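/- **Setting.** Let $d\ge 3$, let $\Sigma$ be a compact smooth manifold of dimension $d-1$ and let $M=\mathbb R\times\Sigma$ carry the globally hyperbolic metric $g=\beta\,dt^2-h_t$ of signature $(+,-,\dots,-)$, with $\beta>0$ smooth and $(h_t)_{t\in\mathbb R}$ a smooth one-parameter family of Riemannian metrics on $\Sigma$; $M$ is time-oriented by $\partial_t$. Put $\Sigma_t=\{t\}\times\Sigma$, with inclusion $\iota_t:\Sigma_t\to M$, and $T'\Sigma=T^*\Sigma\setminus 0$. *Normal neighbourhoods and world function.* Choose for every $Z\in M$ a geodesic normal neighbourhood $\mathcal N(Z)$ of $Z$ (the diffeomorphic image under $\exp_Z$ of a star-shaped subset of $T_ZM$ containing $0$), depending smoothly on $Z$, i.e. such that $\{(Z,X): X\in\mathcal N(Z)\}$ is open in $M\times M$ and $(Z,X)\mapsto\exp_Z^{-1}(X)$ is smooth on it. For $X\in\mathcal N(Z)$ let $\sigma(X,Z)=\frac12\int_0^1 g(\dot\gamma,\dot\gamma)\,d\lambda$ be the Synge world function, where $\gamma(\lambda)=\exp_Z(\lambda\exp_Z^{-1}(X))$. *Flow.* For $s\in\mathbb R$,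 $(y,\eta)\in T'\Sigma$ let $\|\eta\|_{\Sigma_s}=(h_s^{\alpha\beta}(y)\eta_\alpha\eta_\beta)^{1/2}$ and let $\eta_+$ be the unique future pointing null covector at $(s,y)$ with $\iota_s^*\eta_+=\eta$. Let $X^*(\tau;s,y,\eta)=(\tau,x^*(\tau;s,y,\eta))$ be the null geodesic from $(s,y)$ with initial cotangent vector $\eta_+/\|\eta\|_{\Sigma_s}$, reparameterised by the global time $\tau\in\mathbb R$, let $\Xi^*(\tau;s,y,\eta)$ be the parallel transport of $\eta_+$ along it, and let $\xi^*(\tau;s,y,\eta)=\iota_\tau^*\Xi^*(\tau;s,y,\eta)$. *Phase function.* Let $\epsilon>0$. Let $\varphi=\varphi(\tau,x;s,y,\eta)$ be a smooth complex-valued function on $M\times\mathbb R\times T'\Sigma$ such that, with $X=(\tau,x)$ and $X^*=X^*(\tau;s,y,\eta)$, $$\varphi(\tau,x;s,y,\eta)=-\langle\Xi^*(\tau;s,y,\eta),\operatorname{grad}_Z\sigma(X,Z)|_{Z=X^*}\rangle-i\,\epsilon\,\|\eta\|_{\Sigma_s}\,\sigma(X,X^*)\qquad\text{whenever }X\in\mathcal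 N(X^*),$$ and such that elsewhere (where $X\notin\mathcal N(X^*)$) it is an arbitrary smooth continuation that is positively homogeneous of degree one in $\eta$ and has non-negative imaginary part. Any such $\varphi$ is called a Lorentzian Levi-Civita phase function. **Proposition.** Every Lorentzian Levi-Civita phase function $\varphi$ has the following properties. (a) $\varphi(\tau,x;s,y,\lambda\eta)=\lambda\,\varphi(\tau,x;s,y,\eta)$ for all $\lambda>0$ and all $(\tau,x;s,y,\eta)\in M\times\mathbb R\times T'\Sigma$. (b) $\operatorname{Im}\varphi\ge0$ everywhere and, for all $\tau,s\in\mathbb R$ and $(y,\eta)\in T'\Sigma$, $$\varphi(\tau,x^*(\tau;s,y,\eta);s,y,\eta)=0,\qquad \varphi_{x^\alpha}(\tau,x^*(\tau;s,y,\eta);s,y,\eta)=\xi^*_\alpha(\tau;s,y,\eta),\qquad \det\varphi_{x^\alpha\eta_\beta}(\tau,x^*(\tau;s,y,\eta);s,y,\eta)\ne0.$$ (c) Let $\Phi=\{(\tau,x^*(\tau;s,y,\eta);s,y,\eta): \tau,s\in\mathbb R,\ (y,\eta)\in T'\Sigma\}$ and $\mathfrak C_\varphi=\{(\tau,x;s,y,\eta)\in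 M\times\mathbb R\times T'\Sigma:\varphi_\eta(\tau,x;s,y,\eta)=0\}$. Then $\Phi\subseteq\mathfrak C_\varphi$, and there is a neighbourhood $W$ of $\Phi$ with $\mathfrak C_\varphi\cap(W\setminus\Phi)=\emptyset$. -/

import Mathlib

open Set Topology Bundle
open scoped Manifold ContDiff

noncomputable section

namespace LorentzianPhase

/-- The standing geometric data: a manifold `M = ℝ × S` with the metric `g = β dt² - h_t` of
signature `(+, -, …, -)`, where `β > 0` is smooth and `h_t` is a smooth one-parameter family of
Riemannian metrics on `S`. (If `S` is compact, every such metric is globally hyperbolic and all the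
slices `{t} × S` are Cauchy surfaces.) The time orientation is given by `∂_t`. -/
structure Spacetime (n : ℕ) (S : Type*) [TopologicalSpace S]
    [ChartedSpace (EuclideanSpace ℝ (Fin n)) S] [IsManifold (𝓡 n) ∞ S] where
  β : ℝ × S → ℝ
  β_pos : ∀ X, 0 < β X
  β_smooth : ContMDiff (𝓘(ℝ, ℝ).prod (𝓡 n)) 𝓘(ℝ, ℝ) ∞ β
  h : ℝ → ContMDiffRiemannianMetric (𝓡 n) ∞ (EuclideanSpace ℝ (Fin n))
    (fun x : S => TangentSpace (𝓡 n) x)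
  h_smooth : ContMDiff (𝓘(ℝ, ℝ).prod (𝓡 n))
    ((𝓡 n).prod 𝓘(ℝ, EuclideanSpace ℝ (Fin n) →L[ℝ] EuclideanSpace ℝ (Fin n) →L[ℝ] ℝ)) ∞
    (fun X : ℝ × S =>
      (⟨X.2, (h X.1).inner X.2⟩ : TotalSpace
        (EuclideanSpace ℝ (Fin n) →L[ℝ] EuclideanSpace ℝ (Fin n) →L[ℝ] ℝ)
        (fun x : S => TangentSpace (𝓡 n) x →L[ℝ] TangentSpace (𝓡 n) x →L[ℝ] ℝ)))

section Basic

variable (n : ℕ) {S : Type*} [TopologicalSpace S] [ChartedSpace (EuclideanSpace ℝ (Fin n)) S]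

/-- The model vector space of `S`. -/
abbrev E : Type := EuclideanSpace ℝ (Fin n)

/-- `T_x S`. -/
abbrev TanS (x : S) : Type := TangentSpace (𝓡 n) x

/-- `T*_x S`. -/
abbrev CotS (x : S) : Type := TangentSpace (𝓡 n) x →L[ℝ] ℝ

/-- The cotangent bundle `T*S`, with Mathlib's topology and smooth structure of a bundle of
continuous linear maps. -/
abbrev CotBundle (S : Type*) [TopologicalSpace S] [ChartedSpace (EuclideanSpace ℝ (Fin n)) S] :=
  TotalSpace (E n →L[ℝ] ℝ) (fun x : S => TangentSpace (𝓡 n) x →L[ℝ] ℝ)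

/-- `T_X M` for `M = ℝ × S`, in the form of the splitting `T_X M = T_t ℝ ⊕ T_x S`. -/
abbrev TanM (X : ℝ × S) : Type := ℝ × TangentSpace (𝓡 n) X.2

/-- `T*_X M`. -/
abbrev CotM (X : ℝ × S) : Type := TanM n X →L[ℝ] ℝ

/-- The differential of a real function on `M` at `X`. -/
def dM (f : ℝ × S → ℝ) (X : ℝ × S) : CotM n X :=
  mfderiv (𝓘(ℝ, ℝ).prod (𝓡 n)) 𝓘(ℝ, ℝ) f X

/-- The velocity of a curve in `M`. -/
def velocity (γ : ℝ → ℝ × S) (r : ℝ) : TanM n (γ r) :=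
  (deriv (fun r' => (γ r').1) r, mfderiv 𝓘(ℝ, ℝ) (𝓡 n) (fun r' => (γ r').2) r (1 : ℝ))

/-- The coordinates of a point of `M` in the chart `id × (chart of S centred at c)`. -/
def coordPt (c : S) (X : ℝ × S) : ℝ × E n := (X.1, extChartAt (𝓡 n) c X.2)

/-- The components of a tangent vector of `M` at `X` in that chart. -/
def coordVec (c : S) (X : ℝ × S) (v : TanM n X) : ℝ × E n :=
  (v.1, mfderiv (𝓡 n) 𝓘(ℝ, E n) (extChartAt (𝓡 n) c) X.2 v.2)

/-- The tangent vector of `S` at the point with coordinates `u` whose components are `v`. -/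
def ofCoord (c : S) (u v : E n) : TanS n ((extChartAt (𝓡 n) c).symm u) :=
  mfderiv 𝓘(ℝ, E n) (𝓡 n) (extChartAt (𝓡 n) c).symm u v

end Basic

namespace Spacetime

variable {n : ℕ} {S : Type*} [TopologicalSpace S] [ChartedSpace (EuclideanSpace ℝ (Fin n)) S]
  [IsManifold (𝓡 n) ∞ S] (g : Spacetime n S)

/-! ### Metric, musical isomorphisms -/

/-- The Lorentzian metric `g = β dt² - h_t`. -/
def metric (X : ℝ × S) (v w : TanM n X) : ℝ :=
  g.β X * v.1 * w.1 - (g.h X.1).inner X.2 v.2 w.2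

theorem h_injective (s : ℝ) (y : S) :
    Function.Injective ((g.h s).inner y : TanS n y →ₗ[ℝ] (TanS n y →L[ℝ] ℝ)) := by
  rw [← LinearMap.ker_eq_bot, LinearMap.ker_eq_bot']
  intro v hv
  by_contra hne
  have h1 := (g.h s).pos y v hne
  have h2 : (g.h s).inner y v v = 0 := by
    have := congrArg (fun L : TanS n y →L[ℝ] ℝ => L v) hv
    exact this
  exact absurd h2 h1.ne'

theorem h_bijective (s : ℝ) (y : S) :
    Function.Bijective ((g.h s).inner y : TanS n y →ₗ[ℝ] CotS n y) := by
  have : FiniteDimensional ℝ (TanS n y) :=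
    inferInstanceAs (FiniteDimensional ℝ (EuclideanSpace ℝ (Fin n)))
  have : FiniteDimensional ℝ (CotS n y) :=
    inferInstanceAs (FiniteDimensional ℝ (EuclideanSpace ℝ (Fin n) →L[ℝ] ℝ))
  have hdim : Module.finrank ℝ (TanS n y) = Module.finrank ℝ (CotS n y) := by
    change Module.finrank ℝ (EuclideanSpace ℝ (Fin n)) =
      Module.finrank ℝ (EuclideanSpace ℝ (Fin n) →L[ℝ] ℝ)
    rw [← (LinearMap.toContinuousLinearMap
      (𝕜 := ℝ) (E := EuclideanSpace ℝ (Fin n)) (F' := ℝ)).finrank_eq]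
    exact (Subspace.dual_finrank_eq (K := ℝ) (V := EuclideanSpace ℝ (Fin n))).symm
  exact ⟨g.h_injective s y,
    (LinearMap.injective_iff_surjective_of_finrank_eq_finrank hdim).1 (g.h_injective s y)⟩

/-- The isomorphism `v ↦ h_s(v, ·)` of `T_y S` onto `T*_y S`. -/
def hFlat (s : ℝ) (y : S) : TanS n y ≃ₗ[ℝ] CotS n y :=
  LinearEquiv.ofBijective ((g.h s).inner y : TanS n y →ₗ[ℝ] CotS n y) (g.h_bijective s y)

/-- The norm `‖η‖ = (h_s^{αβ}(y) η_α η_β)^{1/2}` of a covector at `y`. -/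
def conorm (s : ℝ) (y : S) (η : CotS n y) : ℝ :=
  Real.sqrt (η ((g.hFlat s y).symm η))

/-- The pull-back of a covector at `X = (t, x)` to the slice `{t} × S`. -/
def restrict (X : ℝ × S) (Ξ : CotM n X) : CotS n X.2 :=
  Ξ.comp (ContinuousLinearMap.inr ℝ ℝ (TanS n X.2))

/-- The vector `Ξ^♯` which is `g`-dual to the covector `Ξ`. -/
def sharp (X : ℝ × S) (Ξ : CotM n X) : TanM n X :=
  (Ξ (1, 0) / g.β X, -((g.hFlat X.1 X.2).symm (restrict X Ξ)))

theorem metric_sharp (X : ℝ × S) (Ξ : CotM n X) (w : TanM n X) :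
    g.metric X (g.sharp X Ξ) w = Ξ w := by
  have hβ : g.β X ≠ 0 := (g.β_pos X).ne'
  have h1 : (g.h X.1).inner X.2 ((g.hFlat X.1 X.2).symm (restrict X Ξ)) w.2 = Ξ (0, w.2) := by
    have h2 : g.hFlat X.1 X.2 ((g.hFlat X.1 X.2).symm (restrict X Ξ)) = restrict X Ξ :=
      LinearEquiv.apply_symm_apply _ _
    exact congrArg (fun L : CotS n X.2 => L w.2) h2
  have h3 : Ξ w = w.1 * Ξ (1, 0) + Ξ (0, w.2) := by
    have : w = w.1 • ((1, 0) : TanM n X) + (0, w.2) := by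
      ext <;> simp
    conv_lhs => rw [this]
    rw [map_add, map_smul, smul_eq_mul]
  rw [h3, ← h1]
  simp only [metric, sharp, map_neg, neg_apply]
  field_simp
  ring

/-- The gradient `(df)^♯` of a function on `M`. -/
def grad (f : ℝ × S → ℝ) (X : ℝ × S) : TanM n X := g.sharp X (dM n f X)

/-- The covector `η_+` at `(s, y)`: the future pointing null covector which restricts to `η` on the
slice; see `isNull_iff_eq_nullLift`. -/
def nullLift (s : ℝ) (y : S) (η : CotS n y) : CotM n ((s, y) : ℝ × S) :=
  (Real.sqrt (g.β (s, y)) * g.conorm s y η) • ContinuousLinearMap.fst ℝ ℝ (TanS n y) +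
    η.comp (ContinuousLinearMap.snd ℝ ℝ (TanS n y))

theorem apply_hFlat_symm_self (s : ℝ) (y : S) (η : CotS n y) :
    η ((g.hFlat s y).symm η) =
      (g.h s).inner y ((g.hFlat s y).symm η) ((g.hFlat s y).symm η) := by
  have h2 : g.hFlat s y ((g.hFlat s y).symm η) = η := LinearEquiv.apply_symm_apply _ _
  exact (congrArg (fun L : CotS n y => L ((g.hFlat s y).symm η)) h2).symm

theorem conorm_pos (s : ℝ) (y : S) (η : CotS n y) (hη : η ≠ 0) : 0 < g.conorm s y η := by
  apply Real.sqrt_pos.2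
  rw [g.apply_hFlat_symm_self]
  exact (g.h s).pos y _ (by simpa using hη)

theorem metric_sharp_self (X : ℝ × S) (Ξ : CotM n X) :
    g.metric X (g.sharp X Ξ) (g.sharp X Ξ) =
      Ξ (1, 0) ^ 2 / g.β X - g.conorm X.1 X.2 (restrict X Ξ) ^ 2 := by
  have hβ : g.β X ≠ 0 := (g.β_pos X).ne'
  have hnn : 0 ≤ restrict X Ξ ((g.hFlat X.1 X.2).symm (restrict X Ξ)) := by
    rw [g.apply_hFlat_symm_self]
    by_cases h0 : (g.hFlat X.1 X.2).symm (restrict X Ξ) = 0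
    · simp [h0]
    · exact ((g.h X.1).pos X.2 _ h0).le
  rw [conorm, Real.sq_sqrt hnn, g.apply_hFlat_symm_self]
  simp only [metric, sharp, map_neg, neg_apply]
  field_simp

theorem isNull_iff_eq_nullLift (s : ℝ) (y : S) (η : CotS n y) (hη : η ≠ 0)
    (Ξ : CotM n ((s, y) : ℝ × S)) :
    (restrict (s, y) Ξ = η ∧ g.metric (s, y) (g.sharp (s, y) Ξ) (g.sharp (s, y) Ξ) = 0 ∧
      0 < (g.sharp (s, y) Ξ).1) ↔ Ξ = g.nullLift s y η := by
  have hβ : 0 < g.β (s, y) := g.β_pos _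
  have hc : 0 < g.conorm s y η := g.conorm_pos s y η hη
  rw [metric_sharp_self]
  constructor
  · rintro ⟨h1, h2, h3⟩
    rw [h1] at h2
    have h3' : 0 < Ξ (1, 0) := by
      have h4 : 0 < Ξ (1, 0) / g.β (s, y) := h3
      exact (div_pos_iff_of_pos_right hβ).1 h4
    have h5 : Ξ (1, 0) = Real.sqrt (g.β (s, y)) * g.conorm s y η := by
      have h6 : Ξ (1, 0) ^ 2 = (Real.sqrt (g.β (s, y)) * g.conorm s y η) ^ 2 := by
        rw [mul_pow, Real.sq_sqrt hβ.le]
        have h7 : Ξ (1, 0) ^ 2 / g.β (s, y) = g.conorm s y η ^ 2 := sub_eq_zero.1 h2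
        field_simp at h7
        exact h7
      exact (sq_eq_sq₀ h3'.le (by positivity)).1 h6
    refine ContinuousLinearMap.ext fun w => ?_
    have h8 : Ξ w = w.1 * Ξ (1, 0) + Ξ (0, w.2) := by
      have : w = w.1 • ((1, 0) : TanM n ((s, y) : ℝ × S)) + (0, w.2) := by
        ext <;> simp
      conv_lhs => rw [this]
      rw [map_add, map_smul, smul_eq_mul]
    have h9 : Ξ (0, w.2) = η w.2 := congrArg (fun L : CotS n y => L w.2) h1
    rw [h8, h9, h5]
    change _ = Real.sqrt (g.β (s, y)) * g.conorm s y η * w.1 + η w.2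
    ring
  · rintro rfl
    have h1 : restrict (s, y) (g.nullLift s y η) = η := by
      refine ContinuousLinearMap.ext fun w => ?_
      change Real.sqrt (g.β (s, y)) * g.conorm s y η * 0 + η w = η w
      ring
    have h2 : g.nullLift s y η (1, 0) = Real.sqrt (g.β (s, y)) * g.conorm s y η := by
      change Real.sqrt (g.β (s, y)) * g.conorm s y η * 1 + η 0 = _
      simp
    refine ⟨h1, ?_, ?_⟩
    · rw [h1, h2, mul_pow, Real.sq_sqrt hβ.le]
      field_simp
      simp
    · change 0 < g.nullLift s y η (1, 0) / g.β (s, y)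
      rw [h2]
      positivity

/-! ### Levi-Civita connection of `g` in charts, parallel transport, geodesics -/

/-- The metric `g` in the chart of `M` centred at `c`: at the point with coordinates `q`, applied
to vectors with components `v`, `w`. -/
def chartMetric (c : S) (q v w : ℝ × E n) : ℝ :=
  g.metric (q.1, (extChartAt (𝓡 n) c).symm q.2) (v.1, ofCoord n c q.2 v.2)
    (w.1, ofCoord n c q.2 w.2)

/-- Christoffel symbols of the first kind `Γ_{dab} v^a w^b z^d`, where
`Γ_{dab} = (∂_a g_{bd} + ∂_b g_{ad} - ∂_d g_{ab}) / 2`. -/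
def christoffel (c : S) (q v w z : ℝ × E n) : ℝ :=
  (fderiv ℝ (fun q' => g.chartMetric c q' w z) q v +
    fderiv ℝ (fun q' => g.chartMetric c q' v z) q w -
    fderiv ℝ (fun q' => g.chartMetric c q' v w) q z) / 2

/-- The vector field `U` along the curve `γ` is parallel on `I`: in every chart,
`g_{da} (dU^a/dr + Γ^a_{bc} (dγ^b/dr) U^c) = 0`. -/
def IsParallelOn (γ : ℝ → ℝ × S) (U : (r : ℝ) → TanM n (γ r)) (I : Set ℝ) : Prop :=
  ∀ r ∈ I, ∀ c : S, (γ r).2 ∈ (chartAt (EuclideanSpace ℝ (Fin n)) c).source →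
    DifferentiableAt ℝ (fun r' => coordVec n c (γ r') (U r')) r ∧
    ∀ z : ℝ × E n,
      g.chartMetric c (coordPt n c (γ r)) (deriv (fun r' => coordVec n c (γ r') (U r')) r) z +
      g.christoffel c (coordPt n c (γ r)) (deriv (fun r' => coordPt n c (γ r')) r)
        (coordVec n c (γ r) (U r)) z = 0

/-- Affinely parameterised geodesics of `g`. -/
def IsGeodesicOn (γ : ℝ → ℝ × S) (I : Set ℝ) : Prop :=
  ContMDiffOn 𝓘(ℝ, ℝ) (𝓘(ℝ, ℝ).prod (𝓡 n)) 2 γ I ∧ g.IsParallelOn γ (velocity n γ) I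

/-! ### Exponential map, normal neighbourhoods, world function -/

/-- `γ` is a geodesic, defined on an open set containing `[0,1]`, with `γ(0) = Z`, `γ'(0) = v`. -/
def IsGeodesicFrom (Z : ℝ × S) (v : TanM n Z) (γ : ℝ → ℝ × S) : Prop :=
  (∃ I : Set ℝ, IsOpen I ∧ Icc 0 1 ⊆ I ∧ g.IsGeodesicOn γ I) ∧
    (⟨γ 0, velocity n γ 0⟩ : Σ X : ℝ × S, TanM n X) = ⟨Z, v⟩

open Classical in
/-- The geodesic on `[0,1]` with initial point `Z` and initial velocity `v`
(a constant curve if there is none). -/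
def geodesic (Z : ℝ × S) (v : TanM n Z) : ℝ → ℝ × S :=
  if hγ : ∃ γ, g.IsGeodesicFrom Z v γ then hγ.choose else fun _ => Z

/-- `v` lies in the domain of `exp_Z`. -/
def ExpDefined (Z : ℝ × S) (v : TanM n Z) : Prop := ∃ γ, g.IsGeodesicFrom Z v γ

/-- The exponential map. -/
def exp (Z : ℝ × S) (v : TanM n Z) : ℝ × S := g.geodesic Z v 1

/-- A choice of a geodesic normal neighbourhood `nhd Z` of every point `Z` of `M`, depending
smoothly on `Z`: `exp_Z` maps the star-shaped set `{log Z X | X ∈ nhd Z}` of `T_Z M`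
diffeomorphically onto `nhd Z`, with inverse `log Z`, the set of all `(Z, X)` with `X ∈ nhd Z` is
an open neighbourhood of the diagonal of `M × M`, and `log Z X` is smooth in `(Z, X)` there. -/
structure NormalNeighbourhoods where
  nhd : ℝ × S → Set (ℝ × S)
  log : (Z : ℝ × S) → ℝ × S → TanM n Z
  isOpen_nhd : IsOpen {p : (ℝ × S) × (ℝ × S) | p.2 ∈ nhd p.1}
  mem_nhd : ∀ Z, Z ∈ nhd Z
  expDefined_log : ∀ Z, ∀ X ∈ nhd Z, g.ExpDefined Z (log Z X)
  exp_log : ∀ Z, ∀ X ∈ nhd Z, g.exp Z (log Z X) = X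
  star_shaped : ∀ Z, ∀ X ∈ nhd Z, ∀ r ∈ Icc (0 : ℝ) 1,
    g.exp Z (r • log Z X) ∈ nhd Z ∧ log Z (g.exp Z (r • log Z X)) = r • log Z X
  log_smooth_fst : ContMDiffOn
    ((𝓘(ℝ, ℝ).prod (𝓡 n)).prod (𝓘(ℝ, ℝ).prod (𝓡 n))) 𝓘(ℝ, ℝ) ∞
    (fun p : (ℝ × S) × (ℝ × S) => (log p.1 p.2).1) {p | p.2 ∈ nhd p.1}
  log_smooth_snd : ContMDiffOn
    ((𝓘(ℝ, ℝ).prod (𝓡 n)).prod (𝓘(ℝ, ℝ).prod (𝓡 n))) (𝓡 n).tangent ∞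
    (fun p : (ℝ × S) × (ℝ × S) => (⟨p.1.2, (log p.1 p.2).2⟩ : TangentBundle (𝓡 n) S))
    {p | p.2 ∈ nhd p.1}

variable {g} in
/-- Synge's world function `σ(X, Z) = ½ ∫_0^1 g(γ', γ') dr`, where `γ` is the geodesic in the
normal neighbourhood of `Z` with `γ(0) = Z` and `γ(1) = X`. -/
def NormalNeighbourhoods.worldFunction (N : g.NormalNeighbourhoods) (X Z : ℝ × S) : ℝ :=
  1 / 2 * ∫ r in (0 : ℝ)..1,
    g.metric (g.geodesic Z (N.log Z X) r) (velocity n (g.geodesic Z (N.log Z X)) r)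
      (velocity n (g.geodesic Z (N.log Z X)) r)

/-! ### The Levi-Civita flow -/

/-- `p = (X, Ξ)` is the point at time `τ` on the Levi-Civita flow starting from `(s, y, η)`: there
is a geodesic `γ` with `γ(s) = (s, y)` and initial cotangent vector `η_+ / ‖η‖`, a covector field
`Θ` along `γ` which is parallel (that is, `Θ^♯` is parallel) with `Θ(s) = η_+`, and
`p = (γ(r), Θ(r))` for a parameter `r` at which the time coordinate of `γ(r)` is `τ`. -/
def IsFlowAt (τ s : ℝ) (y : S) (η : CotS n y) (p : Σ X : ℝ × S, CotM n X) : Prop :=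
  ∃ (I : Set ℝ) (γ : ℝ → ℝ × S) (Θ : (r : ℝ) → CotM n (γ r)),
    IsOpen I ∧ I.OrdConnected ∧ s ∈ I ∧ g.IsGeodesicOn γ I ∧
    (⟨γ s, velocity n γ s⟩ : Σ X : ℝ × S, TanM n X) =
      ⟨(s, y), g.sharp (s, y) ((g.conorm s y η)⁻¹ • g.nullLift s y η)⟩ ∧
    g.IsParallelOn γ (fun r => g.sharp (γ r) (Θ r)) I ∧
    (⟨γ s, Θ s⟩ : Σ X : ℝ × S, CotM n X) = ⟨(s, y), g.nullLift s y η⟩ ∧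
    ∃ r ∈ I, (γ r).1 = τ ∧ p = ⟨γ r, Θ r⟩

open Classical in
/-- The Levi-Civita flow `(X*(τ; s, y, η), Ξ*(τ; s, y, η))`, parameterised by the global time
coordinate. (The second branch of the definition never occurs for compact `S` and `η ≠ 0`.) -/
def flow (τ s : ℝ) (y : S) (η : CotS n y) : Σ X : ℝ × S, CotM n X :=
  if hp : ∃ p, g.IsFlowAt τ s y η p then hp.choose else ⟨(τ, y), 0⟩

/-- `X*(τ; s, y, η)`. -/
def flowX (τ s : ℝ) (y : S) (η : CotS n y) : ℝ × S := (g.flow τ s y η).1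

/-- `Ξ*(τ; s, y, η)`. -/
def flowΞ (τ s : ℝ) (y : S) (η : CotS n y) : CotM n (g.flowX τ s y η) := (g.flow τ s y η).2

/-- `x*(τ; s, y, η)`, the component of `X* = (τ, x*)` in `S`. -/
def flowx (τ s : ℝ) (y : S) (η : CotS n y) : S := (g.flowX τ s y η).2

/-- `ξ*(τ; s, y, η)`, the pull-back of `Ξ*` to the slice `{τ} × S`. -/
def flowξ (τ s : ℝ) (y : S) (η : CotS n y) : CotS n (g.flowx τ s y η) :=
  restrict (g.flowX τ s y η) (g.flowΞ τ s y η)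

/-! ### The phase function -/

variable {g} in
/-- `φ`, a function of `((τ, x), s, (y, η))`, is a Lorentzian Levi-Civita phase function with
parameter `ε`. It is smooth on `M × ℝ × T'S`, it is given by
`φ = -⟨Ξ*, grad_Z σ(X, Z)|_{Z = X*}⟩ - i ε ‖η‖ σ(X, X*)` when `X = (τ, x)` lies in the normal
neighbourhood of `X* = X*(τ; s, y, η)`, and elsewhere it is an arbitrary smooth continuation which
is positively homogeneous and has non-negative imaginary part. Only the values of `φ` at `η ≠ 0`
matter. The sign of the imaginary part fits the signature `(+, -, …, -)`, in which the world
function is non-positive at points with a spacelike separation. -/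
structure IsLeviCivitaPhase (N : g.NormalNeighbourhoods) (ε : ℝ)
    (φ : (ℝ × S) × ℝ × CotBundle n S → ℂ) : Prop where
  smooth : ContMDiffOn
    ((𝓘(ℝ, ℝ).prod (𝓡 n)).prod (𝓘(ℝ, ℝ).prod ((𝓡 n).prod 𝓘(ℝ, E n →L[ℝ] ℝ)))) 𝓘(ℝ, ℂ) ∞
    φ {p | p.2.2.2 ≠ 0}
  formula : ∀ (τ : ℝ) (x : S) (s : ℝ) (y : S) (η : CotS n y), η ≠ 0 →
    (τ, x) ∈ N.nhd (g.flowX τ s y η) →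
    φ ((τ, x), s, ⟨y, η⟩) =
      -((g.flowΞ τ s y η (g.grad (fun Z => N.worldFunction (τ, x) Z) (g.flowX τ s y η)) : ℝ) : ℂ) -
        Complex.I * ((ε * g.conorm s y η * N.worldFunction (τ, x) (g.flowX τ s y η) : ℝ) : ℂ)
  continuation_homogeneous : ∀ (τ : ℝ) (x : S) (s : ℝ) (y : S) (η : CotS n y), η ≠ 0 →
    (τ, x) ∉ N.nhd (g.flowX τ s y η) → ∀ c : ℝ, 0 < c →
    φ ((τ, x), s, ⟨y, c • η⟩) = (c : ℂ) * φ ((τ, x), s, ⟨y, η⟩)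
  continuation_im_nonneg : ∀ (τ : ℝ) (x : S) (s : ℝ) (y : S) (η : CotS n y), η ≠ 0 →
    (τ, x) ∉ N.nhd (g.flowX τ s y η) → 0 ≤ (φ ((τ, x), s, ⟨y, η⟩)).im

/-- The set `Φ` of all `((τ, x*(τ; s, y, η)), s, (y, η))`. -/
def flowSet : Set ((ℝ × S) × ℝ × CotBundle n S) :=
  {p | ∃ (τ s : ℝ) (y : S) (η : CotS n y), η ≠ 0 ∧ p = ((τ, g.flowx τ s y η), s, ⟨y, η⟩)}

end Spacetime

section Phase

variable {n : ℕ} {S : Type*} [TopologicalSpace S] [ChartedSpace (EuclideanSpace ℝ (Fin n)) S]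

/-- The derivative of `φ` at `(X; s, y, η)` in the direction `ζ` of the fibre variable `η`. -/
def dη (φ : (ℝ × S) × ℝ × CotBundle n S → ℂ) (X : ℝ × S) (s : ℝ) (y : S) (η ζ : CotS n y) : ℂ :=
  deriv (fun r : ℝ => φ (X, s, ⟨y, η + r • ζ⟩)) 0

/-- The differential in `x` of a function of the form `x ↦ f x` on `S`. -/
def dx (f : S → ℂ) (x : S) (v : TanS n x) : ℂ := mfderiv (𝓡 n) 𝓘(ℝ, ℂ) f x v

/-- The critical set `{φ_η = 0}` in `M × ℝ × T'S`. -/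
def criticalSet (φ : (ℝ × S) × ℝ × CotBundle n S → ℂ) : Set ((ℝ × S) × ℝ × CotBundle n S) :=
  {p | p.2.2.2 ≠ 0 ∧ ∀ ζ, dη φ p.1 p.2.1 p.2.2.1 p.2.2.2 ζ = 0}

end Phase

end LorentzianPhase

end

/-! Two facts carry the proof: the second-order expansion of the world function at coinciding
points, and the symplectic nature of the null geodesic flow.

World function. Write `ℓ(Z, X) = exp_Z⁻¹ X` in a chart. Geodesics have constant energy, so `σ(X, Z)
= ½ g_Z(ℓ, ℓ)` (`worldFunction_eq`). On the diagonal `ℓ` vanishes with differential `dX - dZ`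
(`hasStrictFDerivAt_logC`), hence `σ` vanishes there to second order with Hessian `g(dX - dZ, dX -
dZ)` (`fderiv_fderiv_quadWorld`). Inserted into the formula for the phase, this gives `φ = 0`, `φ_x
= ξ*` and `Im φ_xx = ε‖η‖ h > 0` on the flow (`phase_derivatives`). The sign of `Im φ` near the flow
comes from Rolle's theorem: a geodesic joining two points of one slice is somewhere tangent to a
slice, so its constant energy is nonpositive (`worldFunction_nonpos`).

Flow. Let `A` and `Ξ` be the derivatives of `x*` and `ξ*` in `η`, the remaining arguments being
fixed. The first variation formula for null geodesics gives `⟨ξ*, A ζ⟩ = 0`, because the initial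
point does not move with `η` (`IsLocalExp.first_variation`). Since the flow can be run backwards, `A
ζ = 0` and `Ξ ζ = 0` together force `ζ = 0` (`fderiv_stateParam_injective`).

Combination. Differentiating `φ(x*(η), η) = 0` and using `φ_x = ξ*` leaves `φ_η = -⟨ξ*, A ·⟩ = 0` on
the flow. Differentiating once more the identities `φ_x = ξ*` and `φ_η = 0` along the flow relates
the blocks of the Hessian to `A` and `Ξ`. If `φ_xη` annihilates `a + ib`, these relations give `Im
φ_xx(Aa, Aa) + Im φ_xx(Ab, Ab) = 0`, so `Aa = Ab = 0`, then `Ξa = Ξb = 0`, and `a = b = 0`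
(`hessian_nondegenerate`). The same nondegeneracy makes `(t, x, s, y, η) ↦ (t, s, y, η, φ_η)`
injective near a flow point; a nearby critical point and the flow point over the same parameters
have the same image, so they coincide (`eventually_mem_flowSet`).

Regularity of the flow. The smooth datum is `ℓ`, so the inverse function theorem applied to `(Z, X)
↦ (Z, ℓ(Z, X))` produces a local `C²` exponential map (`exists_isLocalExp`). It gives `C¹`
dependence of null geodesics on their data for short times, uniformly over compact time intervals
because `S` is compact, and finitely many steps reach every time (`exists_isPropagation`).
Homogeneity reduces to the scaling of geodesics by a positive factor. -/

section

set_option maxSynthPendingDepth 3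
set_option linter.unusedSectionVars false

noncomputable section

namespace LorentzianPhase

/-! ### Charts of `ℝ × S`, components of tangent vectors, changes of coordinates -/

section Charts

variable {n : ℕ} {S : Type*} [TopologicalSpace S] [ChartedSpace (EuclideanSpace ℝ (Fin n)) S]

/-- Every `TanM n X` unfolds to the fixed space `ℝ × E n`, so vectors over different points can be
compared without transport. The model-space versions of the geometric objects used below rest on
this. -/
theorem sigma_tanM_eq_iff {X Y : ℝ × S} {v : TanM n X} {w : TanM n Y} :
    (⟨X, v⟩ : Σ X : ℝ × S, TanM n X) = ⟨Y, w⟩ ↔ X = Y ∧ @Eq (ℝ × E n) v w := by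
  constructor
  · intro h
    cases h
    exact ⟨rfl, rfl⟩
  · rintro ⟨rfl, h⟩
    exact congrArg (Sigma.mk X) h

variable (n) in
/-- The point of `M` with coordinates `q` in the chart `id × (chart of S centred at c)`. -/
def pt (c : S) (q : ℝ × E n) : ℝ × S := (q.1, (extChartAt (𝓡 n) c).symm q.2)

variable (n) in
/-- The range of the chart `id × (chart of S centred at c)`. -/
def chartDom (c : S) : Set (ℝ × E n) := {q | q.2 ∈ (extChartAt (𝓡 n) c).target}

variable (n) in
/-- The differential of the chart of `S` centred at `c`. -/
def chartD (c x : S) : E n →L[ℝ] E n := mfderiv (𝓡 n) 𝓘(ℝ, E n) (extChartAt (𝓡 n) c) x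

variable (n) in
/-- The differential of the inverse of the chart of `S` centred at `c`. -/
def chartDsymm (c : S) (u : E n) : E n →L[ℝ] E n :=
  mfderiv 𝓘(ℝ, E n) (𝓡 n) (extChartAt (𝓡 n) c).symm u

variable (n) in
/-- The tangent vector at `pt c q` with components `p`. -/
def vec (c : S) (q p : ℝ × E n) : ℝ × E n := (p.1, chartDsymm n c q.2 p.2)

variable (n) in
/-- The components of a tangent vector of `M` at `X` in the chart centred at `c`. -/
def cvec (c : S) (X : ℝ × S) (v : ℝ × E n) : ℝ × E n := (v.1, chartD n c X.2 v.2)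

theorem cvec_def (c : S) (X : ℝ × S) (v : ℝ × E n) :
    cvec n c X v = (v.1, chartD n c X.2 v.2) := rfl

theorem isOpen_chartDom (c : S) : IsOpen (chartDom n c) :=
  (isOpen_extChartAt_target c).preimage continuous_snd

theorem pt_coordPt {c : S} {X : ℝ × S} (h : X.2 ∈ (chartAt (EuclideanSpace ℝ (Fin n)) c).source) :
    pt n c (coordPt n c X) = X := by
  rw [← extChartAt_source (𝓡 n)] at h
  exact Prod.ext rfl ((extChartAt (𝓡 n) c).left_inv h)

theorem coordPt_mem {c : S} {X : ℝ × S}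
    (h : X.2 ∈ (chartAt (EuclideanSpace ℝ (Fin n)) c).source) : coordPt n c X ∈ chartDom n c := by
  rw [← extChartAt_source (𝓡 n)] at h
  exact (extChartAt (𝓡 n) c).map_source h

theorem pt_mem {c : S} {q : ℝ × E n} (h : q ∈ chartDom n c) :
    (pt n c q).2 ∈ (chartAt (EuclideanSpace ℝ (Fin n)) c).source := by
  rw [← extChartAt_source (𝓡 n)]
  exact (extChartAt (𝓡 n) c).map_target h

theorem coordPt_pt {c : S} {q : ℝ × E n} (h : q ∈ chartDom n c) : coordPt n c (pt n c q) = q :=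
  Prod.ext rfl ((extChartAt (𝓡 n) c).right_inv h)

theorem continuousOn_pt (c : S) : ContinuousOn (pt n c) (chartDom n c) :=
  continuousOn_fst.prodMk ((continuousOn_extChartAt_symm c).comp continuousOn_snd fun _ h => h)

theorem continuousAt_coordPt {c : S} {X : ℝ × S}
    (h : X.2 ∈ (chartAt (EuclideanSpace ℝ (Fin n)) c).source) :
    ContinuousAt (coordPt n c) X := by
  rw [← extChartAt_source (𝓡 n)] at h
  exact continuousAt_fst.prodMk
    ((continuousAt_extChartAt' (I := 𝓡 n) h).comp (f := Prod.snd) continuousAt_snd)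

variable (n) in
/-- The change of coordinates from the chart centred at `c` to the chart centred at `c'`. -/
def trans (c c' : S) (q : ℝ × E n) : ℝ × E n := coordPt n c' (pt n c q)

theorem trans_coordPt {c c' : S} {X : ℝ × S}
    (h : X.2 ∈ (chartAt (EuclideanSpace ℝ (Fin n)) c).source) :
    trans n c c' (coordPt n c X) = coordPt n c' X := by
  rw [trans, pt_coordPt h]

variable [IsManifold (𝓡 n) ∞ S]

theorem chartD_comp_chartDsymm {c : S} {u : E n} (h : u ∈ (extChartAt (𝓡 n) c).target) :
    (chartD n c ((extChartAt (𝓡 n) c).symm u)).comp (chartDsymm n c u) =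
      ContinuousLinearMap.id ℝ (E n) := by
  have := mfderiv_extChartAt_comp_mfderivWithin_extChartAt_symm (I := 𝓡 n) h
  rw [ModelWithCorners.range_eq_univ, mfderivWithin_univ] at this
  exact this

theorem chartDsymm_comp_chartD {c : S} {u : E n} (h : u ∈ (extChartAt (𝓡 n) c).target) :
    (chartDsymm n c u).comp (chartD n c ((extChartAt (𝓡 n) c).symm u)) =
      ContinuousLinearMap.id ℝ (E n) := by
  have := mfderivWithin_extChartAt_symm_comp_mfderiv_extChartAt (I := 𝓡 n) h
  rw [ModelWithCorners.range_eq_univ, mfderivWithin_univ] at this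
  exact this

theorem chartD_chartDsymm {c : S} {u : E n} (h : u ∈ (extChartAt (𝓡 n) c).target) (v : E n) :
    chartD n c ((extChartAt (𝓡 n) c).symm u) (chartDsymm n c u v) = v :=
  congrArg (fun L : E n →L[ℝ] E n => L v) (chartD_comp_chartDsymm h)

theorem chartDsymm_chartD {c : S} {u : E n} (h : u ∈ (extChartAt (𝓡 n) c).target) (v : E n) :
    chartDsymm n c u (chartD n c ((extChartAt (𝓡 n) c).symm u) v) = v :=
  congrArg (fun L : E n →L[ℝ] E n => L v) (chartDsymm_comp_chartD h)

theorem chartD_self (c : S) : chartD n c c = ContinuousLinearMap.id ℝ (E n) :=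
  mfderiv_extChartAt_self (I := 𝓡 n) (x := c)

/-- Tangent spaces are identified with the model space through the preferred chart, hence the chart
centred at `c` has identity differential at `c`. At centres, components and vectors agree on the
nose. -/
theorem chartDsymm_self (c : S) :
    chartDsymm n c (extChartAt (𝓡 n) c c) = ContinuousLinearMap.id ℝ (E n) := by
  have h := chartDsymm_comp_chartD (n := n) (c := c) (mem_extChartAt_target c)
  rw [extChartAt_to_inv, chartD_self] at h
  exact h

theorem cvec_vec {c : S} {q : ℝ × E n} (h : q ∈ chartDom n c) (p : ℝ × E n) :
    cvec n c (pt n c q) (vec n c q p) = p :=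
  Prod.ext rfl (chartD_chartDsymm h p.2)

theorem vec_cvec {c : S} {X : ℝ × S}
    (h : X.2 ∈ (chartAt (EuclideanSpace ℝ (Fin n)) c).source) (v : ℝ × E n) :
    vec n c (coordPt n c X) (cvec n c X v) = v := by
  have h1 := chartDsymm_chartD (coordPt_mem h) v.2
  rw [← extChartAt_source (𝓡 n)] at h
  simp only [coordPt] at h1
  rw [(extChartAt (𝓡 n) c).left_inv h] at h1
  exact Prod.ext rfl h1

theorem contMDiffOn_pt (c : S) :
    ContMDiffOn 𝓘(ℝ, ℝ × E n) (𝓘(ℝ, ℝ).prod (𝓡 n)) ∞ (pt n c) (chartDom n c) :=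
  (contDiff_fst.contMDiff.contMDiffOn).prodMk
    ((contMDiffOn_extChartAt_symm c).comp contDiff_snd.contMDiff.contMDiffOn fun _ h => h)

theorem contMDiffAt_coordPt {c : S} {X : ℝ × S}
    (h : X.2 ∈ (chartAt (EuclideanSpace ℝ (Fin n)) c).source) :
    ContMDiffAt (𝓘(ℝ, ℝ).prod (𝓡 n)) 𝓘(ℝ, ℝ × E n) ∞ (coordPt n c) X := by
  have h2 : ContMDiffAt (𝓘(ℝ, ℝ).prod (𝓡 n)) 𝓘(ℝ, E n) ∞
      (fun X : ℝ × S => extChartAt (𝓡 n) c X.2) X :=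
    (contMDiffAt_extChartAt' (I := 𝓡 n) h).comp X contMDiffAt_snd
  exact contMDiffAt_fst.prodMk_space h2

theorem contDiffAt_trans {c c' : S} {q : ℝ × E n} (h : q ∈ chartDom n c)
    (h' : (pt n c q).2 ∈ (chartAt (EuclideanSpace ℝ (Fin n)) c').source) :
    ContDiffAt ℝ ∞ (trans n c c') q := by
  rw [← contMDiffAt_iff_contDiffAt]
  exact (contMDiffAt_coordPt h').comp q
    ((contMDiffOn_pt c).contMDiffAt ((isOpen_chartDom c).mem_nhds h))

theorem hasFDerivAt_trans {c c' : S} {q : ℝ × E n} (h : q ∈ chartDom n c)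
    (h' : (pt n c q).2 ∈ (chartAt (EuclideanSpace ℝ (Fin n)) c').source) :
    HasFDerivAt (trans n c c') ((ContinuousLinearMap.id ℝ ℝ).prodMap
      ((chartD n c' (pt n c q).2).comp (chartDsymm n c q.2))) q := by
  have h1 : HasMFDerivAt (𝓡 n) 𝓘(ℝ, E n) (extChartAt (𝓡 n) c') (pt n c q).2
      (chartD n c' (pt n c q).2) := (mdifferentiableAt_extChartAt h').hasMFDerivAt
  have h2 : HasMFDerivAt 𝓘(ℝ, E n) (𝓡 n) (extChartAt (𝓡 n) c).symm q.2 (chartDsymm n c q.2) :=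
    (((contMDiffOn_extChartAt_symm (n := ∞) c).contMDiffAt
      ((isOpen_extChartAt_target c).mem_nhds h)).mdifferentiableAt (by simp)).hasMFDerivAt
  have h3 : HasFDerivAt (fun u => extChartAt (𝓡 n) c' ((extChartAt (𝓡 n) c).symm u))
      ((chartD n c' (pt n c q).2).comp (chartDsymm n c q.2)) q.2 :=
    (HasMFDerivAt.comp q.2 h1 h2).hasFDerivAt
  exact (hasFDerivAt_id q.1).prodMap q h3

theorem fderiv_trans_cvec {c c' : S} {X : ℝ × S}
    (h : X.2 ∈ (chartAt (EuclideanSpace ℝ (Fin n)) c).source)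
    (h' : X.2 ∈ (chartAt (EuclideanSpace ℝ (Fin n)) c').source) (v : ℝ × E n) :
    fderiv ℝ (trans n c c') (coordPt n c X) (cvec n c X v) = cvec n c' X v := by
  have h1 : (pt n c (coordPt n c X)).2 ∈ (chartAt (EuclideanSpace ℝ (Fin n)) c').source := by
    rwa [pt_coordPt h]
  rw [(hasFDerivAt_trans (coordPt_mem h) h1).fderiv, pt_coordPt h]
  have h2 := congrArg Prod.snd (vec_cvec h v)
  refine Prod.ext rfl ?_
  change chartD n c' X.2 (vec n c (coordPt n c X) (cvec n c X v)).2 = _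
  rw [h2]
  rfl

end Charts

/-! ### The metric in a chart: nondegeneracy, smoothness, invariance -/

namespace Spacetime

variable {n : ℕ} {S : Type*} [TopologicalSpace S] [ChartedSpace (EuclideanSpace ℝ (Fin n)) S]
  [IsManifold (𝓡 n) ∞ S] (g : Spacetime n S)

/-- The inner product `h_t` at a point of `S`, as a bilinear map on the model space. -/
def hM (X : ℝ × S) : E n →L[ℝ] E n →L[ℝ] ℝ := (g.h X.1).inner X.2

theorem hM_symm (X : ℝ × S) (v w : E n) : g.hM X v w = g.hM X w v := (g.h X.1).symm X.2 v w

theorem hM_pos (X : ℝ × S) {v : E n} (hv : v ≠ 0) : 0 < g.hM X v v := (g.h X.1).pos X.2 v hv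

theorem hM_nonneg (X : ℝ × S) (v : E n) : 0 ≤ g.hM X v v := by
  by_cases hv : v = 0
  · simp [hv]
  · exact (g.hM_pos X hv).le

/-- The metric `g` at a point of `M`, as a bilinear map on the model space. -/
def gM (X : ℝ × S) : (ℝ × E n) →L[ℝ] (ℝ × E n) →L[ℝ] ℝ :=
  g.β X • (ContinuousLinearMap.mul ℝ ℝ).bilinearComp (ContinuousLinearMap.fst ℝ ℝ (E n))
      (ContinuousLinearMap.fst ℝ ℝ (E n)) -
    (g.hM X).bilinearComp (ContinuousLinearMap.snd ℝ ℝ (E n)) (ContinuousLinearMap.snd ℝ ℝ (E n))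

theorem gM_apply (X : ℝ × S) (v w : ℝ × E n) :
    g.gM X v w = g.β X * (v.1 * w.1) - g.hM X v.2 w.2 := rfl

theorem metric_eq (X : ℝ × S) (v w : ℝ × E n) : g.metric X v w = g.gM X v w := by
  rw [gM_apply, ← mul_assoc]
  rfl

theorem gM_symm (X : ℝ × S) (v w : ℝ × E n) : g.gM X v w = g.gM X w v := by
  rw [gM_apply, gM_apply, hM_symm, mul_comm v.1]

theorem gM_nondegenerate (X : ℝ × S) {v : ℝ × E n} (hv : ∀ w, g.gM X v w = 0) : v = 0 := by
  -- Flipping the spatial part of the test vector turns the Lorentzian form into a positive definite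
  -- one.
  have h1 := hv (v.1, -v.2)
  rw [gM_apply, map_neg, sub_neg_eq_add] at h1
  have h2 := mul_nonneg (g.β_pos X).le (mul_self_nonneg v.1)
  have h3 := g.hM_nonneg X v.2
  have h4 : v.2 = 0 := by
    by_contra h
    linarith [g.hM_pos X h]
  have h5 : v.1 = 0 := by
    have : g.β X * (v.1 * v.1) = 0 := by linarith
    simpa [(g.β_pos X).ne'] using this
  exact Prod.ext h5 h4

/-- The metric in a chart, as a bilinear map. -/
def chartG (c : S) (q : ℝ × E n) : (ℝ × E n) →L[ℝ] (ℝ × E n) →L[ℝ] ℝ :=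
  (g.gM (pt n c q)).bilinearComp ((ContinuousLinearMap.id ℝ ℝ).prodMap (chartDsymm n c q.2))
    ((ContinuousLinearMap.id ℝ ℝ).prodMap (chartDsymm n c q.2))

theorem chartG_apply (c : S) (q v w : ℝ × E n) :
    g.chartG c q v w = g.gM (pt n c q) (vec n c q v) (vec n c q w) := rfl

theorem chartMetric_eq (c : S) (q v w : ℝ × E n) : g.chartMetric c q v w = g.chartG c q v w :=
  g.metric_eq _ _ _

theorem chartG_symm (c : S) (q v w : ℝ × E n) : g.chartG c q v w = g.chartG c q w v :=
  g.gM_symm _ _ _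

theorem chartG_cvec {c : S} {X : ℝ × S}
    (h : X.2 ∈ (chartAt (EuclideanSpace ℝ (Fin n)) c).source) (v w : ℝ × E n) :
    g.chartG c (coordPt n c X) (cvec n c X v) (cvec n c X w) = g.gM X v w := by
  rw [chartG_apply, vec_cvec h, vec_cvec h, pt_coordPt h]

theorem chartG_nondegenerate {c : S} {q : ℝ × E n} (hq : q ∈ chartDom n c) {v : ℝ × E n}
    (hv : ∀ w, g.chartG c q v w = 0) : v = 0 := by
  have h : vec n c q v = 0 := by
    refine g.gM_nondegenerate (pt n c q) fun w => ?_
    have := hv (cvec n c (pt n c q) w)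
    rw [chartG_apply] at this
    have h2 := vec_cvec (pt_mem hq) w
    rw [coordPt_pt hq] at h2
    rwa [h2] at this
  rw [← cvec_vec hq v, h, cvec_def]
  simp

theorem contDiffOn_chartG (c : S) : ContDiffOn ℝ ∞ (g.chartG c) (chartDom n c) := by
  rw [contDiffOn_clm_apply]
  intro v
  rw [contDiffOn_clm_apply]
  intro w
  have hβ : ContDiffOn ℝ ∞ (fun q => g.β (pt n c q)) (chartDom n c) := by
    rw [← contMDiffOn_iff_contDiffOn]
    exact g.β_smooth.comp_contMDiffOn (contMDiffOn_pt c)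
  -- The coordinate vector field with constant components `v` is the image of a constant under the
  -- inverse trivialisation of the tangent bundle, so it is a smooth section to which the smooth
  -- metric can be applied.
  have hs : ∀ v : E n, ContMDiffOn 𝓘(ℝ, ℝ × E n) ((𝓡 n).prod 𝓘(ℝ, E n)) ∞
      (fun q : ℝ × E n => TotalSpace.mk' (E n) (E := fun x : S => TangentSpace (𝓡 n) x)
        (pt n c q).2 (chartDsymm n c q.2 v)) (chartDom n c) := by
    intro v
    have h1 : ContMDiffOn 𝓘(ℝ, ℝ × E n) (𝓡 n) ∞ (fun q => (pt n c q).2) (chartDom n c) :=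
      (contMDiffOn_extChartAt_symm c).comp contDiff_snd.contMDiff.contMDiffOn fun _ h => h
    have h2 := ((trivializationAt (E n) (fun x : S => TangentSpace (𝓡 n) x) c).contMDiffOn_symm
      (IB := 𝓡 n) (n := ∞)).comp (h1.prodMk
        (contMDiffOn_const (I' := 𝓘(ℝ, E n)) (c := v))) (s := chartDom n c) fun q hq => by
          rw [mem_preimage, Trivialization.mem_target]
          simpa using pt_mem hq
    refine h2.congr fun q hq => ?_
    have hb : (pt n c q).2 ∈
        (trivializationAt (E n) (fun x : S => TangentSpace (𝓡 n) x) c).baseSet := by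
      simpa using pt_mem hq
    have h3 := TangentBundle.symmL_trivializationAt (𝕜 := ℝ) (I := 𝓡 n) (pt_mem hq)
    rw [ModelWithCorners.range_eq_univ, mfderivWithin_univ] at h3
    have h4 : extChartAt (𝓡 n) c (pt n c q).2 = q.2 := (extChartAt (𝓡 n) c).right_inv hq
    rw [h4] at h3
    rw [Function.comp_apply, ← Trivialization.mk_symm _ hb]
    exact congrArg (TotalSpace.mk' (E n) (E := fun x : S => TangentSpace (𝓡 n) x) (pt n c q).2)
      ((congrArg (fun L : E n →L[ℝ] E n => L v) h3).symm.trans (Trivialization.symmL_apply _ hb _))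
  have hh : ContDiffOn ℝ ∞ (fun q => g.hM (pt n c q) (chartDsymm n c q.2 v.2)
      (chartDsymm n c q.2 w.2)) (chartDom n c) := by
    have h1 : ContMDiffOn 𝓘(ℝ, ℝ × E n) ((𝓡 n).prod 𝓘(ℝ, ℝ)) ∞ (fun q : ℝ × E n =>
        TotalSpace.mk' ℝ (E := Bundle.Trivial S ℝ) (pt n c q).2
          (g.hM (pt n c q) (chartDsymm n c q.2 v.2) (chartDsymm n c q.2 w.2))) (chartDom n c) :=
      ContMDiffOn.clm_bundle_apply₂ (F₁ := E n) (F₂ := E n)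
        (E₁ := fun x : S => TangentSpace (𝓡 n) x) (E₂ := fun x : S => TangentSpace (𝓡 n) x)
        (g.h_smooth.comp_contMDiffOn (contMDiffOn_pt c)) (hs v.2) (hs w.2)
    rw [← contMDiffOn_iff_contDiffOn]
    intro q hq
    have h2 := h1 q hq
    rw [contMDiffWithinAt_totalSpace] at h2
    exact h2.2
  exact (hβ.mul (contDiffOn_const (c := v.1 * w.1))).sub hh

theorem chartG_trans {c c' : S} {q : ℝ × E n} (h : q ∈ chartDom n c)
    (h' : (pt n c q).2 ∈ (chartAt (EuclideanSpace ℝ (Fin n)) c').source) (v w : ℝ × E n) :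
    g.chartG c' (trans n c c' q) (fderiv ℝ (trans n c c') q v) (fderiv ℝ (trans n c c') q w) =
      g.chartG c q v w := by
  have h1 : ∀ v, fderiv ℝ (trans n c c') q v = cvec n c' (pt n c q) (vec n c q v) := by
    intro v
    rw [(hasFDerivAt_trans h h').fderiv]
    rfl
  rw [h1, h1, trans, chartG_cvec g h', chartG_apply]

end Spacetime

/-! ### Christoffel symbols and parallel transport on a vector space -/

section LeviCivita

theorem two_le_infty : (2 : WithTop ℕ∞) ≤ ∞ :=
  WithTop.coe_le_coe.2 (le_top : (2 : ℕ∞) ≤ ⊤)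

variable {V : Type*} [NormedAddCommGroup V] [NormedSpace ℝ V]

/-- The Christoffel symbols of the first kind of a metric `G` on a vector space, as a linear form
in the last argument. -/
def chrisL (G : V → V →L[ℝ] V →L[ℝ] ℝ) (q v w : V) : V →L[ℝ] ℝ :=
  (2⁻¹ : ℝ) • (fderiv ℝ G q v w + fderiv ℝ G q w v - ((fderiv ℝ G q).flip v).flip w)

theorem chrisL_apply (G : V → V →L[ℝ] V →L[ℝ] ℝ) (q v w z : V) : chrisL G q v w z =
    (fderiv ℝ G q v w z + fderiv ℝ G q w v z - fderiv ℝ G q z v w) / 2 := by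
  simp [chrisL]
  ring

theorem fderiv_apply_apply {G : V → V →L[ℝ] V →L[ℝ] ℝ} {q : V} (hG : DifferentiableAt ℝ G q)
    (u v w : V) : fderiv ℝ (fun q' => G q' v w) q u = fderiv ℝ G q u v w := by
  have h := ((hG.hasFDerivAt.clm_apply
    (hasFDerivAt_const v q)).clm_apply (hasFDerivAt_const w q)).fderiv
  rw [h]
  simp

theorem fderiv_symm_of_symm {G : V → V →L[ℝ] V →L[ℝ] ℝ} {q : V} (hG : DifferentiableAt ℝ G q)
    (hs : ∀ q v w, G q v w = G q w v) (u v w : V) : fderiv ℝ G q u v w = fderiv ℝ G q u w v := by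
  rw [← fderiv_apply_apply hG, ← fderiv_apply_apply hG]
  simp only [hs _ v w]

/-- Metric compatibility of the connection: the terms antisymmetric in the last two slots cancel,
leaving the plain derivative of the metric. -/
theorem chrisL_add {G : V → V →L[ℝ] V →L[ℝ] ℝ} {q : V} (hG : DifferentiableAt ℝ G q)
    (hs : ∀ q v w, G q v w = G q w v) (u v w : V) :
    chrisL G q u v w + chrisL G q u w v = fderiv ℝ G q u v w := by
  rw [chrisL_apply, chrisL_apply, fderiv_symm_of_symm hG hs u w v,
    fderiv_symm_of_symm hG hs v u w, fderiv_symm_of_symm hG hs w u v]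
  ring

theorem chrisL_smul_left (G : V → V →L[ℝ] V →L[ℝ] ℝ) (q v w : V) (a : ℝ) :
    chrisL G q (a • v) w = a • chrisL G q v w := by
  ext z
  simp only [chrisL_apply, map_smul, smul_apply, smul_eq_mul]
  ring

theorem chrisL_smul_right (G : V → V →L[ℝ] V →L[ℝ] ℝ) (q v w : V) (a : ℝ) :
    chrisL G q v (a • w) = a • chrisL G q v w := by
  ext z
  simp only [chrisL_apply, map_smul, smul_apply, smul_eq_mul]
  ring

/-- The vector `-Γ^a_{bc} v^b w^c`. -/
def accL (G : V → V →L[ℝ] V →L[ℝ] ℝ) (q v w : V) : V := -(G q).inverse (chrisL G q v w)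

theorem accL_smul_left (G : V → V →L[ℝ] V →L[ℝ] ℝ) (q v w : V) (a : ℝ) :
    accL G q (a • v) w = a • accL G q v w := by
  rw [accL, accL, chrisL_smul_left, map_smul, smul_neg]

theorem accL_smul_right (G : V → V →L[ℝ] V →L[ℝ] ℝ) (q v w : V) (a : ℝ) :
    accL G q v (a • w) = a • accL G q v w := by
  rw [accL, accL, chrisL_smul_right, map_smul, smul_neg]

/-- The transformation law of the Christoffel symbols under a change of coordinates. -/
theorem chrisL_comp {G G' : V → V →L[ℝ] V →L[ℝ] ℝ} {ψ : V → V} {q : V}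
    (hψ : ContDiffAt ℝ ∞ ψ q) (hG : DifferentiableAt ℝ G q) (hG' : DifferentiableAt ℝ G' (ψ q))
    (hs : ∀ q v w, G' q v w = G' q w v)
    (hev : ∀ᶠ q' in 𝓝 q, ∀ v w, G' (ψ q') (fderiv ℝ ψ q' v) (fderiv ℝ ψ q' w) = G q' v w)
    (v w z : V) :
    chrisL G' (ψ q) (fderiv ℝ ψ q v) (fderiv ℝ ψ q w) (fderiv ℝ ψ q z) +
      G' (ψ q) (fderiv ℝ (fderiv ℝ ψ) q v w) (fderiv ℝ ψ q z) = chrisL G q v w z := by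
  have h1 : HasFDerivAt ψ (fderiv ℝ ψ q) q := (hψ.differentiableAt (by simp)).hasFDerivAt
  have h2 : HasFDerivAt (fderiv ℝ ψ) (fderiv ℝ (fderiv ℝ ψ) q) q :=
    ((hψ.fderiv_right (m := ∞) (by simp)).differentiableAt (by simp)).hasFDerivAt
  have h3 := hG'.hasFDerivAt.comp q h1
  -- The isometry relation `G'(ψ)(ψ'v, ψ'w) = G(v, w)` differentiated in direction `u`. The claim is
  -- the usual alternating sum of three instances.
  have key : ∀ u v w, fderiv ℝ G' (ψ q) (fderiv ℝ ψ q u) (fderiv ℝ ψ q v) (fderiv ℝ ψ q w) +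
      G' (ψ q) (fderiv ℝ (fderiv ℝ ψ) q u v) (fderiv ℝ ψ q w) +
      G' (ψ q) (fderiv ℝ ψ q v) (fderiv ℝ (fderiv ℝ ψ) q u w) = fderiv ℝ G q u v w := by
    intro u v w
    have h4 := (h3.clm_apply (h2.clm_apply (hasFDerivAt_const v q))).clm_apply
      (h2.clm_apply (hasFDerivAt_const w q))
    have h5 := ((hG.hasFDerivAt.clm_apply
      (hasFDerivAt_const v q)).clm_apply (hasFDerivAt_const w q)).congr_of_eventuallyEq
      (hev.mono fun q' hq' => hq' v w)
    have h6 := congrArg (fun L : V →L[ℝ] ℝ => L u) (h4.unique h5)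
    simp at h6
    linarith
  -- Symmetry of the second derivative of `ψ`: five of the six second-derivative terms cancel or
  -- combine, and exactly one inhomogeneous term survives.
  have hs2 : ∀ a b, fderiv ℝ (fderiv ℝ ψ) q a b = fderiv ℝ (fderiv ℝ ψ) q b a := fun a b =>
    (hψ.isSymmSndFDerivAt (by simpa using two_le_infty)).eq a b
  rw [chrisL_apply, chrisL_apply, ← key v w z, ← key w v z, ← key z v w, hs2 w v, hs2 z v,
    hs2 z w, hs (ψ q) (fderiv ℝ ψ q w), hs (ψ q) (fderiv ℝ ψ q v)]
  ring

variable [FiniteDimensional ℝ V]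

/-- A nondegenerate bilinear form as an isomorphism onto the dual space. -/
def dualEquiv (B : V →L[ℝ] V →L[ℝ] ℝ) (hB : ∀ v, (∀ w, B v w = 0) → v = 0) :
    V ≃L[ℝ] (V →L[ℝ] ℝ) :=
  (LinearEquiv.ofInjectiveOfFinrankEq (B : V →ₗ[ℝ] (V →L[ℝ] ℝ))
    ((injective_iff_map_eq_zero _).2 fun v hv => hB v fun w =>
      congrArg (fun L : V →L[ℝ] ℝ => L w) hv)
    ((Subspace.dual_finrank_eq (K := ℝ) (V := V)).symm.trans
      (LinearMap.toContinuousLinearMap (𝕜 := ℝ) (E := V) (F' := ℝ)).finrank_eq)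
    ).toContinuousLinearEquiv

theorem coe_dualEquiv (B : V →L[ℝ] V →L[ℝ] ℝ) (hB : ∀ v, (∀ w, B v w = 0) → v = 0) :
    (dualEquiv B hB : V →L[ℝ] (V →L[ℝ] ℝ)) = B := rfl

theorem apply_accL {G : V → V →L[ℝ] V →L[ℝ] ℝ} {q : V}
    (hn : ∀ v, (∀ w, G q v w = 0) → v = 0) (v w z : V) :
    G q (accL G q v w) z = -chrisL G q v w z := by
  rw [accL, ← coe_dualEquiv (G q) hn, ContinuousLinearMap.inverse_equiv, map_neg]
  simp

/-- Parallelism is defined with a lowered index. Nondegeneracy raises it and yields an explicit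
first-order differential equation. -/
theorem eq_accL_iff {G : V → V →L[ℝ] V →L[ℝ] ℝ} {q : V}
    (hn : ∀ v, (∀ w, G q v w = 0) → v = 0) (v w a : V) :
    (∀ z, G q a z + chrisL G q v w z = 0) ↔ a = accL G q v w := by
  constructor
  · intro h
    rw [← sub_eq_zero]
    refine hn _ fun z => ?_
    rw [map_sub, sub_apply, apply_accL hn]
    linarith [h z]
  · rintro rfl z
    rw [apply_accL hn]
    ring

theorem contDiffAt_inverse {G : V → V →L[ℝ] V →L[ℝ] ℝ} {q : V}
    (hn : ∀ v, (∀ w, G q v w = 0) → v = 0) (hG : ContDiffAt ℝ ∞ G q) :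
    ContDiffAt ℝ ∞ (fun x => (G x).inverse) q :=
  ContDiffAt.comp q (g := ContinuousLinearMap.inverse)
    (contDiffAt_map_inverse (dualEquiv (G q) hn)) hG

theorem contDiffAt_accL {G : V → V →L[ℝ] V →L[ℝ] ℝ} {q : V} (v w : V)
    (hn : ∀ v, (∀ w, G q v w = 0) → v = 0) (hG : ContDiffAt ℝ ∞ G q) :
    ContDiffAt ℝ ∞ (fun x : V × V × V => accL G x.1 x.2.1 x.2.2) (q, v, w) := by
  have h1 : ContDiffAt ℝ ∞ (fun x : V × V × V => (G x.1).inverse) (q, v, w) :=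
    (contDiffAt_inverse hn hG).comp (q, v, w) contDiffAt_fst
  have h2 : ContDiffAt ℝ ∞ (fun x : V × V × V => fderiv ℝ G x.1) (q, v, w) :=
    (hG.fderiv_right (m := ∞) (by simp)).comp (q, v, w) contDiffAt_fst
  have hv : ContDiffAt ℝ ∞ (fun x : V × V × V => x.2.1) (q, v, w) := contDiffAt_snd.fst
  have hw : ContDiffAt ℝ ∞ (fun x : V × V × V => x.2.2) (q, v, w) := contDiffAt_snd.snd
  have hf : ContDiffAt ℝ ∞ (fun x : V × V × V => (fderiv ℝ G x.1).flip) (q, v, w) :=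
    (ContinuousLinearMap.flipₗᵢ ℝ V V (V →L[ℝ] ℝ)).contDiff.contDiffAt.comp _ h2
  have hf' : ContDiffAt ℝ ∞ (fun x : V × V × V => ((fderiv ℝ G x.1).flip x.2.1).flip) (q, v, w) :=
    (ContinuousLinearMap.flipₗᵢ ℝ V V ℝ).contDiff.contDiffAt.comp _ (hf.clm_apply hv)
  exact (h1.clm_apply ((contDiffAt_const (c := (2⁻¹ : ℝ))).smul ((((h2.clm_apply hv).clm_apply hw).add
    ((h2.clm_apply hw).clm_apply hv)).sub (hf'.clm_apply hw)))).neg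

/-- Solutions of the equation of parallel transport are mapped to solutions by changes of
coordinates. -/
theorem hasDerivAt_parallel_comp {G G' : V → V →L[ℝ] V →L[ℝ] ℝ} {ψ : V → V} {q U : ℝ → V}
    {r : ℝ} {p : V}
    (hψ : ContDiffAt ℝ ∞ ψ (q r)) (hG : DifferentiableAt ℝ G (q r))
    (hG' : DifferentiableAt ℝ G' (ψ (q r)))
    (hn : ∀ v, (∀ w, G (q r) v w = 0) → v = 0) (hn' : ∀ v, (∀ w, G' (ψ (q r)) v w = 0) → v = 0)
    (hs : ∀ q v w, G' q v w = G' q w v) (hsurj : Function.Surjective (fderiv ℝ ψ (q r)))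
    (hev : ∀ᶠ q' in 𝓝 (q r), ∀ v w,
      G' (ψ q') (fderiv ℝ ψ q' v) (fderiv ℝ ψ q' w) = G q' v w)
    (hq : HasDerivAt q p r) (hU : HasDerivAt U (accL G (q r) p (U r)) r) :
    HasDerivAt (fun r => fderiv ℝ ψ (q r) (U r))
      (accL G' (ψ (q r)) (fderiv ℝ ψ (q r) p) (fderiv ℝ ψ (q r) (U r))) r := by
  have h2 : HasFDerivAt (fderiv ℝ ψ) (fderiv ℝ (fderiv ℝ ψ) (q r)) (q r) :=
    ((hψ.fderiv_right (m := ∞) (by simp)).differentiableAt (by simp)).hasFDerivAt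
  have h3 := (h2.comp_hasDerivAt r hq).clm_apply hU
  refine h3.congr_deriv ?_
  rw [← eq_accL_iff hn']
  intro z
  -- The transformation law of the Christoffel symbols only tests against images of `fderiv ℝ ψ`;
  -- surjectivity of the Jacobian makes these all vectors.
  obtain ⟨z, rfl⟩ := hsurj z
  have h4 := chrisL_comp hψ hG hG' hs hev p (U r) z
  have h5 := hev.self_of_nhds (accL G (q r) p (U r)) z
  rw [apply_accL hn] at h5
  rw [map_add, add_apply, Function.comp_apply, h5]
  linarith

theorem hasDerivAt_inner_of_parallel {G : V → V →L[ℝ] V →L[ℝ] ℝ} {q U W : ℝ → V} {r : ℝ} {p : V}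
    (hG : DifferentiableAt ℝ G (q r)) (hn : ∀ v, (∀ w, G (q r) v w = 0) → v = 0)
    (hs : ∀ q v w, G q v w = G q w v) (hq : HasDerivAt q p r)
    (hU : HasDerivAt U (accL G (q r) p (U r)) r) (hW : HasDerivAt W (accL G (q r) p (W r)) r) :
    HasDerivAt (fun r => G (q r) (U r) (W r)) 0 r := by
  refine (((hG.hasFDerivAt.comp_hasDerivAt r hq).clm_apply hU).clm_apply hW).congr_deriv ?_
  simp only [add_apply, Function.comp_apply]
  rw [apply_accL hn, hs, apply_accL hn, ← chrisL_add hG hs]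
  ring

end LeviCivita

theorem eventually_mem_chart {n : ℕ} {S : Type*} [TopologicalSpace S]
    [ChartedSpace (EuclideanSpace ℝ (Fin n)) S] {c c' : S} {q : ℝ × E n} (h : q ∈ chartDom n c)
    (h' : (pt n c q).2 ∈ (chartAt (EuclideanSpace ℝ (Fin n)) c').source) :
    ∀ᶠ q' in 𝓝 q, q' ∈ chartDom n c ∧
      (pt n c q').2 ∈ (chartAt (EuclideanSpace ℝ (Fin n)) c').source := by
  have h1 : chartDom n c ∈ 𝓝 q := (isOpen_chartDom c).mem_nhds h
  exact Filter.Eventually.and h1 (((continuousOn_pt c).continuousAt h1).snd.eventually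
    ((chartAt (EuclideanSpace ℝ (Fin n)) c').open_source.mem_nhds h'))

namespace Spacetime

variable {n : ℕ} {S : Type*} [TopologicalSpace S] [ChartedSpace (EuclideanSpace ℝ (Fin n)) S]
  [IsManifold (𝓡 n) ∞ S] (g : Spacetime n S)

theorem contDiffAt_chartG {c : S} {q : ℝ × E n} (hq : q ∈ chartDom n c) :
    ContDiffAt ℝ ∞ (g.chartG c) q :=
  (g.contDiffOn_chartG c).contDiffAt ((isOpen_chartDom c).mem_nhds hq)

theorem differentiableAt_chartG {c : S} {q : ℝ × E n} (hq : q ∈ chartDom n c) :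
    DifferentiableAt ℝ (g.chartG c) q :=
  (g.contDiffAt_chartG hq).differentiableAt (by simp)

theorem christoffel_eq {c : S} {q : ℝ × E n} (hq : q ∈ chartDom n c) (v w z : ℝ × E n) :
    g.christoffel c q v w z = chrisL (g.chartG c) q v w z := by
  have hG := g.differentiableAt_chartG hq
  rw [chrisL_apply, christoffel]
  simp only [chartMetric_eq]
  rw [fderiv_apply_apply hG, fderiv_apply_apply hG, fderiv_apply_apply hG]

theorem chart_parallel_iff {c : S} {q : ℝ × E n} (hq : q ∈ chartDom n c) (v w a : ℝ × E n) :
    (∀ z, g.chartMetric c q a z + g.christoffel c q v w z = 0) ↔ a = accL (g.chartG c) q v w := by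
  rw [← eq_accL_iff fun v => g.chartG_nondegenerate hq]
  simp only [chartMetric_eq, g.christoffel_eq hq]

end Spacetime

/-! ### Geodesics and parallel fields on the manifold: covariance and uniqueness -/

section Curves

variable {n : ℕ} {S : Type*} [TopologicalSpace S] [ChartedSpace (EuclideanSpace ℝ (Fin n)) S]

variable (n) in
/-- The velocity of a curve in `M` as a vector of the model space. -/
def vel (γ : ℝ → ℝ × S) (r : ℝ) : ℝ × E n := velocity n γ r

variable [IsManifold (𝓡 n) ∞ S]

theorem hasDerivAt_coordPt {γ : ℝ → ℝ × S} {r : ℝ} {c : S}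
    (hγ : MDifferentiableAt 𝓘(ℝ, ℝ) (𝓘(ℝ, ℝ).prod (𝓡 n)) γ r)
    (hc : (γ r).2 ∈ (chartAt (EuclideanSpace ℝ (Fin n)) c).source) :
    HasDerivAt (fun r' => coordPt n c (γ r')) (cvec n c (γ r) (vel n γ r)) r := by
  have h1 : HasDerivAt (fun r' => (γ r').1) (deriv (fun r' => (γ r').1) r) r :=
    (mdifferentiableAt_iff_differentiableAt.1 hγ.fst).hasDerivAt
  have h2 : HasFDerivAt (fun r' => extChartAt (𝓡 n) c (γ r').2)
      ((chartD n c (γ r).2).comp (mfderiv 𝓘(ℝ, ℝ) (𝓡 n) (fun r' => (γ r').2) r)) r :=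
    (HasMFDerivAt.comp r (mdifferentiableAt_extChartAt hc).hasMFDerivAt
      hγ.snd.hasMFDerivAt).hasFDerivAt
  exact h1.prodMk h2.hasDerivAt

theorem vel_eq_of_hasDerivAt {γ : ℝ → ℝ × S} {r : ℝ} {c : S} {q : ℝ → ℝ × E n} {p : ℝ × E n}
    (hγ : MDifferentiableAt 𝓘(ℝ, ℝ) (𝓘(ℝ, ℝ).prod (𝓡 n)) γ r)
    (hc : (γ r).2 ∈ (chartAt (EuclideanSpace ℝ (Fin n)) c).source)
    (hq : (fun r' => coordPt n c (γ r')) =ᶠ[𝓝 r] q) (h : HasDerivAt q p r) :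
    cvec n c (γ r) (vel n γ r) = p :=
  (hasDerivAt_coordPt hγ hc).unique (h.congr_of_eventuallyEq hq)

end Curves

namespace Spacetime

variable {n : ℕ} {S : Type*} [TopologicalSpace S] [ChartedSpace (EuclideanSpace ℝ (Fin n)) S]
  [IsManifold (𝓡 n) ∞ S] {g : Spacetime n S}

theorem IsGeodesicOn.mdifferentiableAt {γ : ℝ → ℝ × S} {I : Set ℝ} (hI : IsOpen I)
    (h : g.IsGeodesicOn γ I) {r : ℝ} (hr : r ∈ I) :
    MDifferentiableAt 𝓘(ℝ, ℝ) (𝓘(ℝ, ℝ).prod (𝓡 n)) γ r :=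
  (h.1.contMDiffAt (hI.mem_nhds hr)).mdifferentiableAt (by simp)

theorem IsParallelOn.hasDerivAt {γ : ℝ → ℝ × S} {U : ℝ → ℝ × E n} {I : Set ℝ}
    (h : g.IsParallelOn γ U I) {r : ℝ} (hr : r ∈ I) {c : S}
    (hγ : MDifferentiableAt 𝓘(ℝ, ℝ) (𝓘(ℝ, ℝ).prod (𝓡 n)) γ r)
    (hc : (γ r).2 ∈ (chartAt (EuclideanSpace ℝ (Fin n)) c).source) :
    HasDerivAt (fun r' => cvec n c (γ r') (U r'))
      (accL (g.chartG c) (coordPt n c (γ r)) (cvec n c (γ r) (vel n γ r))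
        (cvec n c (γ r) (U r))) r := by
  obtain ⟨h1, h2⟩ := h r hr c hc
  rw [(hasDerivAt_coordPt hγ hc).deriv, g.chart_parallel_iff (coordPt_mem hc)] at h2
  exact h1.hasDerivAt.congr_deriv h2

/-- The definition quantifies over all charts, but the equation is covariant, so one chart around
each point suffices. This is what allows geodesics to be constructed in a single chart. -/
theorem isParallelOn_of_hasDerivAt {γ : ℝ → ℝ × S} {U : ℝ → ℝ × E n} {I : Set ℝ}
    (hγ : ∀ r ∈ I, MDifferentiableAt 𝓘(ℝ, ℝ) (𝓘(ℝ, ℝ).prod (𝓡 n)) γ r)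
    (h : ∀ r ∈ I, ∃ c : S, (γ r).2 ∈ (chartAt (EuclideanSpace ℝ (Fin n)) c).source ∧
      HasDerivAt (fun r' => cvec n c (γ r') (U r'))
        (accL (g.chartG c) (coordPt n c (γ r)) (cvec n c (γ r) (vel n γ r))
          (cvec n c (γ r) (U r))) r) : g.IsParallelOn γ U I := by
  intro r hr c' hc'
  obtain ⟨c, hc, hU⟩ := h r hr
  have hq := coordPt_mem hc
  have hq' : (pt n c (coordPt n c (γ r))).2 ∈
      (chartAt (EuclideanSpace ℝ (Fin n)) c').source := by rwa [pt_coordPt hc]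
  have hev := eventually_mem_chart hq hq'
  have htr : trans n c c' (coordPt n c (γ r)) ∈ chartDom n c' := coordPt_mem hq'
  have hd := hasDerivAt_parallel_comp (G := g.chartG c) (G' := g.chartG c')
    (q := fun r' => coordPt n c (γ r')) (contDiffAt_trans hq hq') (g.differentiableAt_chartG hq)
    (g.differentiableAt_chartG htr) (fun v => g.chartG_nondegenerate hq)
    (fun v => g.chartG_nondegenerate htr) (g.chartG_symm c')
    (fun w => ⟨cvec n c (γ r) (vec n c' (coordPt n c' (γ r)) w), by
      have h1 := cvec_vec (coordPt_mem hc') w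
      rw [pt_coordPt hc'] at h1
      rw [fderiv_trans_cvec hc hc', h1]⟩)
    (hev.mono fun q' h' v w => g.chartG_trans h'.1 h'.2 v w)
    (hasDerivAt_coordPt (hγ r hr) hc) hU
  have hcont : ContinuousAt (fun r' => (γ r').2) r := (hγ r hr).continuousAt.snd
  have he : (fun r' => cvec n c' (γ r') (U r')) =ᶠ[𝓝 r]
      fun r' => fderiv ℝ (trans n c c') (coordPt n c (γ r')) (cvec n c (γ r') (U r')) := by
    filter_upwards [hcont.eventually
      ((chartAt (EuclideanSpace ℝ (Fin n)) c).open_source.mem_nhds hc), hcont.eventually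
      ((chartAt (EuclideanSpace ℝ (Fin n)) c').open_source.mem_nhds hc')] with r' h1 h2
    rw [fderiv_trans_cvec h1 h2]
  have hd' := hd.congr_of_eventuallyEq he
  simp only [fderiv_trans_cvec hc hc', trans_coordPt hc] at hd'
  refine ⟨hd'.differentiableAt, ?_⟩
  rw [(hasDerivAt_coordPt (hγ r hr) hc').deriv, g.chart_parallel_iff (coordPt_mem hc')]
  exact hd'.deriv

/-- A solution of the geodesic equation in a chart is a geodesic. -/
theorem isGeodesicOn_of_chart {c : S} {q p : ℝ → ℝ × E n} {I : Set ℝ} (hI : IsOpen I)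
    (hq : ∀ r ∈ I, q r ∈ chartDom n c) (hqp : ∀ r ∈ I, HasDerivAt q (p r) r)
    (hp : ∀ r ∈ I, HasDerivAt p (accL (g.chartG c) (q r) (p r) (p r)) r) :
    g.IsGeodesicOn (fun r => pt n c (q r)) I ∧
      ∀ r ∈ I, vel n (fun r => pt n c (q r)) r = vec n c (q r) (p r) := by
  -- Bootstrapping: the right-hand side of the equation is continuous along the curve, so `p` is
  -- `C¹` and `q`, whose derivative is `p`, is `C²`.
  have hqc : ContDiffOn ℝ 2 q I := by
    have h1 : ∀ r ∈ I, deriv q r = p r := fun r hr => (hqp r hr).deriv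
    have h2 : ∀ r ∈ I, deriv p r = accL (g.chartG c) (q r) (p r) (p r) :=
      fun r hr => (hp r hr).deriv
    have hq0 : ContinuousOn q I := fun r hr => (hqp r hr).continuousAt.continuousWithinAt
    have hp0 : ContinuousOn p I := fun r hr => (hp r hr).continuousAt.continuousWithinAt
    have h3 : ContDiffOn ℝ 1 p I := by
      rw [show (1 : WithTop ℕ∞) = 0 + 1 from rfl, contDiffOn_succ_iff_deriv_of_isOpen hI]
      refine ⟨fun r hr => (hp r hr).differentiableAt.differentiableWithinAt, by simp, ?_⟩
      rw [contDiffOn_zero]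
      refine ContinuousOn.congr (fun r hr => ?_) h2
      have h4 := (contDiffAt_accL (p r) (p r) (fun v => g.chartG_nondegenerate (hq r hr))
        (g.contDiffAt_chartG (hq r hr))).continuousAt
      exact (ContinuousAt.comp (f := fun r => (q r, p r, p r)) (x := r) h4
        ((hqp r hr).continuousAt.prodMk ((hp r hr).continuousAt.prodMk
          (hp r hr).continuousAt))).continuousWithinAt
    rw [show (2 : WithTop ℕ∞) = 1 + 1 from rfl, contDiffOn_succ_iff_deriv_of_isOpen hI]
    exact ⟨fun r hr => (hqp r hr).differentiableAt.differentiableWithinAt, by simp, h3.congr h1⟩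
  have hsm : ContMDiffOn 𝓘(ℝ, ℝ) (𝓘(ℝ, ℝ).prod (𝓡 n)) 2 (fun r => pt n c (q r)) I :=
    ((contMDiffOn_pt c).of_le two_le_infty).comp hqc.contMDiffOn hq
  have hmd : ∀ r ∈ I,
      MDifferentiableAt 𝓘(ℝ, ℝ) (𝓘(ℝ, ℝ).prod (𝓡 n)) (fun r => pt n c (q r)) r :=
    fun r hr => (hsm.contMDiffAt (hI.mem_nhds hr)).mdifferentiableAt (by simp)
  have hev : ∀ r ∈ I, (fun r' => coordPt n c (pt n c (q r'))) =ᶠ[𝓝 r] q := fun r hr => by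
    filter_upwards [hI.mem_nhds hr] with r' hr'
    exact coordPt_pt (hq r' hr')
  have hv : ∀ r ∈ I, cvec n c (pt n c (q r)) (vel n (fun r => pt n c (q r)) r) = p r :=
    fun r hr => vel_eq_of_hasDerivAt (hmd r hr) (pt_mem (hq r hr)) (hev r hr) (hqp r hr)
  refine ⟨⟨hsm, isParallelOn_of_hasDerivAt hmd fun r hr => ⟨c, pt_mem (hq r hr), ?_⟩⟩, ?_⟩
  · have he : (fun r' => cvec n c (pt n c (q r')) (velocity n (fun r => pt n c (q r)) r'))
        =ᶠ[𝓝 r] p := by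
      filter_upwards [hI.mem_nhds hr] with r' hr'
      exact hv r' hr'
    have h5 := (hp r hr).congr_of_eventuallyEq he
    rw [coordPt_pt (hq r hr), hv r hr]
    exact h5.congr_deriv (by rw [← hv r hr]; rfl)
  · intro r hr
    have h6 := vec_cvec (pt_mem (hq r hr)) (vel n (fun r => pt n c (q r)) r)
    rw [hv r hr, coordPt_pt (hq r hr)] at h6
    exact h6.symm

/-- The geodesic equation and the transport equation for one more vector are put into a single
first-order system for position, velocity and transported vector. It is quadratic in the vectors, so
only a local Lipschitz bound is available. -/
theorem exists_lipschitz_geodesic_system (g : Spacetime n S) {c : S} {q p u : ℝ × E n}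
    (hq : q ∈ chartDom n c) :
    ∃ K, ∃ s ∈ 𝓝 ((q, p, u) : (ℝ × E n) × (ℝ × E n) × (ℝ × E n)), LipschitzOnWith K
      (fun y : (ℝ × E n) × (ℝ × E n) × (ℝ × E n) =>
        (y.2.1, accL (g.chartG c) y.1 y.2.1 y.2.1, accL (g.chartG c) y.1 y.2.1 y.2.2)) s := by
  have hn : ∀ v, (∀ w, g.chartG c q v w = 0) → v = 0 := fun v => g.chartG_nondegenerate hq
  have h1 := contDiffAt_accL p p hn (g.contDiffAt_chartG hq)
  have h2 := contDiffAt_accL p u hn (g.contDiffAt_chartG hq)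
  have h3 : ContDiffAt ℝ ∞ (fun y : (ℝ × E n) × (ℝ × E n) × (ℝ × E n) =>
      accL (g.chartG c) y.1 y.2.1 y.2.1) (q, p, u) :=
    ContDiffAt.comp (f := fun y : (ℝ × E n) × (ℝ × E n) × (ℝ × E n) => (y.1, y.2.1, y.2.1))
      (q, p, u) h1 (contDiffAt_fst.prodMk (contDiffAt_snd.fst.prodMk contDiffAt_snd.fst))
  exact ((contDiffAt_snd.fst.prodMk (h3.prodMk h2)).of_le
    (by simp : (1 : WithTop ℕ∞) ≤ ∞)).exists_lipschitzOnWith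

variable [T2Space S]

/-- Geodesics and parallel vector fields along them are determined by their initial values. -/
theorem parallel_unique {γ₁ γ₂ : ℝ → ℝ × S} {U₁ U₂ : ℝ → ℝ × E n} {I : Set ℝ} (hI : IsOpen I)
    (hconn : I.OrdConnected) (h₁ : g.IsGeodesicOn γ₁ I) (h₂ : g.IsGeodesicOn γ₂ I)
    (hU₁ : g.IsParallelOn γ₁ U₁ I) (hU₂ : g.IsParallelOn γ₂ U₂ I) {r₀ : ℝ} (hr₀ : r₀ ∈ I)
    (e : γ₁ r₀ = γ₂ r₀) (e' : vel n γ₁ r₀ = vel n γ₂ r₀) (e'' : U₁ r₀ = U₂ r₀) :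
    ∀ r ∈ I, γ₁ r = γ₂ r ∧ vel n γ₁ r = vel n γ₂ r ∧ U₁ r = U₂ r := by
  set A : Set ℝ := {r | r ∈ I ∧ γ₁ r = γ₂ r ∧ vel n γ₁ r = vel n γ₂ r ∧ U₁ r = U₂ r} with hA
  have hder : ∀ {γ : ℝ → ℝ × S} {U : ℝ → ℝ × E n}, g.IsGeodesicOn γ I → g.IsParallelOn γ U I →
      ∀ r ∈ I, ∀ c : S, (γ r).2 ∈ (chartAt (EuclideanSpace ℝ (Fin n)) c).source →
      HasDerivAt (fun r => (coordPt n c (γ r), cvec n c (γ r) (vel n γ r),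
        cvec n c (γ r) (U r))) (cvec n c (γ r) (vel n γ r),
          accL (g.chartG c) (coordPt n c (γ r)) (cvec n c (γ r) (vel n γ r))
            (cvec n c (γ r) (vel n γ r)),
          accL (g.chartG c) (coordPt n c (γ r)) (cvec n c (γ r) (vel n γ r))
            (cvec n c (γ r) (U r))) r := by
    intro γ U hγ hU r hr c hc
    have hm := hγ.mdifferentiableAt hI hr
    exact (hasDerivAt_coordPt hm hc).prodMk ((hγ.2.hasDerivAt hr hm hc).prodMk
      (hU.hasDerivAt hr hm hc))
  have hsrc : ∀ {γ : ℝ → ℝ × S}, g.IsGeodesicOn γ I → ∀ r ∈ I, ∀ c : S,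
      (γ r).2 ∈ (chartAt (EuclideanSpace ℝ (Fin n)) c).source →
      ∀ᶠ r' in 𝓝 r, r' ∈ I ∧ (γ r').2 ∈ (chartAt (EuclideanSpace ℝ (Fin n)) c).source := by
    intro γ hγ r hr c hc
    exact Filter.Eventually.and (hI.mem_nhds hr)
      ((hγ.mdifferentiableAt hI hr).continuousAt.snd.eventually
        ((chartAt (EuclideanSpace ℝ (Fin n)) c).open_source.mem_nhds hc))
  -- Connectedness argument. The coincidence set is open by local ODE uniqueness in a chart at the
  -- common point, and relatively closed by continuity and the Hausdorff property.
  have hopen : IsOpen A := by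
    rw [isOpen_iff_mem_nhds]
    rintro r ⟨hr, h1, h2, h3⟩
    set c := (γ₁ r).2 with hcdef
    have hc₁ : (γ₁ r).2 ∈ (chartAt (EuclideanSpace ℝ (Fin n)) c).source :=
      mem_chart_source _ _
    have hc₂ : (γ₂ r).2 ∈ (chartAt (EuclideanSpace ℝ (Fin n)) c).source := h1 ▸ hc₁
    obtain ⟨K, s, hs, hK⟩ := g.exists_lipschitz_geodesic_system (c := c)
      (p := cvec n c (γ₁ r) (vel n γ₁ r)) (u := cvec n c (γ₁ r) (U₁ r)) (coordPt_mem hc₁)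
    have hstart : (coordPt n c (γ₁ r), cvec n c (γ₁ r) (vel n γ₁ r),
        cvec n c (γ₁ r) (U₁ r)) = (coordPt n c (γ₂ r), cvec n c (γ₂ r) (vel n γ₂ r),
        cvec n c (γ₂ r) (U₂ r)) := by rw [h1, h2, h3]
    have key := ODE_solution_unique_of_eventually (v := fun _ => _) (s := fun _ => s) (t₀ := r)
      (f := fun r => (coordPt n c (γ₁ r), cvec n c (γ₁ r) (vel n γ₁ r),
        cvec n c (γ₁ r) (U₁ r)))
      (g := fun r => (coordPt n c (γ₂ r), cvec n c (γ₂ r) (vel n γ₂ r),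
        cvec n c (γ₂ r) (U₂ r)))
      (Filter.Eventually.of_forall fun _ => hK)
      ((hsrc h₁ r hr c hc₁).mono (fun r' h' => hder h₁ hU₁ r' h'.1 c h'.2) |>.and
        ((hder h₁ hU₁ r hr c hc₁).continuousAt.eventually_mem hs))
      ((hsrc h₂ r hr c hc₂).mono (fun r' h' => hder h₂ hU₂ r' h'.1 c h'.2) |>.and
        ((hder h₂ hU₂ r hr c hc₂).continuousAt.eventually_mem (hstart ▸ hs))) hstart
    filter_upwards [key, hsrc h₁ r hr c hc₁, hsrc h₂ r hr c hc₂] with r' k1 k2 k3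
    simp only [Prod.mk.injEq] at k1
    have k4 : γ₁ r' = γ₂ r' := by rw [← pt_coordPt k2.2, ← pt_coordPt k3.2, k1.1]
    refine ⟨k2.1, k4, ?_, ?_⟩
    · rw [← vec_cvec k2.2 (vel n γ₁ r'), ← vec_cvec k3.2 (vel n γ₂ r'), k1.1, k1.2.1]
    · rw [← vec_cvec k2.2 (U₁ r'), ← vec_cvec k3.2 (U₂ r'), k1.1, k1.2.2]
  have hclosed : closure A ∩ I ⊆ A := by
    rintro r ⟨hr, hrI⟩
    have hne : (𝓝[A] r).NeBot := mem_closure_iff_nhdsWithin_neBot.1 hr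
    have hg₁ := (h₁.mdifferentiableAt hI hrI).continuousAt
    have hg₂ := (h₂.mdifferentiableAt hI hrI).continuousAt
    have hA' : ∀ᶠ r' in 𝓝[A] r, r' ∈ A := self_mem_nhdsWithin
    have k4 : γ₁ r = γ₂ r :=
      tendsto_nhds_unique_of_eventuallyEq (hg₁.tendsto.mono_left nhdsWithin_le_nhds)
        (hg₂.tendsto.mono_left nhdsWithin_le_nhds) (hA'.mono fun r' h => h.2.1)
    set c := (γ₁ r).2 with hcdef
    have hc₁ : (γ₁ r).2 ∈ (chartAt (EuclideanSpace ℝ (Fin n)) c).source :=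
      mem_chart_source _ _
    have hc₂ : (γ₂ r).2 ∈ (chartAt (EuclideanSpace ℝ (Fin n)) c).source := k4 ▸ hc₁
    have k1 := tendsto_nhds_unique_of_eventuallyEq
      ((hder h₁ hU₁ r hrI c hc₁).continuousAt.tendsto.mono_left nhdsWithin_le_nhds)
      ((hder h₂ hU₂ r hrI c hc₂).continuousAt.tendsto.mono_left nhdsWithin_le_nhds)
      (hA'.mono fun r' h => by simp only [h.2.1, h.2.2.1, h.2.2.2])
    simp only [Prod.mk.injEq] at k1
    refine ⟨hrI, k4, ?_, ?_⟩
    · rw [← vec_cvec hc₁ (vel n γ₁ r), ← vec_cvec hc₂ (vel n γ₂ r), k1.1, k1.2.1]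
    · rw [← vec_cvec hc₁ (U₁ r), ← vec_cvec hc₂ (U₂ r), k1.1, k1.2.2]
  exact fun r hr => ((hconn.isPreconnected).subset_of_closure_inter_subset hopen
    ⟨r₀, hr₀, hr₀, e, e', e''⟩ hclosed hr).2

theorem geodesic_unique {γ₁ γ₂ : ℝ → ℝ × S} {I : Set ℝ} (hI : IsOpen I)
    (hconn : I.OrdConnected) (h₁ : g.IsGeodesicOn γ₁ I) (h₂ : g.IsGeodesicOn γ₂ I)
    {r₀ : ℝ} (hr₀ : r₀ ∈ I) (e : γ₁ r₀ = γ₂ r₀) (e' : vel n γ₁ r₀ = vel n γ₂ r₀) :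
    ∀ r ∈ I, γ₁ r = γ₂ r ∧ vel n γ₁ r = vel n γ₂ r := fun r hr =>
  have h := parallel_unique hI hconn h₁ h₂ h₁.2 h₂.2 hr₀ e e' e' r hr
  ⟨h.1, h.2.1⟩

end Spacetime

namespace Spacetime

variable {n : ℕ} {S : Type*} [TopologicalSpace S] [ChartedSpace (EuclideanSpace ℝ (Fin n)) S]
  [IsManifold (𝓡 n) ∞ S] {g : Spacetime n S}

/-! ### Elementary properties of geodesics -/

theorem IsGeodesicOn.eventually_mem_source {γ : ℝ → ℝ × S} {I : Set ℝ} (hI : IsOpen I)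
    (hγ : g.IsGeodesicOn γ I) {r : ℝ} (hr : r ∈ I) {c : S}
    (hc : (γ r).2 ∈ (chartAt (EuclideanSpace ℝ (Fin n)) c).source) :
    ∀ᶠ r' in 𝓝 r, r' ∈ I ∧ (γ r').2 ∈ (chartAt (EuclideanSpace ℝ (Fin n)) c).source :=
  Filter.Eventually.and (hI.mem_nhds hr)
    ((hγ.mdifferentiableAt hI hr).continuousAt.snd.eventually
      ((chartAt (EuclideanSpace ℝ (Fin n)) c).open_source.mem_nhds hc))

/-- The inner product of parallel vector fields is constant. -/
theorem hasDerivAt_gM_of_isParallelOn {γ : ℝ → ℝ × S} {U W : ℝ → ℝ × E n} {I : Set ℝ}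
    (hI : IsOpen I) (hγ : g.IsGeodesicOn γ I) (hU : g.IsParallelOn γ U I)
    (hW : g.IsParallelOn γ W I) {r : ℝ} (hr : r ∈ I) :
    HasDerivAt (fun r => g.gM (γ r) (U r) (W r)) 0 r := by
  set c := (γ r).2 with hcdef
  have hc : (γ r).2 ∈ (chartAt (EuclideanSpace ℝ (Fin n)) c).source := mem_chart_source _ _
  have hm := hγ.mdifferentiableAt hI hr
  have hq := coordPt_mem hc
  have h1 := hasDerivAt_inner_of_parallel (q := fun r => coordPt n c (γ r))
    (g.differentiableAt_chartG hq) (fun v => g.chartG_nondegenerate hq) (g.chartG_symm c)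
    (hasDerivAt_coordPt hm hc) (hU.hasDerivAt hr hm hc) (hW.hasDerivAt hr hm hc)
  have hev : (fun r => g.gM (γ r) (U r) (W r)) =ᶠ[𝓝 r] fun r =>
      g.chartG c (coordPt n c (γ r)) (cvec n c (γ r) (U r)) (cvec n c (γ r) (W r)) := by
    filter_upwards [hγ.eventually_mem_source hI hr hc] with r' h'
    rw [chartG_cvec g h'.2]
  exact h1.congr_of_eventuallyEq hev

theorem gM_const_of_isParallelOn {γ : ℝ → ℝ × S} {U W : ℝ → ℝ × E n} {I : Set ℝ}
    (hI : IsOpen I) (hconn : I.OrdConnected) (hγ : g.IsGeodesicOn γ I)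
    (hU : g.IsParallelOn γ U I) (hW : g.IsParallelOn γ W I) {r r' : ℝ} (hr : r ∈ I)
    (hr' : r' ∈ I) : g.gM (γ r) (U r) (W r) = g.gM (γ r') (U r') (W r') :=
  hI.is_const_of_deriv_eq_zero hconn.isPreconnected
    (fun _ hr => (hasDerivAt_gM_of_isParallelOn hI hγ hU hW
      hr).differentiableAt.differentiableWithinAt)
    (fun _ hr => (hasDerivAt_gM_of_isParallelOn hI hγ hU hW hr).deriv) hr hr'

theorem energy_const {γ : ℝ → ℝ × S} {I : Set ℝ}
    (hI : IsOpen I) (hconn : I.OrdConnected) (hγ : g.IsGeodesicOn γ I) {r r' : ℝ} (hr : r ∈ I)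
    (hr' : r' ∈ I) : g.gM (γ r) (vel n γ r) (vel n γ r) = g.gM (γ r') (vel n γ r') (vel n γ r') :=
  gM_const_of_isParallelOn (U := vel n γ) (W := vel n γ) hI hconn hγ hγ.2 hγ.2 hr hr'

theorem cvec_smul (c : S) (X : ℝ × S) (a : ℝ) (v : ℝ × E n) :
    cvec n c X (a • v) = a • cvec n c X v := by
  simp [cvec_def]

theorem IsParallelOn.smul {γ : ℝ → ℝ × S} {U : ℝ → ℝ × E n} {I : Set ℝ} (hI : IsOpen I)
    (hγ : g.IsGeodesicOn γ I) (hU : g.IsParallelOn γ U I) (a : ℝ) :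
    g.IsParallelOn γ (fun r => (a • U r : ℝ × E n)) I := by
  refine isParallelOn_of_hasDerivAt (fun r hr => hγ.mdifferentiableAt hI hr) fun r hr =>
    ⟨(γ r).2, mem_chart_source _ _, ?_⟩
  simp only [cvec_smul, accL_smul_right]
  exact (hU.hasDerivAt hr (hγ.mdifferentiableAt hI hr) (mem_chart_source _ _)).const_smul a

theorem IsGeodesicOn.mono {γ : ℝ → ℝ × S} {I J : Set ℝ} (h : g.IsGeodesicOn γ I) (hJ : J ⊆ I) :
    g.IsGeodesicOn γ J :=
  ⟨h.1.mono hJ, fun r hr => h.2 r (hJ hr)⟩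

theorem vel_congr {γ₁ γ₂ : ℝ → ℝ × S} {r : ℝ}
    (h₁ : MDifferentiableAt 𝓘(ℝ, ℝ) (𝓘(ℝ, ℝ).prod (𝓡 n)) γ₁ r) (h : γ₁ =ᶠ[𝓝 r] γ₂) :
    vel n γ₁ r = vel n γ₂ r := by
  have hc : (γ₁ r).2 ∈ (chartAt (EuclideanSpace ℝ (Fin n)) (γ₁ r).2).source :=
    mem_chart_source _ _
  have h₂ : MDifferentiableAt 𝓘(ℝ, ℝ) (𝓘(ℝ, ℝ).prod (𝓡 n)) γ₂ r := h₁.congr_of_eventuallyEq h.symm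
  have hc' : (γ₂ r).2 ∈ (chartAt (EuclideanSpace ℝ (Fin n)) (γ₁ r).2).source := by
    rw [← h.eq_of_nhds]
    exact hc
  have h3 := vel_eq_of_hasDerivAt h₂ hc'
    (h.mono fun r' h' => congrArg (coordPt n (γ₁ r).2) h'.symm) (hasDerivAt_coordPt h₁ hc)
  rw [← h.eq_of_nhds] at h3
  rw [← vec_cvec hc (vel n γ₁ r), ← vec_cvec hc (vel n γ₂ r), h3]

theorem IsGeodesicOn.congr {γ₁ γ₂ : ℝ → ℝ × S} {I : Set ℝ} (hI : IsOpen I)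
    (h : g.IsGeodesicOn γ₁ I) (he : EqOn γ₂ γ₁ I) : g.IsGeodesicOn γ₂ I := by
  have h1 : ContMDiffOn 𝓘(ℝ, ℝ) (𝓘(ℝ, ℝ).prod (𝓡 n)) 2 γ₂ I := h.1.congr he
  have hmd : ∀ r ∈ I, MDifferentiableAt 𝓘(ℝ, ℝ) (𝓘(ℝ, ℝ).prod (𝓡 n)) γ₂ r :=
    fun r hr => (h1.contMDiffAt (hI.mem_nhds hr)).mdifferentiableAt (by simp)
  have hev : ∀ r ∈ I, γ₂ =ᶠ[𝓝 r] γ₁ := fun r hr => he.eventuallyEq_of_mem (hI.mem_nhds hr)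
  have hv : EqOn (vel n γ₂) (vel n γ₁) I := fun r hr => vel_congr (hmd r hr) (hev r hr)
  refine ⟨h1, isParallelOn_of_hasDerivAt (U := vel n γ₂) hmd fun r hr =>
    ⟨(γ₁ r).2, ?_, ?_⟩⟩
  · rw [he hr]
    exact mem_chart_source _ _
  · rw [he hr, hv hr]
    refine (h.2.hasDerivAt (U := vel n γ₁) hr (h.mdifferentiableAt hI hr)
      (mem_chart_source _ _)).congr_of_eventuallyEq ?_
    filter_upwards [hI.mem_nhds hr] with r' hr'
    rw [he hr', hv hr']

theorem IsGeodesicOn.union {γ : ℝ → ℝ × S} {I J : Set ℝ} (hI : IsOpen I) (hJ : IsOpen J)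
    (h : g.IsGeodesicOn γ I) (h' : g.IsGeodesicOn γ J) : g.IsGeodesicOn γ (I ∪ J) :=
  ⟨h.1.union_of_isOpen h'.1 hI hJ, fun r hr => hr.elim (h.2 r) (h'.2 r)⟩

/-- The acceleration is quadratic in the velocity, so both sides scale by `a ^ 2`. The value `a = 0`
is allowed and gives constant geodesics. -/
theorem isGeodesicOn_comp_affine {γ : ℝ → ℝ × S} {I : Set ℝ} (hI : IsOpen I)
    (h : g.IsGeodesicOn γ I) (a b : ℝ) :
    g.IsGeodesicOn (fun r => γ (a * r + b)) ((fun r => a * r + b) ⁻¹' I) ∧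
      ∀ r, a * r + b ∈ I → vel n (fun r => γ (a * r + b)) r = a • vel n γ (a * r + b) := by
  have hd : ∀ r, HasDerivAt (fun r => a * r + b) a r := fun r => by
    simpa using ((hasDerivAt_id r).const_mul a).add_const b
  have h1 : ContMDiffOn 𝓘(ℝ, ℝ) (𝓘(ℝ, ℝ).prod (𝓡 n)) 2 (fun r => γ (a * r + b))
      ((fun r => a * r + b) ⁻¹' I) :=
    h.1.comp (ContDiff.contMDiff (by fun_prop)).contMDiffOn (fun _ h => h)
  have hJ : IsOpen ((fun r => a * r + b) ⁻¹' I) := hI.preimage (by fun_prop)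
  have hmd : ∀ r ∈ (fun r => a * r + b) ⁻¹' I,
      MDifferentiableAt 𝓘(ℝ, ℝ) (𝓘(ℝ, ℝ).prod (𝓡 n)) (fun r => γ (a * r + b)) r :=
    fun r hr => (h1.contMDiffAt (hJ.mem_nhds hr)).mdifferentiableAt (by simp)
  have hv : ∀ r, a * r + b ∈ I →
      vel n (fun r => γ (a * r + b)) r = a • vel n γ (a * r + b) := by
    intro r hr
    have hc : (γ (a * r + b)).2 ∈
      (chartAt (EuclideanSpace ℝ (Fin n)) (γ (a * r + b)).2).source := mem_chart_source _ _
    have h2 := (hasDerivAt_coordPt (h.mdifferentiableAt hI hr) hc).scomp r (hd r)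
    have h3 := vel_eq_of_hasDerivAt (hmd r hr) hc Filter.EventuallyEq.rfl h2
    rw [← cvec_smul] at h3
    rw [← vec_cvec hc (vel n (fun r => γ (a * r + b)) r), h3, vec_cvec hc]
  refine ⟨⟨h1, isParallelOn_of_hasDerivAt (U := vel n (fun r => γ (a * r + b))) hmd fun r hr =>
    ⟨(γ (a * r + b)).2, mem_chart_source _ _, ?_⟩⟩, hv⟩
  have h2 := ((h.2.hasDerivAt (U := vel n γ) hr (h.mdifferentiableAt hI hr)
    (mem_chart_source _ _)).scomp r (hd r)).const_smul a
  have hev : (fun r' => cvec n (γ (a * r + b)).2 (γ (a * r' + b))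
      (vel n (fun r => γ (a * r + b)) r')) =ᶠ[𝓝 r] fun r' =>
      a • cvec n (γ (a * r + b)).2 (γ (a * r' + b)) (vel n γ (a * r' + b)) := by
    filter_upwards [hJ.mem_nhds hr] with r' hr'
    rw [hv r' hr', cvec_smul]
  refine (h2.congr_of_eventuallyEq hev).congr_deriv ?_
  rw [hv r hr, cvec_smul, accL_smul_left, accL_smul_right]

variable [T2Space S]

open Classical in
/-- Geodesics with the same initial values can be glued. -/
theorem exists_geodesic_union {γ₁ γ₂ : ℝ → ℝ × S} {I J : Set ℝ} (hI : IsOpen I) (hJ : IsOpen J)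
    (hIc : I.OrdConnected) (hJc : J.OrdConnected) (h₁ : g.IsGeodesicOn γ₁ I)
    (h₂ : g.IsGeodesicOn γ₂ J) {r₀ : ℝ} (hr₁ : r₀ ∈ I) (hr₂ : r₀ ∈ J) (e : γ₁ r₀ = γ₂ r₀)
    (e' : vel n γ₁ r₀ = vel n γ₂ r₀) :
    ∃ γ : ℝ → ℝ × S, g.IsGeodesicOn γ (I ∪ J) ∧ IsOpen (I ∪ J) ∧ (I ∪ J).OrdConnected ∧
      (∀ r ∈ I, γ r = γ₁ r ∧ vel n γ r = vel n γ₁ r) ∧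
      ∀ r ∈ J, γ r = γ₂ r ∧ vel n γ r = vel n γ₂ r := by
  -- The intersection of two order-connected sets is order-connected, so uniqueness applies to the
  -- whole overlap and the piecewise definition is consistent.
  have hu := geodesic_unique (hI.inter hJ) (hIc.inter hJc) (h₁.mono inter_subset_left)
    (h₂.mono inter_subset_right) ⟨hr₁, hr₂⟩ e e'
  set γ : ℝ → ℝ × S := fun r => if r ∈ I then γ₁ r else γ₂ r with hγ
  have e₁ : EqOn γ γ₁ I := fun r hr => if_pos hr
  have e₂ : EqOn γ γ₂ J := fun r hr => by
    by_cases h : r ∈ I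
    · rw [e₁ h, (hu r ⟨h, hr⟩).1]
    · exact if_neg h
  have g₁ := h₁.congr hI e₁
  have g₂ := h₂.congr hJ e₂
  refine ⟨γ, g₁.union hI hJ g₂, hI.union hJ, ?_, fun r hr => ⟨e₁ hr, ?_⟩, fun r hr => ⟨e₂ hr, ?_⟩⟩
  · rw [← isPreconnected_iff_ordConnected]
    exact IsPreconnected.union r₀ hr₁ hr₂ hIc.isPreconnected hJc.isPreconnected
  · exact vel_congr (g₁.mdifferentiableAt hI hr) (e₁.eventuallyEq_of_mem (hI.mem_nhds hr))
  · exact vel_congr (g₂.mdifferentiableAt hJ hr) (e₂.eventuallyEq_of_mem (hJ.mem_nhds hr))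

/-! ### The exponential map and the world function -/

/-- The open domain of a geodesic from `Z` need not be connected, whereas uniqueness and energy
conservation need an interval; it is shrunk to one around `[0, 1]`. -/
theorem exists_Ioo_subset_of_Icc_subset {I : Set ℝ} (hI : IsOpen I) (h : Icc (0 : ℝ) 1 ⊆ I) :
    ∃ δ > 0, Ioo (-δ) (1 + δ) ⊆ I := by
  obtain ⟨δ, hδ, h1⟩ := isCompact_Icc.exists_thickening_subset_open hI h
  refine ⟨δ, hδ, fun r hr => h1 ?_⟩
  rw [Metric.mem_thickening_iff]
  refine ⟨max 0 (min r 1), ⟨le_max_left _ _, by simp⟩, ?_⟩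
  rw [Real.dist_eq, abs_lt]
  obtain ⟨h2, h3⟩ := hr
  rw [max_def, min_def]
  split_ifs <;> constructor <;> linarith

theorem IsGeodesicFrom.exists_Ioo {Z : ℝ × S} {v : ℝ × E n} {γ : ℝ → ℝ × S}
    (h : g.IsGeodesicFrom Z v γ) : γ 0 = Z ∧ vel n γ 0 = v ∧
      ∃ δ > 0, g.IsGeodesicOn γ (Ioo (-δ) (1 + δ)) := by
  obtain ⟨⟨I, hI, hIc, hγ⟩, h2⟩ := h
  have h2 := sigma_tanM_eq_iff.1 h2
  obtain ⟨δ, hδ, h3⟩ := exists_Ioo_subset_of_Icc_subset hI hIc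
  exact ⟨h2.1, h2.2, δ, hδ, hγ.mono h3⟩

theorem isGeodesicFrom_of_Ioo {Z : ℝ × S} {v : ℝ × E n} {γ : ℝ → ℝ × S} (h0 : γ 0 = Z)
    (h1 : vel n γ 0 = v) {δ : ℝ} (hδ : 0 < δ) (hγ : g.IsGeodesicOn γ (Ioo (-δ) (1 + δ))) :
    g.IsGeodesicFrom Z v γ :=
  ⟨⟨_, isOpen_Ioo, fun _ hr => ⟨by linarith [hr.1], by linarith [hr.2]⟩, hγ⟩,
    sigma_tanM_eq_iff.2 ⟨h0, h1⟩⟩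

theorem IsGeodesicFrom.eqOn {Z : ℝ × S} {v : ℝ × E n} {γ₁ γ₂ : ℝ → ℝ × S}
    (h₁ : g.IsGeodesicFrom Z v γ₁) (h₂ : g.IsGeodesicFrom Z v γ₂) : EqOn γ₁ γ₂ (Icc 0 1) := by
  obtain ⟨a1, b1, δ₁, hδ₁, g1⟩ := h₁.exists_Ioo
  obtain ⟨a2, b2, δ₂, hδ₂, g2⟩ := h₂.exists_Ioo
  have hδ := lt_min hδ₁ hδ₂
  intro r hr
  refine (geodesic_unique (I := Ioo (-(min δ₁ δ₂)) (1 + min δ₁ δ₂)) isOpen_Ioo ordConnected_Ioo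
    (g1.mono ?_) (g2.mono ?_) (r₀ := 0) ⟨by linarith, by linarith⟩ (a1.trans a2.symm)
    (b1.trans b2.symm) r ⟨by linarith [hr.1], by linarith [hr.2]⟩).1
  · exact Ioo_subset_Ioo (by simp) (by simp)
  · exact Ioo_subset_Ioo (by simp) (by simp)

theorem isGeodesicFrom_geodesic {Z : ℝ × S} {v : ℝ × E n} (h : g.ExpDefined Z v) :
    g.IsGeodesicFrom Z v (g.geodesic Z v) := by
  have h1 : g.geodesic Z v = Exists.choose h := dif_pos h
  rw [h1]
  exact Exists.choose_spec h

theorem IsGeodesicFrom.geodesic_eq {Z : ℝ × S} {v : ℝ × E n} {γ : ℝ → ℝ × S}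
    (h : g.IsGeodesicFrom Z v γ) {r : ℝ} (hr : r ∈ Icc (0 : ℝ) 1) : g.geodesic Z v r = γ r :=
  (isGeodesicFrom_geodesic ⟨γ, h⟩).eqOn h hr

theorem IsGeodesicFrom.exp_smul {Z : ℝ × S} {v : ℝ × E n} {γ : ℝ → ℝ × S}
    (h : g.IsGeodesicFrom Z v γ) {r : ℝ} (hr : r ∈ Icc (0 : ℝ) 1) :
    g.exp Z (r • v : ℝ × E n) = γ r := by
  obtain ⟨a1, b1, δ, hδ, g1⟩ := h.exists_Ioo
  obtain ⟨g2, hv⟩ := isGeodesicOn_comp_affine isOpen_Ioo g1 r 0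
  have h2 : g.IsGeodesicFrom Z (r • v : ℝ × E n) (fun u => γ (r * u + 0)) := by
    refine isGeodesicFrom_of_Ioo (by simpa using a1) ?_ hδ (g2.mono ?_)
    · rw [hv 0 ⟨by simpa using hδ, by simp; linarith⟩]
      simp [b1]
    · rintro u ⟨hu1, hu2⟩
      change -δ < r * u + 0 ∧ r * u + 0 < 1 + δ
      rcases le_total 0 u with hu | hu
      · have h3 := mul_nonneg hr.1 hu
        have h4 := mul_le_of_le_one_left hu hr.2
        constructor <;> linarith
      · have h3 := mul_nonneg hr.1 (neg_nonneg.2 hu)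
        have h4 := mul_le_of_le_one_left (neg_nonneg.2 hu) hr.2
        constructor <;> linarith
  exact (h2.geodesic_eq (r := 1) ⟨zero_le_one, le_rfl⟩).trans (by simp)

namespace NormalNeighbourhoods

variable (N : g.NormalNeighbourhoods)

/-- The inverse of the exponential map with values in the model space. -/
def logV (Z X : ℝ × S) : ℝ × E n := N.log Z X

theorem isGeodesicFrom_log {Z X : ℝ × S} (hX : X ∈ N.nhd Z) :
    g.IsGeodesicFrom Z (N.logV Z X) (g.geodesic Z (N.logV Z X)) :=
  isGeodesicFrom_geodesic (N.expDefined_log Z X hX)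

theorem exp_smul_logV {Z X : ℝ × S} (hX : X ∈ N.nhd Z) {r : ℝ} (hr : r ∈ Icc (0 : ℝ) 1) :
    g.exp Z (r • N.logV Z X : ℝ × E n) = g.geodesic Z (N.logV Z X) r :=
  (N.isGeodesicFrom_log hX).exp_smul hr

theorem logV_geodesic {Z X : ℝ × S} (hX : X ∈ N.nhd Z) {r : ℝ} (hr : r ∈ Icc (0 : ℝ) 1) :
    g.geodesic Z (N.logV Z X) r ∈ N.nhd Z ∧
      N.logV Z (g.geodesic Z (N.logV Z X) r) = r • N.logV Z X := by
  rw [← N.exp_smul_logV hX hr]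
  exact N.star_shaped Z X hX r hr

/-- Star-shapedness at parameter `0`: the radial geodesic starts at `Z`, and its logarithm there is
`0` times a vector. -/
theorem logV_self (Z : ℝ × S) : N.logV Z Z = 0 := by
  have h := (N.logV_geodesic (N.mem_nhd Z) (r := 0) ⟨le_rfl, zero_le_one⟩).2
  rwa [(N.isGeodesicFrom_log (N.mem_nhd Z)).exists_Ioo.1, zero_smul] at h

theorem logV_injOn (Z : ℝ × S) : InjOn (N.logV Z) (N.nhd Z) := by
  intro X hX Y hY h
  rw [← N.exp_log Z X hX, ← N.exp_log Z Y hY]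
  exact congrArg (fun v : ℝ × E n => g.exp Z v) h

/-- The integrand is the energy of the geodesic, which is constant and may be evaluated at parameter
`0`, where the velocity is the logarithm. -/
theorem worldFunction_eq {Z X : ℝ × S} (hX : X ∈ N.nhd Z) :
    N.worldFunction X Z = 1 / 2 * g.gM Z (N.logV Z X) (N.logV Z X) := by
  obtain ⟨a, b, δ, hδ, hγ⟩ := (N.isGeodesicFrom_log hX).exists_Ioo
  have h1 : ∀ r ∈ uIcc (0 : ℝ) 1, g.metric (g.geodesic Z (N.log Z X) r)
      (velocity n (g.geodesic Z (N.log Z X)) r) (velocity n (g.geodesic Z (N.log Z X)) r) =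
      g.gM Z (N.logV Z X) (N.logV Z X) := by
    intro r hr
    rw [uIcc_of_le zero_le_one] at hr
    have h2 := energy_const isOpen_Ioo ordConnected_Ioo hγ (r := r) (r' := 0)
      ⟨by linarith [hr.1], by linarith [hr.2]⟩ ⟨by linarith, by linarith⟩
    rw [a, b] at h2
    rw [← h2]
    exact g.metric_eq _ _ _
  rw [worldFunction, intervalIntegral.integral_congr h1]
  simp

/-- By Rolle's theorem the time component of the velocity vanishes somewhere on the connecting
geodesic. There the energy is `-h(v, v) ≤ 0`, and the energy is constant. -/
theorem worldFunction_nonpos {Z X : ℝ × S} (hX : X ∈ N.nhd Z) (ht : X.1 = Z.1) :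
    N.worldFunction X Z ≤ 0 := by
  by_contra! hpos
  rw [N.worldFunction_eq hX] at hpos
  obtain ⟨a, b, δ, hδ, hγ⟩ := (N.isGeodesicFrom_log hX).exists_Ioo
  have h1 := N.exp_smul_logV hX (r := 1) ⟨zero_le_one, le_rfl⟩
  have h2 : g.geodesic Z (N.logV Z X) 1 = X := by
    rw [← h1, one_smul]
    exact N.exp_log Z X hX
  set γ := g.geodesic Z (N.logV Z X) with hγdef
  have hm : ∀ r ∈ Icc (0 : ℝ) 1, r ∈ Ioo (-δ) (1 + δ) := fun r hr =>
    ⟨by linarith [hr.1], by linarith [hr.2]⟩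
  obtain ⟨r, hr, hd⟩ := exists_deriv_eq_zero (f := fun r => (γ r).1) zero_lt_one
    (fun r hr => ((hγ.mdifferentiableAt isOpen_Ioo
      (hm r hr)).continuousAt.fst).continuousWithinAt) (by simp only [a, h2, ht])
  have h3 := energy_const isOpen_Ioo ordConnected_Ioo hγ (hm r (Ioo_subset_Icc_self hr))
    (hm 0 ⟨le_rfl, zero_le_one⟩)
  have h4 : (vel n γ r).1 = 0 := hd
  rw [a, b, gM_apply, h4] at h3
  have h5 := g.hM_nonneg (γ r) (vel n γ r).2
  linarith

end NormalNeighbourhoods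

end Spacetime

/-! ### A criterion for a derivative to be the identity -/

section Calculus

variable {V : Type*} [NormedAddCommGroup V] [NormedSpace ℝ V] [CompleteSpace V]

/-- If the derivative at a point of a locally injective map fixes the values of the map, then it
is the identity. -/
theorem fderiv_eq_id_of_fixes_values {ℓ : V → V} {q₀ : V} {P : V →L[ℝ] V}
    (hℓ : HasStrictFDerivAt ℓ P q₀) (h0 : ℓ q₀ = 0) (hfix : ∀ᶠ x in 𝓝 q₀, P (ℓ x) = ℓ x)
    {s : Set V} (hs : s ∈ 𝓝 q₀) (hinj : InjOn ℓ s) : P = ContinuousLinearMap.id ℝ V := by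
  -- Differentiating `P ∘ ℓ = ℓ` at `q₀` shows that `P` is a projection; it remains to see that its
  -- kernel is trivial.
  have hP : ∀ v, P (P v) = P v := by
    have h1 : HasFDerivAt (fun x => P (ℓ x)) (P.comp P) q₀ := P.hasFDerivAt.comp q₀ hℓ.hasFDerivAt
    have h2 := h1.unique (hℓ.hasFDerivAt.congr_of_eventuallyEq hfix)
    exact fun v => congrArg (fun L : V →L[ℝ] V => L v) h2
  -- The correction `(1 - P)(x - q₀)` changes the derivative from `P` to the identity, so this map
  -- is onto a neighbourhood of `0`.
  have hm : HasStrictFDerivAt (fun x => ℓ x + ((x - q₀) - P (x - q₀)))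
      ((ContinuousLinearEquiv.refl ℝ V : V ≃L[ℝ] V) : V →L[ℝ] V) q₀ := by
    have h3 : HasStrictFDerivAt (fun x => x - q₀) (ContinuousLinearMap.id ℝ V) q₀ :=
      (hasStrictFDerivAt_id q₀).sub_const q₀
    refine (hℓ.add (h3.sub (P.hasStrictFDerivAt.comp q₀ h3))).congr_fderiv ?_
    ext v
    simp
  have hnhds := hm.map_nhds_eq_of_equiv
  simp only [h0, sub_self, map_zero, add_zero] at hnhds
  -- Write a small `k` as `ℓ x + (1 - P)(x - q₀)`. Then `P k = ℓ x`, so `P k = 0` forces `x = q₀` by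
  -- injectivity and `k = 0`.
  have hker : ∀ᶠ k in 𝓝 (0 : V), P k = 0 → k = 0 := by
    rw [← hnhds, Filter.eventually_map]
    filter_upwards [hfix, hs] with x hx hxs hk
    simp only [map_add, map_sub, hP, sub_self, add_zero, hx] at hk
    have h4 : x = q₀ := hinj hxs (mem_of_mem_nhds hs) (hk.trans h0.symm)
    simp [h4, h0]
  have hker' : ∀ k, P k = 0 → k = 0 := by
    intro k hk
    have h5 : Filter.Tendsto (fun r : ℝ => r • k) (𝓝[≠] 0) (𝓝 0) := by
      have : Filter.Tendsto (fun r : ℝ => r • k) (𝓝 0) (𝓝 ((0 : ℝ) • k)) :=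
        (continuous_id.smul continuous_const).tendsto 0
      rw [zero_smul] at this
      exact this.mono_left nhdsWithin_le_nhds
    obtain ⟨r, hr, hr0⟩ := ((h5.eventually hker).and self_mem_nhdsWithin).exists
    exact (smul_eq_zero.1 (hr (by rw [map_smul, hk, smul_zero]))).resolve_left hr0
  ext v
  have h6 := hker' (P v - v) (by rw [map_sub, hP, sub_self])
  simpa [sub_eq_zero] using h6

end Calculus

/-! ### The logarithm in a chart and its differential on the diagonal -/

namespace Spacetime.NormalNeighbourhoods

variable {n : ℕ} {S : Type*} [TopologicalSpace S] [ChartedSpace (EuclideanSpace ℝ (Fin n)) S]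
  [IsManifold (𝓡 n) ∞ S] {g : Spacetime n S} (N : g.NormalNeighbourhoods)

/-- The inverse of the exponential map in a chart. -/
def logC (c : S) (y : (ℝ × E n) × (ℝ × E n)) : ℝ × E n :=
  cvec n c (pt n c y.1) (N.logV (pt n c y.1) (pt n c y.2))

/-- The set of pairs of coordinates for which `logC` is defined. -/
def logDom (c : S) : Set ((ℝ × E n) × (ℝ × E n)) :=
  {y | y.1 ∈ chartDom n c ∧ y.2 ∈ chartDom n c ∧ pt n c y.2 ∈ N.nhd (pt n c y.1)}

theorem continuousOn_pt_prod (c : S) :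
    ContinuousOn (fun y : (ℝ × E n) × (ℝ × E n) => (pt n c y.1, pt n c y.2))
      {y | y.1 ∈ chartDom n c ∧ y.2 ∈ chartDom n c} :=
  ((continuousOn_pt c).comp continuousOn_fst fun _ h => h.1).prodMk
    ((continuousOn_pt c).comp continuousOn_snd fun _ h => h.2)

theorem isOpen_logDom (c : S) : IsOpen (N.logDom c) := by
  have h1 : IsOpen {y : (ℝ × E n) × (ℝ × E n) | y.1 ∈ chartDom n c ∧ y.2 ∈ chartDom n c} :=
    (isOpen_chartDom c).prod (isOpen_chartDom c)
  have h2 := (continuousOn_pt_prod c).isOpen_inter_preimage h1 N.isOpen_nhd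
  convert h2 using 1
  ext y
  simp [logDom, and_assoc]

theorem diag_mem_logDom {c : S} {q : ℝ × E n} (hq : q ∈ chartDom n c) : (q, q) ∈ N.logDom c :=
  ⟨hq, hq, N.mem_nhd _⟩

theorem contDiffOn_logC (c : S) : ContDiffOn ℝ ∞ (N.logC c) (N.logDom c) := by
  have hp : ContMDiffOn 𝓘(ℝ, (ℝ × E n) × (ℝ × E n))
      ((𝓘(ℝ, ℝ).prod (𝓡 n)).prod (𝓘(ℝ, ℝ).prod (𝓡 n))) ∞
      (fun y : (ℝ × E n) × (ℝ × E n) => (pt n c y.1, pt n c y.2)) (N.logDom c) :=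
    ((contMDiffOn_pt c).comp contDiff_fst.contMDiff.contMDiffOn fun _ h => h.1).prodMk
      ((contMDiffOn_pt c).comp contDiff_snd.contMDiff.contMDiffOn fun _ h => h.2.1)
  have hm : MapsTo (fun y : (ℝ × E n) × (ℝ × E n) => (pt n c y.1, pt n c y.2)) (N.logDom c)
      {p : (ℝ × S) × (ℝ × S) | p.2 ∈ N.nhd p.1} := fun y hy => hy.2.2
  have h1 := N.log_smooth_fst.comp hp hm
  have h2 := N.log_smooth_snd.comp hp hm
  set e := trivializationAt (E n) (fun x : S => TangentSpace (𝓡 n) x) c with he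
  have hb : ∀ y ∈ N.logDom c, (pt n c y.1).2 ∈ e.baseSet := by
    intro y hy
    rw [he, TangentBundle.trivializationAt_baseSet]
    exact pt_mem hy.1
  rw [e.contMDiffOn_iff fun y hy => by
    rw [Trivialization.mem_source]
    exact hb y hy] at h2
  rw [contMDiffOn_iff_contDiffOn] at h1
  have h3 := contMDiffOn_iff_contDiffOn.1 h2.2
  refine h1.prodMk (h3.congr fun y hy => ?_)
  have h4 := TangentBundle.continuousLinearMapAt_trivializationAt (𝕜 := ℝ) (I := 𝓡 n)
    (pt_mem hy.1)
  have h5 := congrArg (fun L : E n →L[ℝ] E n => L (N.logV (pt n c y.1) (pt n c y.2)).2) h4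
  refine h5.symm.trans ?_
  exact congrFun (e.coe_linearMapAt_of_mem (hb y hy)) _

theorem contDiffAt_logC {c : S} {y : (ℝ × E n) × (ℝ × E n)} (hy : y ∈ N.logDom c) :
    ContDiffAt ℝ ∞ (N.logC c) y :=
  (N.contDiffOn_logC c).contDiffAt ((N.isOpen_logDom c).mem_nhds hy)

theorem vec_logC {c : S} {y : (ℝ × E n) × (ℝ × E n)} (hy : y ∈ N.logDom c) :
    vec n c y.1 (N.logC c y) = N.logV (pt n c y.1) (pt n c y.2) := by
  have h := vec_cvec (pt_mem hy.1) (N.logV (pt n c y.1) (pt n c y.2))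
  rwa [coordPt_pt hy.1] at h

variable [T2Space S]

theorem worldFunction_pt {c : S} {y : (ℝ × E n) × (ℝ × E n)} (hy : y ∈ N.logDom c) :
    N.worldFunction (pt n c y.2) (pt n c y.1) =
      1 / 2 * g.chartG c y.1 (N.logC c y) (N.logC c y) := by
  rw [N.worldFunction_eq hy.2.2, chartG_apply, N.vec_logC hy]

theorem logC_diag (c : S) (q : ℝ × E n) : N.logC c (q, q) = 0 := by
  rw [logC, N.logV_self]
  simp [cvec_def]

theorem logC_injOn {c : S} {q : ℝ × E n} :
    InjOn (fun x => N.logC c (q, x)) {x | (q, x) ∈ N.logDom c} := by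
  intro x hx y hy h
  have h1 := N.vec_logC hx
  have h2 := N.vec_logC hy
  simp only at h
  rw [h, h2] at h1
  have h3 := congrArg (coordPt n c) (N.logV_injOn _ hx.2.2 hy.2.2 h1.symm)
  rwa [coordPt_pt hx.2.1, coordPt_pt hy.2.1] at h3

/-- Along the radial geodesic `γ` towards `x` the logarithm is `r • log x`. Comparing derivatives at
`r = 0` gives the claim, since `γ` starts with velocity `log x`. The derivative of the linear side
is one-sided, because star-shapedness concerns only `r ∈ [0, 1]`. -/
theorem fderiv_logC_fixes {c : S} {q x : ℝ × E n} (hx : (q, x) ∈ N.logDom c) :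
    fderiv ℝ (fun x => N.logC c (q, x)) q (N.logC c (q, x)) = N.logC c (q, x) := by
  have hq : q ∈ chartDom n c := hx.1
  obtain ⟨a, b, δ, hδ, hγ⟩ := (N.isGeodesicFrom_log hx.2.2).exists_Ioo
  have hlog := fun r hr => N.logV_geodesic hx.2.2 (r := r) hr
  set γ := g.geodesic (pt n c q) (N.logV (pt n c q) (pt n c x)) with hγdef
  have h0 : (0 : ℝ) ∈ Ioo (-δ) (1 + δ) := ⟨by linarith, by linarith⟩
  have hc : (γ 0).2 ∈ (chartAt (EuclideanSpace ℝ (Fin n)) c).source := by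
    rw [a]
    exact pt_mem hq
  have h1 := hasDerivAt_coordPt (hγ.mdifferentiableAt isOpen_Ioo h0) hc
  have e0 : coordPt n c (γ 0) = q := by rw [a, coordPt_pt hq]
  rw [b, a] at h1
  have h2 : HasFDerivAt (fun x => N.logC c (q, x)) (fderiv ℝ (fun x => N.logC c (q, x)) q)
      (coordPt n c (γ 0)) := by
    rw [e0]
    refine DifferentiableAt.hasFDerivAt ?_
    exact ((N.contDiffAt_logC (N.diag_mem_logDom hq)).differentiableAt (by simp)).comp q
      ((differentiableAt_const q).prodMk differentiableAt_id)
  have h3 := h2.comp_hasDerivAt (0 : ℝ) h1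
  have h4 : HasDerivWithinAt (fun r : ℝ => r • N.logC c (q, x)) (N.logC c (q, x))
      (Icc 0 1) 0 := by
    have := ((hasDerivAt_id (0 : ℝ)).smul_const (N.logC c (q, x))).hasDerivWithinAt (s := Icc 0 1)
    simpa using this
  have h5 : (fun r => N.logC c (q, coordPt n c (γ r))) =ᶠ[𝓝[Icc 0 1] 0]
      fun r : ℝ => r • N.logC c (q, x) := by
    filter_upwards [self_mem_nhdsWithin, nhdsWithin_le_nhds
      (hγ.eventually_mem_source isOpen_Ioo h0 hc)] with r hr hr'
    simp only [logC]
    rw [pt_coordPt hr'.2, (hlog r hr).2, cvec_smul]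
  have h6 := h4.congr_of_eventuallyEq h5 (by simp [e0, N.logC_diag])
  exact (uniqueDiffOn_Icc_zero_one 0 ⟨le_rfl, zero_le_one⟩).eq_deriv _ h3.hasDerivWithinAt h6

/-- The partial derivative in the endpoint fixes all values of the locally injective logarithm, so
it is the identity. As the logarithm vanishes on the whole diagonal, the partial derivative in the
base point is the opposite. -/
theorem hasStrictFDerivAt_logC {c : S} {q : ℝ × E n} (hq : q ∈ chartDom n c) :
    HasStrictFDerivAt (N.logC c) (ContinuousLinearMap.snd ℝ (ℝ × E n) (ℝ × E n) -
      ContinuousLinearMap.fst ℝ (ℝ × E n) (ℝ × E n)) (q, q) := by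
  have h1 : HasStrictFDerivAt (N.logC c) (fderiv ℝ (N.logC c) (q, q)) (q, q) :=
    (N.contDiffAt_logC (N.diag_mem_logDom hq)).hasStrictFDerivAt (by simp)
  have h2 : HasStrictFDerivAt (fun x => N.logC c (q, x))
      ((fderiv ℝ (N.logC c) (q, q)).comp (ContinuousLinearMap.inr ℝ (ℝ × E n) (ℝ × E n))) q :=
    h1.comp q ((hasStrictFDerivAt_const q q).prodMk (hasStrictFDerivAt_id q))
  have hnhd : {x | (q, x) ∈ N.logDom c} ∈ 𝓝 q :=
    ((N.isOpen_logDom c).preimage (by fun_prop : Continuous fun x : ℝ × E n => (q, x))).mem_nhds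
      (N.diag_mem_logDom hq)
  have h3 := fderiv_eq_id_of_fixes_values h2 (N.logC_diag c q) (by
    filter_upwards [hnhd] with x hx
    have := N.fderiv_logC_fixes hx
    rwa [h2.hasFDerivAt.fderiv] at this) hnhd N.logC_injOn
  have h4 : HasFDerivAt (fun x => N.logC c (x, x)) ((fderiv ℝ (N.logC c) (q, q)).comp
      ((ContinuousLinearMap.id ℝ (ℝ × E n)).prod (ContinuousLinearMap.id ℝ (ℝ × E n)))) q :=
    HasFDerivAt.comp (f := fun x => (x, x)) q h1.hasFDerivAt ((hasFDerivAt_id q).prodMk (hasFDerivAt_id q))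
  have h5 : (fun x => N.logC c (x, x)) = fun _ => 0 := funext (N.logC_diag c)
  rw [h5] at h4
  have h6 := h4.unique (hasFDerivAt_const 0 q)
  refine h1.congr_fderiv ?_
  refine ContinuousLinearMap.ext fun w => ?_
  have e1 := congrArg (fun L : (ℝ × E n) →L[ℝ] (ℝ × E n) => L (w.2 - w.1)) h3
  have e2 := congrArg (fun L : (ℝ × E n) →L[ℝ] (ℝ × E n) => L w.1) h6
  simp only [ContinuousLinearMap.comp_apply, ContinuousLinearMap.inr_apply,
    ContinuousLinearMap.id_apply, ContinuousLinearMap.prod_apply, zero_apply] at e1 e2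
  have e3 : w = (w.1, w.1) + (0, w.2 - w.1) := by
    ext1 <;> simp
  rw [e3, map_add, e1, e2]
  simp

end Spacetime.NormalNeighbourhoods

/-! ### The local exponential map as an inverse of the logarithm -/

section Calculus

variable {V W : Type*} [NormedAddCommGroup V] [NormedSpace ℝ V] [CompleteSpace V]
  [NormedAddCommGroup W] [NormedSpace ℝ W]

theorem exists_local_inverse {f : V → W} {f' : V ≃L[ℝ] W} {a : V} {k : WithTop ℕ∞}
    (hf : ContDiffAt ℝ k f a) (hf' : HasFDerivAt f (f' : V →L[ℝ] W) a) (hk : k ≠ 0) :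
    ∃ h : W → V, ContDiffAt ℝ k h (f a) ∧ h (f a) = a ∧ (∀ᶠ x in 𝓝 a, h (f x) = x) ∧
      ∀ᶠ y in 𝓝 (f a), f (h y) = y :=
  ⟨hf.localInverse hf' hk, hf.to_localInverse hf' hk, hf.localInverse_apply_image hf' hk,
    (hf.hasStrictFDerivAt' hf' hk).eventually_left_inverse,
    (hf.hasStrictFDerivAt' hf' hk).eventually_right_inverse⟩

end Calculus

namespace Spacetime

variable {n : ℕ} {S : Type*} [TopologicalSpace S] [ChartedSpace (EuclideanSpace ℝ (Fin n)) S]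
  [IsManifold (𝓡 n) ∞ S] {g : Spacetime n S}

/-- `e` is the exponential map in the chart centred at `c`, near the zero vector at the point with
coordinates `q₀`. -/
structure IsLocalExp (g : Spacetime n S) (c : S) (q₀ : ℝ × E n)
    (e : (ℝ × E n) × (ℝ × E n) → ℝ × E n) (ρ : ℝ) : Prop where
  pos : 0 < ρ
  mem : ∀ q, ‖q - q₀‖ < ρ → q ∈ chartDom n c
  smooth : ∀ q v, ‖q - q₀‖ < ρ → ‖v‖ < ρ → ContDiffAt ℝ 2 e (q, v)
  map_mem : ∀ q v, ‖q - q₀‖ < ρ → ‖v‖ < ρ → e (q, v) ∈ chartDom n c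
  map_zero : ∀ q, ‖q - q₀‖ < ρ → e (q, 0) = q
  fderiv_zero : ∀ q v, ‖q - q₀‖ < ρ → fderiv ℝ e (q, 0) (0, v) = v
  ode : ∀ (q v : ℝ × E n) (r : ℝ), ‖q - q₀‖ < ρ → ‖r • v‖ < ρ →
    fderiv ℝ (fderiv ℝ e) (q, r • v) (0, v) (0, v) =
      accL (g.chartG c) (e (q, r • v)) (fderiv ℝ e (q, r • v) (0, v))
        (fderiv ℝ e (q, r • v) (0, v))

theorem vec_smul (c : S) (q : ℝ × E n) (a : ℝ) (v : ℝ × E n) :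
    vec n c q (a • v) = a • vec n c q v := by
  ext1
  · rfl
  · exact (chartDsymm n c q.2).map_smul a v.2

theorem hasDerivAt_prod_line (q v : ℝ × E n) (r : ℝ) :
    HasDerivAt (fun r : ℝ => (q, r • v)) ((0, v) : (ℝ × E n) × (ℝ × E n)) r := by
  have := (hasDerivAt_const r q).prodMk ((hasDerivAt_id r).smul_const v)
  simpa using this

variable [T2Space S] (N : g.NormalNeighbourhoods)

/-- The map `(q, x) ↦ (q, log_q x)` has the invertible differential `(fst, snd - fst)` on the
diagonal. The second component of its local inverse is the exponential map, with joint regularity in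
base point and vector. -/
theorem NormalNeighbourhoods.exists_inverse_logC {c : S} {q₀ : ℝ × E n}
    (hq₀ : q₀ ∈ chartDom n c) :
    ∃ (e : (ℝ × E n) × (ℝ × E n) → ℝ × E n) (ρ : ℝ), 0 < ρ ∧ ∀ q, ‖q - q₀‖ < ρ →
      q ∈ chartDom n c ∧ e (q, 0) = q ∧ ∀ v, ‖v‖ < ρ → ContDiffAt ℝ 2 e (q, v) ∧
        (q, e (q, v)) ∈ N.logDom c ∧ N.logC c (q, e (q, v)) = v := by
  let T : ((ℝ × E n) × (ℝ × E n)) ≃L[ℝ] ((ℝ × E n) × (ℝ × E n)) :=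
    ContinuousLinearEquiv.equivOfInverse
      ((ContinuousLinearMap.fst ℝ (ℝ × E n) (ℝ × E n)).prod
        (ContinuousLinearMap.snd ℝ (ℝ × E n) (ℝ × E n) -
          ContinuousLinearMap.fst ℝ (ℝ × E n) (ℝ × E n)))
      ((ContinuousLinearMap.fst ℝ (ℝ × E n) (ℝ × E n)).prod
        (ContinuousLinearMap.snd ℝ (ℝ × E n) (ℝ × E n) +
          ContinuousLinearMap.fst ℝ (ℝ × E n) (ℝ × E n)))
      (fun x => by simp) (fun x => by simp)
  have hT : HasFDerivAt (fun y : (ℝ × E n) × (ℝ × E n) => (y.1, N.logC c y))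
      (T : _ →L[ℝ] _) (q₀, q₀) :=
    hasFDerivAt_fst.prodMk (N.hasStrictFDerivAt_logC hq₀).hasFDerivAt
  have hΨ : ContDiffAt ℝ 2 (fun y : (ℝ × E n) × (ℝ × E n) => (y.1, N.logC c y)) (q₀, q₀) :=
    contDiffAt_fst.prodMk ((N.contDiffAt_logC (N.diag_mem_logDom hq₀)).of_le two_le_infty)
  obtain ⟨h, h1, h2, h3, h4⟩ := exists_local_inverse hΨ hT (by norm_num)
  simp only [N.logC_diag] at h1 h2 h4
  have h5 : ∀ᶠ y in 𝓝 ((q₀, 0) : (ℝ × E n) × (ℝ × E n)), h y ∈ N.logDom c :=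
    h1.continuousAt.eventually_mem
      (h2.symm ▸ (N.isOpen_logDom c).mem_nhds (N.diag_mem_logDom hq₀))
  have h6 : ∀ᶠ q in 𝓝 q₀, h (q, 0) = (q, q) := by
    have : Filter.Tendsto (fun q : ℝ × E n => (q, q)) (𝓝 q₀) (𝓝 (q₀, q₀)) :=
      (continuous_id.prodMk continuous_id).tendsto q₀
    filter_upwards [this.eventually h3] with q hq
    simpa only [N.logC_diag] using hq
  obtain ⟨ρ₁, hρ₁, h7⟩ := Metric.eventually_nhds_iff.1
    (h6.and ((isOpen_chartDom c).mem_nhds hq₀))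
  obtain ⟨ρ₂, hρ₂, h8⟩ := Metric.eventually_nhds_iff.1
    ((h1.eventually (by simp)).and (h4.and h5))
  refine ⟨fun y => (h y).2, min ρ₁ ρ₂, lt_min hρ₁ hρ₂, fun q hq => ?_⟩
  obtain ⟨h9, h10⟩ := h7 (y := q) (by rw [dist_eq_norm]; exact hq.trans_le (min_le_left _ _))
  refine ⟨h10, by simp only [h9], fun v hv => ?_⟩
  obtain ⟨h11, h12, h13⟩ := h8 (y := (q, v)) (by
    rw [Prod.dist_eq, dist_eq_norm, dist_eq_norm, sub_zero]
    exact max_lt (hq.trans_le (min_le_right _ _)) (hv.trans_le (min_le_right _ _)))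
  have h14 : (h (q, v)).1 = q := congrArg Prod.fst h12
  have h15 : h (q, v) = (q, (h (q, v)).2) := Prod.ext h14 rfl
  refine ⟨contDiffAt_snd.comp _ h11, h15 ▸ h13, ?_⟩
  rw [← h15]
  exact congrArg Prod.snd h12

/-- For `r ∈ [0, 1]` both `γ r` and the point with coordinates `e (q, r • v)` have logarithm `r`
times that of the endpoint, and the logarithm is injective on a normal neighbourhood. -/
theorem NormalNeighbourhoods.geodesic_eq_pt {c : S} {q₀ : ℝ × E n}
    {e : (ℝ × E n) × (ℝ × E n) → ℝ × E n} {ρ : ℝ}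
    (H : ∀ q, ‖q - q₀‖ < ρ →
      q ∈ chartDom n c ∧ e (q, 0) = q ∧ ∀ v, ‖v‖ < ρ → ContDiffAt ℝ 2 e (q, v) ∧
        (q, e (q, v)) ∈ N.logDom c ∧ N.logC c (q, e (q, v)) = v) {q v : ℝ × E n}
    (hq : ‖q - q₀‖ < ρ) (hv : ‖v‖ < ρ) :
    g.IsGeodesicFrom (pt n c q) (vec n c q v) (g.geodesic (pt n c q) (vec n c q v)) ∧
      ∀ r ∈ Icc (0 : ℝ) 1, g.geodesic (pt n c q) (vec n c q v) r = pt n c (e (q, r • v)) := by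
  obtain ⟨-, -, h1⟩ := H q hq
  obtain ⟨-, h2, h3⟩ := h1 v hv
  have h4 : vec n c q v = N.logV (pt n c q) (pt n c (e (q, v))) := by
    have := N.vec_logC h2
    rwa [h3] at this
  rw [h4]
  refine ⟨N.isGeodesicFrom_log h2.2.2, fun r hr => ?_⟩
  obtain ⟨h5, h6⟩ := N.logV_geodesic h2.2.2 hr
  have hrv : ‖r • v‖ < ρ := by
    rw [norm_smul, Real.norm_eq_abs, abs_of_nonneg hr.1]
    exact (mul_le_of_le_one_left (norm_nonneg v) hr.2).trans_lt hv
  obtain ⟨-, h7, h8⟩ := h1 _ hrv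
  refine N.logV_injOn _ h5 h7.2.2 ?_
  rw [h6, ← h4, ← vec_smul]
  have := N.vec_logC h7
  rwa [h8] at this

end Spacetime

namespace Spacetime

variable {n : ℕ} {S : Type*} [TopologicalSpace S] [ChartedSpace (EuclideanSpace ℝ (Fin n)) S]
  [IsManifold (𝓡 n) ∞ S] {g : Spacetime n S}

theorem hasDerivAt_fderiv_line {e : (ℝ × E n) × (ℝ × E n) → ℝ × E n} {q v : ℝ × E n} {r : ℝ}
    (he : ContDiffAt ℝ 2 e (q, r • v)) (w : (ℝ × E n) × (ℝ × E n)) :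
    HasDerivAt (fun r : ℝ => fderiv ℝ e (q, r • v) w)
      (fderiv ℝ (fderiv ℝ e) (q, r • v) (0, v) w) r := by
  have h1 : ContDiffAt ℝ 1 (fderiv ℝ e) (q, r • v) := he.fderiv_right (by norm_num)
  have h2 : HasFDerivAt (fderiv ℝ e) (fderiv ℝ (fderiv ℝ e) (q, r • v)) (q, r • v) :=
    (h1.differentiableAt (by norm_num)).hasFDerivAt
  have h3 := h2.comp_hasDerivAt r (hasDerivAt_prod_line q v r)
  have h4 := ((ContinuousLinearMap.apply ℝ (ℝ × E n) w).hasFDerivAt).comp_hasDerivAt r h3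
  exact h4

theorem hasDerivAt_line {e : (ℝ × E n) × (ℝ × E n) → ℝ × E n} {q v : ℝ × E n} {r : ℝ}
    (he : ContDiffAt ℝ 2 e (q, r • v)) :
    HasDerivAt (fun r : ℝ => e (q, r • v)) (fderiv ℝ e (q, r • v) (0, v)) r :=
  ((he.differentiableAt (by norm_num)).hasFDerivAt).comp_hasDerivAt r (hasDerivAt_prod_line q v r)

variable [T2Space S] (N : g.NormalNeighbourhoods)

/-- For `0 < r < 1` the curve `r ↦ e (q, r • v)` is the coordinate expression of a geodesic, so its
second derivative is the Christoffel term. -/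
theorem NormalNeighbourhoods.exp_ode_unit {c : S} {q₀ : ℝ × E n}
    {e : (ℝ × E n) × (ℝ × E n) → ℝ × E n} {ρ : ℝ}
    (H : ∀ q, ‖q - q₀‖ < ρ →
      q ∈ chartDom n c ∧ e (q, 0) = q ∧ ∀ v, ‖v‖ < ρ → ContDiffAt ℝ 2 e (q, v) ∧
        (q, e (q, v)) ∈ N.logDom c ∧ N.logC c (q, e (q, v)) = v) {q v : ℝ × E n}
    (hq : ‖q - q₀‖ < ρ) (hv : ‖v‖ < ρ) {r : ℝ} (hr : r ∈ Ioo (0 : ℝ) 1) :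
    fderiv ℝ (fderiv ℝ e) (q, r • v) (0, v) (0, v) =
      accL (g.chartG c) (e (q, r • v)) (fderiv ℝ e (q, r • v) (0, v))
        (fderiv ℝ e (q, r • v) (0, v)) := by
  obtain ⟨h1, h2⟩ := N.geodesic_eq_pt H hq hv
  set γ := g.geodesic (pt n c q) (vec n c q v) with hγ
  obtain ⟨-, -, δ, hδ, h3⟩ := h1.exists_Ioo
  obtain ⟨-, -, h4⟩ := H q hq
  have hrv : ∀ r ∈ Ioo (0 : ℝ) 1, ‖r • v‖ < ρ := fun r hr => by
    rw [norm_smul, Real.norm_eq_abs, abs_of_pos hr.1]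
    exact (mul_le_of_le_one_left (norm_nonneg v) hr.2.le).trans_lt hv
  have hI : ∀ r ∈ Ioo (0 : ℝ) 1, r ∈ Ioo (-δ) (1 + δ) := fun r hr =>
    ⟨by linarith [hr.1], by linarith [hr.2]⟩
  have hsrc : ∀ r ∈ Ioo (0 : ℝ) 1,
      (γ r).2 ∈ (chartAt (EuclideanSpace ℝ (Fin n)) c).source := fun r hr => by
    rw [h2 r (Ioo_subset_Icc_self hr)]
    exact pt_mem (h4 _ (hrv r hr)).2.1.2.1
  have hco : ∀ r ∈ Ioo (0 : ℝ) 1, coordPt n c (γ r) = e (q, r • v) := fun r hr => by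
    rw [h2 r (Ioo_subset_Icc_self hr)]
    exact coordPt_pt (h4 _ (hrv r hr)).2.1.2.1
  have hvel : ∀ r ∈ Ioo (0 : ℝ) 1,
      cvec n c (γ r) (vel n γ r) = fderiv ℝ e (q, r • v) (0, v) := fun r hr => by
    have h5 := hasDerivAt_coordPt (h3.mdifferentiableAt isOpen_Ioo (hI r hr)) (hsrc r hr)
    have h6 := hasDerivAt_line (h4 _ (hrv r hr)).1
    refine h5.unique (h6.congr_of_eventuallyEq ?_)
    filter_upwards [isOpen_Ioo.mem_nhds hr] with r' hr' using hco r' hr'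
  have h7 := IsParallelOn.hasDerivAt (U := vel n γ) h3.2 (hI r hr)
    (h3.mdifferentiableAt isOpen_Ioo (hI r hr)) (hsrc r hr)
  rw [hvel r hr, hco r hr] at h7
  refine (hasDerivAt_fderiv_line (h4 _ (hrv r hr)).1 _).unique (h7.congr_of_eventuallyEq ?_)
  filter_upwards [isOpen_Ioo.mem_nhds hr] with r' hr' using (hvel r' hr').symm

theorem NormalNeighbourhoods.exp_ode_ne_zero {c : S} {q₀ : ℝ × E n}
    {e : (ℝ × E n) × (ℝ × E n) → ℝ × E n} {ρ : ℝ}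
    (H : ∀ q, ‖q - q₀‖ < ρ →
      q ∈ chartDom n c ∧ e (q, 0) = q ∧ ∀ v, ‖v‖ < ρ → ContDiffAt ℝ 2 e (q, v) ∧
        (q, e (q, v)) ∈ N.logDom c ∧ N.logC c (q, e (q, v)) = v) {q v : ℝ × E n} {r : ℝ}
    (hq : ‖q - q₀‖ < ρ) (hv : ‖r • v‖ < ρ) (hr : r ≠ 0) :
    fderiv ℝ (fderiv ℝ e) (q, r • v) (0, v) (0, v) =
      accL (g.chartG c) (e (q, r • v)) (fderiv ℝ e (q, r • v) (0, v))
        (fderiv ℝ e (q, r • v) (0, v)) := by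
  -- The vector `r • v` is placed strictly inside a slightly longer one, at parameter `a⁻¹ < 1` on
  -- the ray of `a • r • v`. Both sides are homogeneous of degree two in the direction, so the
  -- factor `a * r`, possibly negative, is divided out twice.
  have h1 : ∀ᶠ a : ℝ in 𝓝[>] 1, ‖a • r • v‖ < ρ := by
    have : Filter.Tendsto (fun a : ℝ => ‖a • r • v‖) (𝓝 1) (𝓝 ‖(1 : ℝ) • r • v‖) :=
      (continuous_id.smul continuous_const).norm.tendsto 1
    rw [one_smul] at this
    exact (this.eventually (gt_mem_nhds hv)).filter_mono nhdsWithin_le_nhds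
  obtain ⟨a, ha, ha1⟩ := (h1.and self_mem_nhdsWithin).exists
  have ha0 : (0 : ℝ) < a := zero_lt_one.trans ha1
  have h2 := N.exp_ode_unit H hq ha (r := a⁻¹) ⟨inv_pos.2 ha0, inv_lt_one_of_one_lt₀ ha1⟩
  rw [inv_smul_smul₀ ha0.ne', smul_smul] at h2
  have h3 : (((0 : ℝ × E n), (a * r) • v) : (ℝ × E n) × (ℝ × E n)) =
      (a * r) • ((0 : ℝ × E n), v) := by ext1 <;> simp
  have har : a * r ≠ 0 := mul_ne_zero ha0.ne' hr
  rw [h3, map_smul, map_smul, map_smul, accL_smul_left, accL_smul_right,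
    smul_apply] at h2
  exact smul_right_injective _ har (smul_right_injective _ har h2)

/-- At `r = 0` the equation is the limit of its instances for `r ≠ 0`; this is where continuity of
the second derivative of `e` enters. -/
theorem NormalNeighbourhoods.exp_ode_zero {c : S} {q₀ : ℝ × E n}
    {e : (ℝ × E n) × (ℝ × E n) → ℝ × E n} {ρ : ℝ} (hρ : 0 < ρ)
    (H : ∀ q, ‖q - q₀‖ < ρ →
      q ∈ chartDom n c ∧ e (q, 0) = q ∧ ∀ v, ‖v‖ < ρ → ContDiffAt ℝ 2 e (q, v) ∧
        (q, e (q, v)) ∈ N.logDom c ∧ N.logC c (q, e (q, v)) = v) {q : ℝ × E n} (v : ℝ × E n)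
    (hq : ‖q - q₀‖ < ρ) :
    fderiv ℝ (fderiv ℝ e) (q, (0 : ℝ) • v) (0, v) (0, v) =
      accL (g.chartG c) (e (q, (0 : ℝ) • v)) (fderiv ℝ e (q, (0 : ℝ) • v) (0, v))
        (fderiv ℝ e (q, (0 : ℝ) • v) (0, v)) := by
  obtain ⟨-, -, h4⟩ := H q hq
  have h0 : ‖(0 : ℝ) • v‖ < ρ := by simpa using hρ
  have he := (h4 _ h0).1
  have hl : ContinuousAt (fun r : ℝ => (q, r • v)) 0 := (hasDerivAt_prod_line q v 0).continuousAt
  have h1 : ContDiffAt ℝ 1 (fderiv ℝ e) (q, (0 : ℝ) • v) := he.fderiv_right (by norm_num)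
  have h2 : ContinuousAt (fderiv ℝ (fderiv ℝ e)) (q, (0 : ℝ) • v) :=
    (h1.fderiv_right (m := 0) (by norm_num)).continuousAt
  have c1 : ContinuousAt (fun r : ℝ => fderiv ℝ (fderiv ℝ e) (q, r • v) (0, v) (0, v)) 0 :=
    ((ContinuousAt.comp (x := (0 : ℝ)) (f := fun r : ℝ => (q, r • v)) h2 hl).clm_apply
      continuousAt_const).clm_apply continuousAt_const
  have c2 : ContinuousAt (fun r : ℝ => fderiv ℝ e (q, r • v) (0, v)) 0 :=
    (hasDerivAt_fderiv_line he _).continuousAt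
  have c3 : ContinuousAt (fun r : ℝ => e (q, r • v)) 0 := (hasDerivAt_line he).continuousAt
  have hd := (h4 _ h0).2.1.2.1
  have c4 := (contDiffAt_accL (fderiv ℝ e (q, (0 : ℝ) • v) (0, v))
    (fderiv ℝ e (q, (0 : ℝ) • v) (0, v)) (fun _ => g.chartG_nondegenerate hd)
    (g.contDiffAt_chartG hd)).continuousAt
  have c5 : ContinuousAt (fun r : ℝ => accL (g.chartG c) (e (q, r • v))
      (fderiv ℝ e (q, r • v) (0, v)) (fderiv ℝ e (q, r • v) (0, v))) 0 :=
    ContinuousAt.comp (x := (0 : ℝ)) (f := fun r : ℝ => (e (q, r • v),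
      fderiv ℝ e (q, r • v) (0, v), fderiv ℝ e (q, r • v) (0, v))) c4
      (c3.prodMk (c2.prodMk c2))
  have h5 : ∀ᶠ r : ℝ in 𝓝[≠] 0, fderiv ℝ (fderiv ℝ e) (q, r • v) (0, v) (0, v) =
      accL (g.chartG c) (e (q, r • v)) (fderiv ℝ e (q, r • v) (0, v))
        (fderiv ℝ e (q, r • v) (0, v)) := by
    have h6 : ContinuousAt (fun r : ℝ => ‖r • v‖) 0 := by fun_prop
    filter_upwards [(h6.eventually (gt_mem_nhds h0)).filter_mono nhdsWithin_le_nhds,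
      self_mem_nhdsWithin] with r hr hr0 using N.exp_ode_ne_zero H hq hr hr0
  exact tendsto_nhds_unique_of_eventuallyEq (c1.tendsto.mono_left nhdsWithin_le_nhds)
    (c5.tendsto.mono_left nhdsWithin_le_nhds) h5

theorem exists_isLocalExp (N : g.NormalNeighbourhoods) {c : S} {q₀ : ℝ × E n}
    (hq₀ : q₀ ∈ chartDom n c) : ∃ e ρ, IsLocalExp g c q₀ e ρ := by
  obtain ⟨e, ρ, hρ, H⟩ := N.exists_inverse_logC hq₀
  refine ⟨e, ρ, hρ, fun q hq => (H q hq).1, fun q v hq hv => ((H q hq).2.2 v hv).1,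
    fun q v hq hv => ((H q hq).2.2 v hv).2.1.2.1, fun q hq => (H q hq).2.1, fun q v hq => ?_,
    fun q v r hq hv => ?_⟩
  · obtain ⟨h1, h2, h3⟩ := H q hq
    -- Differentiating `logC (q, e (q, r • v)) = r • v` at `r = 0` and using the known differential
    -- of the logarithm on the diagonal gives the derivative of `e` in the vector variable.
    have h0 : ‖(0 : ℝ) • v‖ < ρ := by simpa using hρ
    have h4 := hasDerivAt_line (h3 _ h0).1
    have h5 := (hasDerivAt_const (0 : ℝ) q).prodMk h4
    have h6 : HasFDerivAt (N.logC c) (ContinuousLinearMap.snd ℝ (ℝ × E n) (ℝ × E n) -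
      ContinuousLinearMap.fst ℝ (ℝ × E n) (ℝ × E n)) (q, e (q, (0 : ℝ) • v)) := by
      rw [zero_smul, h2]
      exact (N.hasStrictFDerivAt_logC h1).hasFDerivAt
    have h7 := h6.comp_hasDerivAt (0 : ℝ) h5
    have h8 : HasDerivAt (fun r : ℝ => r • v) v 0 := by
      simpa using (hasDerivAt_id (0 : ℝ)).smul_const v
    have h9 : (N.logC c ∘ fun r : ℝ => (q, e (q, r • v))) =ᶠ[𝓝 0] fun r : ℝ => r • v := by
      have h10 : ContinuousAt (fun r : ℝ => ‖r • v‖) 0 := by fun_prop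
      filter_upwards [h10.eventually (gt_mem_nhds h0)] with r hr using (h3 _ hr).2.2
    have h11 := h7.unique (h8.congr_of_eventuallyEq h9)
    simpa using h11
  · rcases eq_or_ne r 0 with rfl | hr
    · exact N.exp_ode_zero hρ H v hq
    · exact N.exp_ode_ne_zero H hq hv hr

theorem IsLocalExp.isGeodesicOn {c : S} {q₀ : ℝ × E n}
    {e : (ℝ × E n) × (ℝ × E n) → ℝ × E n} {ρ : ℝ} (h : IsLocalExp g c q₀ e ρ) {q : ℝ × E n}
    (p : ℝ × E n) (hq : ‖q - q₀‖ < ρ) :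
    IsOpen {r : ℝ | ‖r • p‖ < ρ} ∧ OrdConnected {r : ℝ | ‖r • p‖ < ρ} ∧
    g.IsGeodesicOn (fun r => pt n c (e (q, r • p))) {r : ℝ | ‖r • p‖ < ρ} ∧
      ∀ r : ℝ, ‖r • p‖ < ρ → vel n (fun r => pt n c (e (q, r • p))) r =
        vec n c (e (q, r • p)) (fderiv ℝ e (q, r • p) (0, p)) := by
  have ho : IsOpen {r : ℝ | ‖r • p‖ < ρ} :=
    isOpen_lt (continuous_id.smul continuous_const).norm continuous_const
  refine ⟨ho, ?_, isGeodesicOn_of_chart ho (fun r hr => h.map_mem q _ hq hr)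
    (fun r hr => hasDerivAt_line (h.smooth q _ hq hr)) fun r hr => ?_⟩
  · refine ⟨fun r hr r' hr' x hx => ?_⟩
    simp only [mem_ofPred_eq, norm_smul, Real.norm_eq_abs] at hr hr' ⊢
    refine (mul_le_mul_of_nonneg_right (abs_le_max_abs_abs hx.1 hx.2) (norm_nonneg p)).trans_lt ?_
    rcases max_choice |r| |r'| with h | h <;> rwa [h]
  · have h1 := hasDerivAt_fderiv_line (h.smooth q _ hq hr) (0, p)
    rwa [h.ode q p r hq hr] at h1

end Spacetime

namespace Spacetime

variable {n : ℕ} {S : Type*} [TopologicalSpace S] [ChartedSpace (EuclideanSpace ℝ (Fin n)) S]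
  [IsManifold (𝓡 n) ∞ S] {g : Spacetime n S}

/-! ### States of null geodesics -/

/-- `z = (X, v)` is a point together with a future pointing null vector. -/
def IsNullFuture (g : Spacetime n S) (z : (ℝ × S) × (ℝ × E n)) : Prop :=
  g.gM z.1 z.2 z.2 = 0 ∧ 0 < z.2.1

/-- The states `z` and `z'` lie on the same geodesic. -/
def Joins (g : Spacetime n S) (z z' : (ℝ × S) × (ℝ × E n)) : Prop :=
  ∃ (I : Set ℝ) (γ : ℝ → ℝ × S), IsOpen I ∧ I.OrdConnected ∧ g.IsGeodesicOn γ I ∧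
    ∃ r ∈ I, ∃ r' ∈ I, (γ r, vel n γ r) = z ∧ (γ r', vel n γ r') = z'

theorem Joins.symm {z z' : (ℝ × S) × (ℝ × E n)} (h : g.Joins z z') : g.Joins z' z := by
  obtain ⟨I, γ, hI, hc, hγ, r, hr, r', hr', e, e'⟩ := h
  exact ⟨I, γ, hI, hc, hγ, r', hr', r, hr, e', e⟩

theorem ordConnected_preimage_affine {I : Set ℝ} (hI : I.OrdConnected) {a : ℝ} (ha : 0 < a)
    (b : ℝ) : ((fun r : ℝ => a * r + b) ⁻¹' I).OrdConnected :=
  hI.preimage_mono fun x y hxy => by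
    have := mul_le_mul_of_nonneg_left hxy ha.le
    simpa using this

theorem Joins.smul {z z' : (ℝ × S) × (ℝ × E n)} (h : g.Joins z z') {a : ℝ} (ha : 0 < a) :
    g.Joins (z.1, a • z.2) (z'.1, a • z'.2) := by
  obtain ⟨I, γ, hI, hc, hγ, r, hr, r', hr', rfl, rfl⟩ := h
  obtain ⟨h1, h2⟩ := isGeodesicOn_comp_affine hI hγ a 0
  have key : ∀ r, a * (a⁻¹ * r) + 0 = r := fun r => by
    rw [add_zero, mul_inv_cancel_left₀ ha.ne']
  refine ⟨_, _, hI.preimage (by fun_prop), ordConnected_preimage_affine hc ha 0, h1, a⁻¹ * r, ?_,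
    a⁻¹ * r', ?_, ?_, ?_⟩
  · rwa [mem_preimage, key]
  · rwa [mem_preimage, key]
  · rw [h2 _ (by rwa [key]), key]
  · rw [h2 _ (by rwa [key]), key]

theorem hM_eq_zero {X : ℝ × S} {v : E n} (h : g.hM X v v = 0) : v = 0 := by
  by_contra hv
  exact (g.hM_pos X hv).ne' h

theorem hasDerivAt_time {γ : ℝ → ℝ × S} {I : Set ℝ} (hI : IsOpen I) (hγ : g.IsGeodesicOn γ I)
    {r : ℝ} (hr : r ∈ I) : HasDerivAt (fun r => (γ r).1) (vel n γ r).1 r := by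
  have h := hasDerivAt_coordPt (hγ.mdifferentiableAt hI hr)
    (mem_chart_source (EuclideanSpace ℝ (Fin n)) (γ r).2)
  exact (hasFDerivAt_fst (𝕜 := ℝ) (E := ℝ) (F := E n)).comp_hasDerivAt r h

variable [T2Space S]

/-- The second curve is shifted in parameter until the common state occurs at the same value, and
the two geodesics are glued there. -/
theorem Joins.trans {z z' z'' : (ℝ × S) × (ℝ × E n)} (h : g.Joins z z') (h' : g.Joins z' z'') :
    g.Joins z z'' := by
  obtain ⟨I, γ, hI, hc, hγ, r, hr, r', hr', e1, e2⟩ := h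
  obtain ⟨J, γ', hJ, hc', hγ', t, ht, t', ht', e3, e4⟩ := h'
  obtain ⟨h1, h2⟩ := isGeodesicOn_comp_affine hJ hγ' 1 (t - r')
  have k1 : 1 * r' + (t - r') = t := by ring
  have k2 : 1 * (t' - (t - r')) + (t - r') = t' := by ring
  have m1 : r' ∈ (fun r : ℝ => 1 * r + (t - r')) ⁻¹' J := by rwa [mem_preimage, k1]
  have m2 : t' - (t - r') ∈ (fun r : ℝ => 1 * r + (t - r')) ⁻¹' J := by rwa [mem_preimage, k2]
  have e5 := e2.trans e3.symm
  rw [Prod.mk.injEq] at e5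
  obtain ⟨γ'', h3, h4, h5, h6, h7⟩ := exists_geodesic_union hI (hJ.preimage (by fun_prop)) hc
    (ordConnected_preimage_affine hc' one_pos _) hγ h1 hr' m1
    (by simpa only [k1] using e5.1) (by rw [h2 _ m1, k1, one_smul]; exact e5.2)
  refine ⟨_, γ'', h4, h5, h3, r, Or.inl hr, t' - (t - r'), Or.inr m2, ?_, ?_⟩
  · rw [(h6 r hr).1, (h6 r hr).2, e1]
  · rw [(h7 _ m2).1, (h7 _ m2).2, h2 _ m2, k2, one_smul, e4]

/-- A null vector without time component is zero, and a geodesic whose velocity vanishes once is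
constant. Hence the time component of the velocity never vanishes, and being a derivative it keeps
its sign. -/
theorem IsNullFuture.along {γ : ℝ → ℝ × S} {I : Set ℝ} (hI : IsOpen I) (hc : I.OrdConnected)
    (hγ : g.IsGeodesicOn γ I) {r₀ : ℝ} (hr₀ : r₀ ∈ I) (h : g.IsNullFuture (γ r₀, vel n γ r₀)) :
    ∀ r ∈ I, g.IsNullFuture (γ r, vel n γ r) := by
  have h1 : ∀ r ∈ I, g.gM (γ r) (vel n γ r) (vel n γ r) = 0 := fun r hr =>
    (energy_const hI hc hγ hr hr₀).trans h.1
  have h2 : ∀ r ∈ I, (vel n γ r).1 ≠ 0 := by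
    intro r hr h0
    have h3 := h1 r hr
    rw [gM_apply, h0, mul_zero, mul_zero, zero_sub, neg_eq_zero] at h3
    have h4 : vel n γ r = 0 := Prod.ext h0 (hM_eq_zero h3)
    -- Comparison with the constant geodesic at `γ r`, obtained from the affine reparametrisation
    -- with factor `0`.
    obtain ⟨h5, h6⟩ := isGeodesicOn_comp_affine hI hγ 0 r
    have h7 : I ⊆ (fun x : ℝ => 0 * x + r) ⁻¹' I := fun x _ => by
      rwa [mem_preimage, zero_mul, zero_add]
    have h8 : ∀ x, vel n (fun x => γ (0 * x + r)) x = 0 := fun x => by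
      rw [h6 x (by rwa [zero_mul, zero_add]), zero_smul]
    have h9 := (geodesic_unique hI hc hγ (h5.mono h7) hr (by rw [zero_mul, zero_add])
      (by rw [h8, h4]) r₀ hr₀).2
    rw [h8] at h9
    have h10 := h.2
    rw [h9] at h10
    exact lt_irrefl _ h10
  have h3 := hasDerivWithinAt_forall_lt_or_forall_gt_of_forall_ne hc.convex
    (fun r hr => (hasDerivAt_time hI hγ hr).hasDerivWithinAt) h2
  rcases h3 with h3 | h3
  · exact absurd h.2 (h3 r₀ hr₀).not_gt
  · exact fun r hr => ⟨h1 r hr, h3 r hr⟩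

theorem Joins.isNullFuture {z z' : (ℝ × S) × (ℝ × E n)} (h : g.Joins z z')
    (hz : g.IsNullFuture z) : g.IsNullFuture z' := by
  obtain ⟨I, γ, hI, hc, hγ, r, hr, r', hr', rfl, rfl⟩ := h
  exact hz.along hI hc hγ hr r' hr'

theorem strictMonoOn_time {γ : ℝ → ℝ × S} {I : Set ℝ} (hI : IsOpen I) (hc : I.OrdConnected)
    (hγ : g.IsGeodesicOn γ I) {r₀ : ℝ} (hr₀ : r₀ ∈ I) (h : g.IsNullFuture (γ r₀, vel n γ r₀)) :
    StrictMonoOn (fun r => (γ r).1) I := by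
  refine strictMonoOn_of_deriv_pos hc.convex
    (fun r hr => (hasDerivAt_time hI hγ hr).continuousAt.continuousWithinAt) fun r hr => ?_
  rw [hI.interior_eq] at hr
  rw [(hasDerivAt_time hI hγ hr).deriv]
  exact (h.along hI hc hγ hr₀ r hr).2

/-- There is only one state at a given time on a null geodesic. -/
theorem Joins.eq_of_time_eq {z z₁ z₂ : (ℝ × S) × (ℝ × E n)} (hz : g.IsNullFuture z)
    -- Through symmetry and transitivity both states lie on one null geodesic, on which time is
    -- strictly increasing.
    (h₁ : g.Joins z z₁) (h₂ : g.Joins z z₂) (ht : z₁.1.1 = z₂.1.1) : z₁ = z₂ := by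
  obtain ⟨I, γ, hI, hc, hγ, r, hr, r', hr', rfl, rfl⟩ := h₁.symm.trans h₂
  rw [(strictMonoOn_time hI hc hγ hr (h₁.isNullFuture hz)).injOn hr hr' ht]

/-! ### The flow and geodesic states -/

theorem sigma_cotM_eq_iff {X Y : ℝ × S} {v : CotM n X} {w : CotM n Y} :
    (⟨X, v⟩ : Σ X : ℝ × S, CotM n X) = ⟨Y, w⟩ ↔ X = Y ∧ @Eq ((ℝ × E n) →L[ℝ] ℝ) v w := by
  constructor
  · intro h
    cases h
    exact ⟨rfl, rfl⟩
  · rintro ⟨rfl, h⟩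
    exact congrArg (Sigma.mk X) h

/-- The vector dual to a covector of `M`, as a vector of the model space. -/
def shM (g : Spacetime n S) (X : ℝ × S) (Ξ : (ℝ × E n) →L[ℝ] ℝ) : ℝ × E n := g.sharp X Ξ

/-- The null covector `η_+`, as a covector of the model space. -/
def nullL (g : Spacetime n S) (s : ℝ) (y : S) (η : E n →L[ℝ] ℝ) : (ℝ × E n) →L[ℝ] ℝ :=
  g.nullLift s y η

/-- The norm of a covector of the model space. -/
def conM (g : Spacetime n S) (s : ℝ) (y : S) (η : E n →L[ℝ] ℝ) : ℝ := g.conorm s y η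

theorem gM_shM (X : ℝ × S) (Ξ : (ℝ × E n) →L[ℝ] ℝ) : g.gM X (g.shM X Ξ) = Ξ :=
  ContinuousLinearMap.ext fun w => (g.metric_eq X _ w).symm.trans (g.metric_sharp X Ξ w)

theorem shM_eq_iff (X : ℝ × S) (Ξ : (ℝ × E n) →L[ℝ] ℝ) (v : ℝ × E n) :
    g.shM X Ξ = v ↔ Ξ = g.gM X v := by
  constructor
  · rintro rfl
    exact (gM_shM X Ξ).symm
  · intro h
    have h1 : g.gM X (g.shM X Ξ - v) = 0 := by
      rw [map_sub, gM_shM, h, sub_self]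
    exact sub_eq_zero.1 (g.gM_nondegenerate X fun w => by rw [h1]; rfl)

theorem shM_gM (X : ℝ × S) (v : ℝ × E n) : g.shM X (g.gM X v) = v :=
  (shM_eq_iff X _ v).2 rfl

theorem shM_smul (X : ℝ × S) (a : ℝ) (Ξ : (ℝ × E n) →L[ℝ] ℝ) :
    g.shM X (a • Ξ) = a • g.shM X Ξ := by
  rw [shM_eq_iff, map_smul, gM_shM]

theorem conM_pos (s : ℝ) (y : S) {η : E n →L[ℝ] ℝ} (hη : η ≠ 0) : 0 < g.conM s y η :=
  g.conorm_pos s y η hη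

/-- The initial state of the Levi-Civita flow: the vector `(η_+)^♯` at `(s, y)`. -/
def nullState (g : Spacetime n S) (s : ℝ) (y : S) (η : E n →L[ℝ] ℝ) : (ℝ × S) × (ℝ × E n) :=
  ((s, y), g.shM (s, y) (g.nullL s y η))

theorem isNullFuture_nullState (s : ℝ) (y : S) {η : E n →L[ℝ] ℝ} (hη : η ≠ 0) :
    g.IsNullFuture (g.nullState s y η) := by
  obtain ⟨-, h1, h2⟩ := (g.isNull_iff_eq_nullLift s y η hη _).2 rfl
  exact ⟨(g.metric_eq _ _ _).symm.trans h1, h2⟩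

/-- The flow runs along the geodesic with initial vector `(η_+)^♯ / ‖η‖` but transports `η_+`
itself. The transported vector is `‖η‖` times the velocity, so the affine reparametrisation with
factor `‖η‖⁻¹` identifies flow points with states of the geodesic issuing from `(η_+)^♯`. -/
theorem isFlowAt_of_joins {τ s : ℝ} {y : S} {η : E n →L[ℝ] ℝ} (hη : η ≠ 0)
    {z : (ℝ × S) × (ℝ × E n)} (h : g.Joins (g.nullState s y η) z) (ht : z.1.1 = τ) :
    g.IsFlowAt τ s y η ⟨z.1, g.gM z.1 z.2⟩ := by
  have hc := conM_pos (g := g) s y hη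
  obtain ⟨I, γ, hI, hcn, hγ, r, hr, r', hr', e1, e2⟩ := h
  set b := g.conM s y η with hb
  set a := b⁻¹ with ha
  have ha0 : 0 < a := inv_pos.2 hc
  have hba : b * a = 1 := mul_inv_cancel₀ hc.ne'
  have k : ∀ x, a * (s + b * (x - r)) + (r - a * s) = x := fun x => by
    linear_combination (x - r) * hba
  obtain ⟨h1, h2⟩ := isGeodesicOn_comp_affine hI hγ a (r - a * s)
  set γ' : ℝ → ℝ × S := fun x => γ (a * x + (r - a * s)) with hγ'
  have hI' : IsOpen ((fun x => a * x + (r - a * s)) ⁻¹' I) := hI.preimage (by fun_prop)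
  have ks : a * s + (r - a * s) = r := by ring
  have ms : a * s + (r - a * s) ∈ I := by rwa [ks]
  have e1' := Prod.ext_iff.1 e1
  have e2' := Prod.ext_iff.1 e2
  dsimp only at e1' e2'
  have f1 : γ' s = (s, y) := by
    rw [hγ']
    dsimp only
    rw [ks, e1'.1]
    rfl
  have f2 : vel n γ' s = a • g.shM (s, y) (g.nullL s y η) := by
    rw [h2 s ms, ks, e1'.2]
    rfl
  have f3 : γ' (s + b * (r' - r)) = z.1 := by
    rw [hγ']
    dsimp only
    rw [k, e2'.1]
  have f4 : vel n γ' (s + b * (r' - r)) = a • z.2 := by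
    rw [h2 _ (by rwa [k]), k, e2'.2]
  have par : g.IsParallelOn γ' (fun x => (b • vel n γ' x : ℝ × E n))
    ((fun x => a * x + (r - a * s)) ⁻¹' I) := IsParallelOn.smul hI' h1 h1.2 b
  refine ⟨(fun x => a * x + (r - a * s)) ⁻¹' I, γ', fun x => g.gM (γ' x) (b • vel n γ' x), hI',
    ordConnected_preimage_affine hcn ha0 _, ms, h1, sigma_tanM_eq_iff.2 ⟨f1, ?_⟩, ?_,
    sigma_cotM_eq_iff.2 ⟨f1, ?_⟩, s + b * (r' - r), ?_, ?_, (sigma_cotM_eq_iff.2 ⟨f3, ?_⟩).symm⟩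
  · exact f2.trans (shM_smul _ a _).symm
  · have h3 : (fun x => g.shM (γ' x) (g.gM (γ' x) (b • vel n γ' x))) =
        fun x => (b • vel n γ' x : ℝ × E n) := funext fun x => shM_gM _ _
    exact h3.symm ▸ par
  · change g.gM (γ' s) (b • vel n γ' s) = g.nullL s y η
    rw [f2, f1, smul_smul, hba, one_smul, gM_shM]
  · rwa [mem_preimage, k]
  · rw [f3, ht]
  · change g.gM (γ' _) (b • vel n γ' _) = g.gM z.1 z.2
    rw [f4, f3, smul_smul, hba, one_smul]

theorem IsFlowAt.joins {τ s : ℝ} {y : S} {η : E n →L[ℝ] ℝ} (hη : η ≠ 0)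
    {p : Σ X : ℝ × S, CotM n X} (h : g.IsFlowAt τ s y η p) :
    ∃ z : (ℝ × S) × (ℝ × E n), g.Joins (g.nullState s y η) z ∧ z.1.1 = τ ∧
      p = ⟨z.1, g.gM z.1 z.2⟩ := by
  have hc := conM_pos (g := g) s y hη
  obtain ⟨I, γ, Θ, hI, hcn, hs, hγ, e1, hpar, e2, r, hr, ht, rfl⟩ := h
  have e1 := sigma_tanM_eq_iff.1 e1
  have e2 := sigma_cotM_eq_iff.1 e2
  have hv : vel n γ s = (g.conM s y η)⁻¹ • g.shM (s, y) (g.nullL s y η) :=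
    e1.2.trans (shM_smul _ _ _)
  have hv' : g.conM s y η • vel n γ s = g.shM (s, y) (g.nullL s y η) := by
    rw [hv, smul_smul, mul_inv_cancel₀ hc.ne', one_smul]
  have h0 : g.shM (γ s) (Θ s) = g.conM s y η • vel n γ s := by
    refine (shM_eq_iff _ _ _).2 ?_
    rw [hv', e1.1, gM_shM]
    exact e2.2
  -- `Θ^♯` and `‖η‖` times the velocity are parallel fields with the same initial value.
  have h1 := parallel_unique (U₁ := fun r => g.shM (γ r) (Θ r))
    (U₂ := fun r => g.conM s y η • vel n γ r) hI hcn hγ hγ hpar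
    (IsParallelOn.smul hI hγ hγ.2 (g.conM s y η)) hs rfl rfl h0 r hr
  have h2 := (shM_eq_iff _ _ _).1 h1.2.2
  refine ⟨(γ r, g.conM s y η • vel n γ r), ?_, ht, sigma_cotM_eq_iff.2 ⟨rfl, h2⟩⟩
  have h3 : g.Joins (γ s, vel n γ s) (γ r, vel n γ r) :=
    ⟨I, γ, hI, hcn, hγ, s, hs, r, hr, rfl, rfl⟩
  have h4 := h3.smul hc
  dsimp only at h4
  rw [hv', e1.1] at h4
  exact h4

/-- The flow is a choice among admissible points. There is only one, because a null geodesic has a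
single state at each time; hence any state found at time `τ` computes the flow. -/
theorem flow_eq_of_joins {τ s : ℝ} {y : S} {η : E n →L[ℝ] ℝ} (hη : η ≠ 0)
    {z : (ℝ × S) × (ℝ × E n)} (h : g.Joins (g.nullState s y η) z) (ht : z.1.1 = τ) :
    g.flow τ s y η = ⟨z.1, g.gM z.1 z.2⟩ := by
  have hex : ∃ p, g.IsFlowAt τ s y η p := ⟨_, isFlowAt_of_joins hη h ht⟩
  have h1 : g.flow τ s y η = hex.choose := dif_pos hex
  obtain ⟨z', h2, h3, h4⟩ := hex.choose_spec.joins hη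
  rw [h1, h4, Joins.eq_of_time_eq (isNullFuture_nullState s y hη) h2 h (h3.trans ht.symm)]

end Spacetime

/-! ### Bounds on null vectors and short-time existence, uniform in the null vector -/

theorem exists_le_of_pos {W : Type*} [NormedAddCommGroup W] [NormedSpace ℝ W]
    [FiniteDimensional ℝ W] (B : W →L[ℝ] W →L[ℝ] ℝ) (hB : ∀ u, u ≠ 0 → 0 < B u u) :
    ∃ m > 0, ∀ u, m * ‖u‖ ^ 2 ≤ B u u := by
  have hp : ProperSpace W := FiniteDimensional.proper ℝ W
  have hc : Continuous fun u => B u u := by fun_prop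
  rcases (Metric.sphere (0 : W) 1).eq_empty_or_nonempty with h0 | h0
  · refine ⟨1, one_pos, fun u => ?_⟩
    rcases eq_or_ne u 0 with rfl | hu
    · simp
    · have : ‖u‖⁻¹ • u ∈ Metric.sphere (0 : W) 1 := by
        simp [norm_smul, inv_mul_cancel₀ (norm_ne_zero_iff.2 hu)]
      rw [h0] at this
      exact this.elim
  · obtain ⟨u₀, hu₀, hmin⟩ := (isCompact_sphere (0 : W) 1).exists_isMinOn h0 hc.continuousOn
    have hu₀' : u₀ ≠ 0 := by
      rintro rfl
      simp at hu₀
    refine ⟨B u₀ u₀, hB _ hu₀', fun u => ?_⟩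
    rcases eq_or_ne u 0 with rfl | hu
    · simp
    · have hn := norm_ne_zero_iff.2 hu
      have h1 : ‖u‖⁻¹ • u ∈ Metric.sphere (0 : W) 1 := by
        simp [norm_smul, inv_mul_cancel₀ hn]
      have h2 : B u₀ u₀ ≤ B (‖u‖⁻¹ • u) (‖u‖⁻¹ • u) := hmin h1
      simp only [map_smul, smul_apply, smul_eq_mul] at h2
      calc B u₀ u₀ * ‖u‖ ^ 2 ≤ (‖u‖⁻¹ * (‖u‖⁻¹ * B u u)) * ‖u‖ ^ 2 :=
            mul_le_mul_of_nonneg_right h2 (by positivity)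
        _ = B u u := by field_simp

namespace Spacetime

variable {n : ℕ} {S : Type*} [TopologicalSpace S] [ChartedSpace (EuclideanSpace ℝ (Fin n)) S]
  [IsManifold (𝓡 n) ∞ S] {g : Spacetime n S}

theorem chartG_split (c : S) (q p : ℝ × E n) :
    g.chartG c q p p = g.chartG c q (1, 0) (1, 0) * p.1 ^ 2 + g.chartG c q (0, p.2) (0, p.2) := by
  simp only [chartG_apply, gM_apply, vec, map_zero]
  ring

theorem chartG_neg {c : S} {q : ℝ × E n} (hq : q ∈ chartDom n c) {u : E n} (hu : u ≠ 0) :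
    g.chartG c q (0, u) (0, u) < 0 := by
  simp only [chartG_apply, gM_apply, vec]
  have h : chartDsymm n c q.2 u ≠ 0 := fun h => by
    have := chartD_chartDsymm (n := n) (c := c) (u := q.2) hq u
    rw [h, map_zero] at this
    exact hu this.symm
  have := g.hM_pos (pt n c q) h
  simpa using this

theorem chartG_zero_one (c : S) (q : ℝ × E n) (u : E n) : g.chartG c q (1, 0) (0, u) = 0 := by
  simp [chartG_apply, gM_apply, vec]

/-- Null vectors are bounded by their time component, locally uniformly. -/
theorem exists_null_bound (g : Spacetime n S) {c : S} {q₀ : ℝ × E n} (hq₀ : q₀ ∈ chartDom n c) :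
    ∃ C : ℝ, 1 ≤ C ∧ ∀ᶠ q in 𝓝 q₀, ∀ p : ℝ × E n, g.chartG c q p p = 0 → 0 < p.1 →
      ‖p‖ ≤ C * p.1 := by
  let i : E n →L[ℝ] (ℝ × E n) := ContinuousLinearMap.inr ℝ ℝ (E n)
  have hi : ∀ u, ‖i u‖ = ‖u‖ := fun u => by simp [i]
  -- The spatial part of `-g` at `q₀` is bounded below by `m`. Nearby it loses at most `m / 2` while
  -- the time coefficient stays below `A`, so a null vector satisfies `(m / 2)‖p.2‖² ≤ A p.1²`; this
  -- is the origin of `√(2A / m)`.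
  obtain ⟨m, hm, h1⟩ := exists_le_of_pos (-((g.chartG c q₀).bilinearComp i i)) fun u hu => by
    have := chartG_neg (g := g) hq₀ hu
    simpa [i] using this
  set A := g.chartG c q₀ (1, 0) (1, 0) + 1 with hA
  have hcont := (g.contDiffAt_chartG hq₀).continuousAt
  have hA0 : ∀ᶠ q in 𝓝 q₀, g.chartG c q (1, 0) (1, 0) < A := by
    have : ContinuousAt (fun q => g.chartG c q (1, 0) (1, 0)) q₀ :=
      (hcont.clm_apply continuousAt_const).clm_apply continuousAt_const
    exact this.eventually (gt_mem_nhds (lt_add_one _))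
  have hm2 : ∀ᶠ q in 𝓝 q₀, ‖g.chartG c q - g.chartG c q₀‖ < m / 2 := by
    have : ContinuousAt (fun q => ‖g.chartG c q - g.chartG c q₀‖) q₀ :=
      (hcont.sub continuousAt_const).norm
    exact this.eventually (gt_mem_nhds (by simpa using hm))
  refine ⟨max 1 (Real.sqrt (2 * A / m)), le_max_left _ _, ?_⟩
  filter_upwards [hA0, hm2] with q hq1 hq2 p hp hp1
  have h2 : -(g.chartG c q₀ (0, p.2) (0, p.2)) - -(g.chartG c q (0, p.2) (0, p.2)) ≤
      m / 2 * ‖p.2‖ ^ 2 := by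
    have h3 := (g.chartG c q - g.chartG c q₀).le_opNorm₂ (i p.2) (i p.2)
    rw [hi] at h3
    have h4 := (le_abs_self _).trans (h3.trans (b := _) (c := m / 2 * ‖p.2‖ * ‖p.2‖) (by gcongr))
    simp only [sub_apply] at h4
    have h5 : i p.2 = (0, p.2) := rfl
    rw [h5] at h4
    linarith [pow_two ‖p.2‖]
  have h3 : m * ‖p.2‖ ^ 2 ≤ -(g.chartG c q₀ (0, p.2) (0, p.2)) := h1 p.2
  have h4 := chartG_split (g := g) c q p
  rw [hp] at h4
  have h5 : m / 2 * ‖p.2‖ ^ 2 ≤ A * p.1 ^ 2 := by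
    have : g.chartG c q (1, 0) (1, 0) * p.1 ^ 2 ≤ A * p.1 ^ 2 :=
      mul_le_mul_of_nonneg_right hq1.le (sq_nonneg _)
    linarith
  have h6 : ‖p.2‖ ≤ Real.sqrt (2 * A / m) * p.1 := by
    have h7 : ‖p.2‖ ^ 2 ≤ (2 * A / m) * p.1 ^ 2 := by
      rw [div_mul_eq_mul_div, le_div_iff₀ hm]
      linarith
    calc ‖p.2‖ = Real.sqrt (‖p.2‖ ^ 2) := (Real.sqrt_sq (norm_nonneg _)).symm
      _ ≤ Real.sqrt ((2 * A / m) * p.1 ^ 2) := Real.sqrt_le_sqrt h7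
      _ = Real.sqrt (2 * A / m) * p.1 := by
          rw [Real.sqrt_mul' _ (sq_nonneg _), Real.sqrt_sq hp1.le]
  rw [Prod.norm_def]
  refine max_le ?_ (h6.trans (mul_le_mul_of_nonneg_right (le_max_right _ _) hp1.le))
  rw [Real.norm_eq_abs, abs_of_pos hp1]
  exact le_mul_of_one_le_left hp1.le (le_max_left _ _)

/-- Near `q₀`, null geodesics starting at time `t` reach all times near `t` within the domain of
the local exponential map. -/
theorem IsLocalExp.exists_time {c : S} {q₀ : ℝ × E n}
    {e : (ℝ × E n) × (ℝ × E n) → ℝ × E n} {ρ : ℝ} (h : IsLocalExp g c q₀ e ρ) :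
    ∃ η > 0, η ≤ ρ ∧ ∃ δ > 0, ∀ q p : ℝ × E n, ‖q - q₀‖ < η → g.chartG c q p p = 0 → 0 < p.1 →
      ∀ τ : ℝ, |τ - q.1| < δ → ∃ r : ℝ, ‖r • p‖ < ρ ∧ (e (q, r • p)).1 = τ := by
  have h00 : ‖q₀ - q₀‖ < ρ := by simpa using h.pos
  have h0 : ‖(0 : ℝ × E n)‖ < ρ := by simpa using h.pos
  obtain ⟨C, hC, hnull⟩ := g.exists_null_bound (h.mem q₀ h00)
  have hC0 : 0 < C := zero_lt_one.trans_le hC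
  have h1 : ContDiffAt ℝ 1 (fderiv ℝ e) (q₀, 0) := (h.smooth q₀ 0 h00 h0).fderiv_right (by norm_num)
  have h2 : ∀ᶠ y in 𝓝 ((q₀, 0) : (ℝ × E n) × (ℝ × E n)),
      ‖fderiv ℝ e y - fderiv ℝ e (q₀, 0)‖ < (2 * C)⁻¹ := by
    have : ContinuousAt (fun y => ‖fderiv ℝ e y - fderiv ℝ e (q₀, 0)‖) (q₀, 0) :=
      (h1.continuousAt.sub continuousAt_const).norm
    exact this.eventually (gt_mem_nhds (by simpa using hC0))
  obtain ⟨η₁, hη₁, h3⟩ := Metric.eventually_nhds_iff.1 h2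
  obtain ⟨η₂, hη₂, h4⟩ := Metric.eventually_nhds_iff.1 hnull
  set η := min (min η₁ η₂) ρ with hη
  have hη0 : 0 < η := lt_min (lt_min hη₁ hη₂) h.pos
  have hηρ : η ≤ ρ := min_le_right _ _
  have hη₁' : η ≤ η₁ := (min_le_left _ _).trans (min_le_left _ _)
  have hη₂' : η ≤ η₂ := (min_le_left _ _).trans (min_le_right _ _)
  -- With `‖v‖ ≤ C` this keeps `‖r • v‖ ≤ η / 2` for `|r| ≤ R`.
  set R := η / (2 * C) with hR
  have hR0 : 0 < R := by positivity
  refine ⟨η, hη0, hηρ, R / 2, by positivity, fun q p hq hp hp1 τ hτ => ?_⟩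
  -- Normalising the time component to `1` makes all estimates independent of the size of `p`; the
  -- factor is restored in the witness `r * p.1⁻¹`.
  set v : ℝ × E n := p.1⁻¹ • p with hv
  have hv1 : v.1 = 1 := inv_mul_cancel₀ hp1.ne'
  have hvC : ‖v‖ ≤ C := by
    have := h4 (y := q) (by rw [dist_eq_norm]; exact hq.trans_le hη₂') v
      (by rw [hv, map_smul, map_smul, smul_apply, hp, smul_zero, smul_zero])
      (by rw [hv1]; exact one_pos)
    rwa [hv1, mul_one] at this
  have hqρ := hq.trans_le hηρ
  have hrv : ∀ r ∈ Icc (-R) R, ‖r • v‖ < η := fun r hr => by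
    rw [norm_smul, Real.norm_eq_abs]
    calc |r| * ‖v‖ ≤ R * C := mul_le_mul (abs_le.2 hr) hvC (norm_nonneg _) hR0.le
      _ = η / 2 := by rw [hR]; field_simp
      _ < η := by linarith
  have hd : ∀ r ∈ Icc (-R) R, HasDerivAt (fun r : ℝ => (e (q, r • v)).1)
      (fderiv ℝ e (q, r • v) (0, v)).1 r := fun r hr =>
    (hasFDerivAt_fst (𝕜 := ℝ) (E := ℝ) (F := E n)).comp_hasDerivAt r
      (hasDerivAt_line (h.smooth q _ hqρ ((hrv r hr).trans_le hηρ)))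
  -- At `(q₀, 0)` the derivative in direction `v` is `v`, with time component `1`. The deviation is
  -- at most `(2C)⁻¹ * C = 1/2`, so time advances at rate at least `1/2` and the intermediate value
  -- theorem covers `|τ - q.1| < R / 2`.
  have hd2 : ∀ r ∈ Icc (-R) R, 1 / 2 ≤ (fderiv ℝ e (q, r • v) (0, v)).1 := fun r hr => by
    have h5 := h3 (y := (q, r • v)) (by
      rw [Prod.dist_eq, dist_eq_norm, dist_eq_norm, sub_zero]
      exact max_lt (hq.trans_le hη₁') ((hrv r hr).trans_le hη₁'))
    have h6 := (fderiv ℝ e (q, r • v) - fderiv ℝ e (q₀, 0)).le_opNorm (0, v)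
    rw [sub_apply, h.fderiv_zero q₀ v h00] at h6
    have h7 : ‖((0 : ℝ × E n), v)‖ = ‖v‖ := by simp
    have h8 : ‖(fderiv ℝ e (q, r • v) (0, v) - v).1‖ ≤ (2 * C)⁻¹ * C := by
      refine (norm_fst_le _).trans (h6.trans ?_)
      rw [h7]
      exact mul_le_mul h5.le hvC (norm_nonneg _) (by positivity)
    have h9 : (2 * C)⁻¹ * C = 1 / 2 := by field_simp
    rw [h9, Prod.fst_sub, hv1, Real.norm_eq_abs] at h8
    linarith [(abs_le.1 h8).1]
  have h0R : (0 : ℝ) ∈ Icc (-R) R := ⟨by linarith, hR0.le⟩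
  have ht0 : (e (q, (0 : ℝ) • v)).1 = q.1 := by rw [zero_smul, h.map_zero q hqρ]
  have hcont : ContinuousOn (fun r : ℝ => (e (q, r • v)).1) (Icc (-R) R) := fun r hr =>
    (hd r hr).continuousAt.continuousWithinAt
  have hgrow : ∀ x ∈ Icc (-R) R, ∀ y ∈ Icc (-R) R, x ≤ y →
      1 / 2 * (y - x) ≤ (e (q, y • v)).1 - (e (q, x • v)).1 :=
    (convex_Icc (-R) R).mul_sub_le_image_sub_of_le_deriv hcont
      (fun r hr => (hd r (interior_subset hr)).differentiableAt.differentiableWithinAt)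
      fun r hr => by
        rw [(hd r (interior_subset hr)).deriv]
        exact hd2 r (interior_subset hr)
  have h5 := hgrow 0 h0R R ⟨by linarith, le_rfl⟩ hR0.le
  have h6 := hgrow (-R) ⟨le_rfl, by linarith⟩ 0 h0R (by linarith)
  rw [ht0] at h5 h6
  obtain ⟨h7, h8⟩ := abs_lt.1 hτ
  obtain ⟨r, hr, hr'⟩ := intermediate_value_Icc (by linarith : -R ≤ R) hcont
    (show τ ∈ Icc _ _ from ⟨by linarith, by linarith⟩)
  refine ⟨r * p.1⁻¹, ?_, ?_⟩
  · rw [mul_smul]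
    exact (hrv r hr).trans_le hηρ
  · rw [mul_smul]
    exact hr'

end Spacetime

/-! ### The first variation formula for null geodesics -/

namespace Spacetime

variable {n : ℕ} {S : Type*} [TopologicalSpace S] [ChartedSpace (EuclideanSpace ℝ (Fin n)) S]
  [IsManifold (𝓡 n) ∞ S] {g : Spacetime n S}

theorem hasDerivAt_quad {V : Type*} [NormedAddCommGroup V] [NormedSpace ℝ V]
    {G : V → V →L[ℝ] V →L[ℝ] ℝ} {x y w : ℝ → V} {t : ℝ} {x' y' w' : V}
    (hG : DifferentiableAt ℝ G (x t)) (hx : HasDerivAt x x' t) (hy : HasDerivAt y y' t)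
    (hw : HasDerivAt w w' t) :
    HasDerivAt (fun t => G (x t) (y t) (w t))
      (fderiv ℝ G (x t) x' (y t) (w t) + G (x t) y' (w t) + G (x t) (y t) w') t := by
  have h1 : HasDerivAt (fun t => G (x t)) (fderiv ℝ G (x t) x') t :=
    hG.hasFDerivAt.comp_hasDerivAt t hx
  have h2 := (h1.clm_apply hy).clm_apply hw
  exact h2.congr_deriv (by simp only [add_apply])

variable [T2Space S]

theorem IsLocalExp.joins {c : S} {q₀ : ℝ × E n}
    {e : (ℝ × E n) × (ℝ × E n) → ℝ × E n} {ρ : ℝ} (h : IsLocalExp g c q₀ e ρ) {q p : ℝ × E n}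
    {r : ℝ} (hq : ‖q - q₀‖ < ρ) (hr : ‖r • p‖ < ρ) :
    g.Joins (pt n c q, vec n c q p) (pt n c (e (q, r • p)),
      vec n c (e (q, r • p)) (fderiv ℝ e (q, r • p) (0, p))) := by
  obtain ⟨h1, h2, h3, h4⟩ := h.isGeodesicOn p hq
  have h0 : ‖(0 : ℝ) • p‖ < ρ := by simpa using h.pos
  refine ⟨_, _, h1, h2, h3, 0, h0, r, hr, ?_, ?_⟩
  · rw [h4 0 h0, zero_smul, h.map_zero q hq, h.fderiv_zero q p hq]
  · rw [h4 r hr]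

theorem IsLocalExp.isNullFuture {c : S} {q₀ : ℝ × E n}
    {e : (ℝ × E n) × (ℝ × E n) → ℝ × E n} {ρ : ℝ} (h : IsLocalExp g c q₀ e ρ) {q p : ℝ × E n}
    {r : ℝ} (hq : ‖q - q₀‖ < ρ) (hr : ‖r • p‖ < ρ) (hp : g.chartG c q p p = 0) (hp1 : 0 < p.1) :
    g.chartG c (e (q, r • p)) (fderiv ℝ e (q, r • p) (0, p)) (fderiv ℝ e (q, r • p) (0, p)) = 0 ∧
      0 < (fderiv ℝ e (q, r • p) (0, p)).1 := by
  have h1 : g.IsNullFuture (pt n c q, vec n c q p) := ⟨by rw [← chartG_apply, hp], hp1⟩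
  have h2 := (h.joins hq hr).isNullFuture h1
  exact ⟨by rw [chartG_apply]; exact h2.1, h2.2⟩

/-- First variation: the product of the velocity of a null geodesic with the variation field of a
family of null geodesics is constant. -/
theorem IsLocalExp.first_variation {c : S} {q₀ : ℝ × E n}
    {e : (ℝ × E n) × (ℝ × E n) → ℝ × E n} {ρ : ℝ} (h : IsLocalExp g c q₀ e ρ)
    {q p : ℝ → ℝ × E n} {Q A : ℝ × E n} (hq : HasDerivAt q Q 0) (hp : HasDerivAt p A 0)
    (hnull : ∀ᶠ t in 𝓝 0, g.chartG c (q t) (p t) (p t) = 0 ∧ 0 < (p t).1)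
    (hq0 : ‖q 0 - q₀‖ < ρ) {r : ℝ} (hr : ‖r • p 0‖ < ρ) :
    g.chartG c (e (q 0, r • p 0)) (fderiv ℝ e (q 0, r • p 0) (0, p 0))
      (fderiv ℝ e (q 0, r • p 0) (Q, r • A)) = g.chartG c (q 0) (p 0) Q := by
  obtain ⟨ho, hc, -, -⟩ := h.isGeodesicOn (p 0) hq0
  have h0 : ‖(0 : ℝ) • p 0‖ < ρ := by simpa using h.pos
  -- With `v` the velocity and `J` the variation field, `d/dr g(v, J) = g(v, ∇_v J) = g(v, ∇_J v) =
  -- ½ J(g(v, v)) = 0`, the last because every member of the family is null.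
  have hder : ∀ r : ℝ, ‖r • p 0‖ < ρ → HasDerivAt (fun r => g.chartG c (e (q 0, r • p 0))
      (fderiv ℝ e (q 0, r • p 0) (0, p 0)) (fderiv ℝ e (q 0, r • p 0) (Q, r • A))) 0 r := by
    intro r hr
    have he := h.smooth _ _ hq0 hr
    have hd := h.map_mem _ _ hq0 hr
    have hG := g.differentiableAt_chartG hd
    have he1 : DifferentiableAt ℝ e (q 0, r • p 0) := he.differentiableAt (by norm_num)
    have he2 : DifferentiableAt ℝ (fderiv ℝ e) (q 0, r • p 0) :=
      (he.fderiv_right (m := 1) (by norm_num)).differentiableAt (by norm_num)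
    have hsym : IsSymmSndFDerivAt ℝ e (q 0, r • p 0) := he.isSymmSndFDerivAt (by simp)
    -- the variation of the energy
    have hy : HasDerivAt (fun t => (q t, r • p t)) (Q, r • A) 0 := hq.prodMk (hp.const_smul r)
    have hx : HasDerivAt (fun t => e (q t, r • p t)) (fderiv ℝ e (q 0, r • p 0) (Q, r • A)) 0 :=
      HasFDerivAt.comp_hasDerivAt (f := fun t => (q t, r • p t)) 0 he1.hasFDerivAt hy
    have hv0 : HasDerivAt (fun t => ((0 : ℝ × E n), p t)) (0, A) 0 :=
      (hasDerivAt_const 0 0).prodMk hp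
    have hv1 : HasDerivAt (fun t => fderiv ℝ e (q t, r • p t))
        (fderiv ℝ (fderiv ℝ e) (q 0, r • p 0) (Q, r • A)) 0 :=
      HasFDerivAt.comp_hasDerivAt (f := fun t => (q t, r • p t)) 0 he2.hasFDerivAt hy
    have hv := hv1.clm_apply hv0
    have hE := hasDerivAt_quad hG hx hv hv
    have hqc : ∀ᶠ t in 𝓝 (0 : ℝ), ‖q t - q₀‖ < ρ ∧ ‖r • p t‖ < ρ :=
      (((hq.continuousAt.sub continuousAt_const).norm).eventually (gt_mem_nhds hq0)).and
        (((hp.const_smul r).continuousAt.norm).eventually (gt_mem_nhds hr))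
    have hE0 : (fun t => g.chartG c (e (q t, r • p t)) (fderiv ℝ e (q t, r • p t) (0, p t))
        (fderiv ℝ e (q t, r • p t) (0, p t))) =ᶠ[𝓝 0] fun _ => (0 : ℝ) := by
      filter_upwards [hnull, hqc] with t ht ht'
      exact (h.isNullFuture ht'.1 ht'.2 ht.1 ht.2).1
    have h1 := hE.unique ((hasDerivAt_const (0 : ℝ) (0 : ℝ)).congr_of_eventuallyEq hE0)
    -- the derivative along the geodesic
    have hx' := hasDerivAt_line he
    have hv' := hasDerivAt_fderiv_line he (0, p 0)
    rw [h.ode _ _ _ hq0 hr] at hv'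
    have hJ0 : HasDerivAt (fun r : ℝ => (Q, r • A)) (0, A) r := hasDerivAt_prod_line Q A r
    have hJ1 : HasDerivAt (fun r : ℝ => fderiv ℝ e (q 0, r • p 0))
        (fderiv ℝ (fderiv ℝ e) (q 0, r • p 0) (0, p 0)) r :=
      HasFDerivAt.comp_hasDerivAt (f := fun r : ℝ => (q 0, r • p 0)) r he2.hasFDerivAt
        (hasDerivAt_prod_line (q 0) (p 0) r)
    have hJ := hJ1.clm_apply hJ0
    have h2 := hasDerivAt_quad hG hx' hv' hJ
    convert h2 using 1
    have h3 := apply_accL (fun _ => g.chartG_nondegenerate hd)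
      (fderiv ℝ e (q 0, r • p 0) (0, p 0)) (fderiv ℝ e (q 0, r • p 0) (0, p 0))
      (fderiv ℝ e (q 0, r • p 0) (Q, r • A))
    rw [chrisL_apply] at h3
    -- Symmetry of the second derivative of `e` exchanges the derivatives along the geodesic and
    -- across the family.
    rw [h3, hsym.eq (0, p 0) (Q, r • A)]
    rw [g.chartG_symm c _ (_ + _) _] at h1
    linarith
  have h1 : ∀ r ∈ {r : ℝ | ‖r • p 0‖ < ρ}, g.chartG c (e (q 0, r • p 0))
      (fderiv ℝ e (q 0, r • p 0) (0, p 0)) (fderiv ℝ e (q 0, r • p 0) (Q, r • A)) =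
      g.chartG c (e (q 0, (0 : ℝ) • p 0)) (fderiv ℝ e (q 0, (0 : ℝ) • p 0) (0, p 0))
        (fderiv ℝ e (q 0, (0 : ℝ) • p 0) (Q, (0 : ℝ) • A)) := fun r hr =>
    ho.is_const_of_deriv_eq_zero hc.isPreconnected
      (fun r hr => (hder r hr).differentiableAt.differentiableWithinAt)
      (fun r hr => (hder r hr).deriv) hr h0
  rw [h1 r hr, zero_smul, zero_smul, h.map_zero _ hq0, h.fderiv_zero _ _ hq0]
  -- At `r = 0` the variation field is the variation `Q` of the base point, since `e (x, 0) = x` for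
  -- all `x` near `q 0`.
  congr 1
  have he0 : DifferentiableAt ℝ e (q 0, 0) :=
    (h.smooth (q 0) 0 hq0 (by simpa using h.pos)).differentiableAt (by norm_num)
  have h2 : HasFDerivAt (fun x : ℝ × E n => e (x, 0))
      ((fderiv ℝ e (q 0, 0)).comp (ContinuousLinearMap.inl ℝ (ℝ × E n) (ℝ × E n))) (q 0) :=
    HasFDerivAt.comp (f := fun x : ℝ × E n => (x, (0 : ℝ × E n))) (q 0) he0.hasFDerivAt
      (hasFDerivAt_prodMk_left (q 0) 0)
  have h3 : (fun x : ℝ × E n => e (x, 0)) =ᶠ[𝓝 (q 0)] fun x => x := by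
    have : ContinuousAt (fun x : ℝ × E n => ‖x - q₀‖) (q 0) := by fun_prop
    filter_upwards [this.eventually (gt_mem_nhds hq0)] with x hx using h.map_zero x hx
  have h4 := h2.unique ((hasFDerivAt_id (q 0)).congr_of_eventuallyEq h3)
  exact congrArg (fun L : (ℝ × E n) →L[ℝ] (ℝ × E n) => L Q) h4

end Spacetime

/-! ### Solving for the curve parameter as a function of time -/

section Implicit

variable {P : Type*} [NormedAddCommGroup P] [NormedSpace ℝ P] [CompleteSpace P]

/-- The equation `f (r, α) = τ` can be solved for the real variable `r`. -/
theorem exists_implicit {f : ℝ × P → ℝ} {x₀ : ℝ × P} (hf : ContDiffAt ℝ 1 f x₀)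
    (h : fderiv ℝ f x₀ (1, 0) ≠ 0) :
    ∃ R : ℝ × P → ℝ, ContDiffAt ℝ 1 R (f x₀, x₀.2) ∧ R (f x₀, x₀.2) = x₀.1 ∧
      ∀ᶠ y in 𝓝 (f x₀, x₀.2), f (R y, y.2) = y.1 := by
  set L := fderiv ℝ f x₀ with hL
  set t := L (1, 0) with ht
  have hsplit : ∀ x : ℝ × P, L x = x.1 * t + L (0, x.2) := fun x => by
    have : x = x.1 • ((1, 0) : ℝ × P) + (0, x.2) := by ext <;> simp
    conv_lhs => rw [this]
    rw [map_add, map_smul, smul_eq_mul]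
  -- The differential of `(r, α) ↦ (f (r, α), α)` is triangular with nonzero diagonal entry `t`,
  -- hence invertible with the explicit inverse given here.
  let T : (ℝ × P) ≃L[ℝ] (ℝ × P) := ContinuousLinearEquiv.equivOfInverse
    (L.prod (ContinuousLinearMap.snd ℝ ℝ P))
    ((t⁻¹ • (ContinuousLinearMap.fst ℝ ℝ P - L.comp ((ContinuousLinearMap.inr ℝ ℝ P).comp
      (ContinuousLinearMap.snd ℝ ℝ P)))).prod (ContinuousLinearMap.snd ℝ ℝ P))
    (fun x => by
      ext1
      · simp [hsplit x, mul_comm x.1 t, inv_mul_cancel_left₀ h]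
      · simp)
    (fun x => by
      ext1
      · have := hsplit (t⁻¹ * (x.1 - L (0, x.2)), x.2)
        dsimp only at this
        simp only [ContinuousLinearMap.prod_apply, smul_apply,
          sub_apply, ContinuousLinearMap.coe_fst', ContinuousLinearMap.coe_snd',
          ContinuousLinearMap.comp_apply, ContinuousLinearMap.inr_apply, smul_eq_mul]
        rw [this, mul_right_comm, inv_mul_cancel₀ h]
        ring
      · simp)
  have hT : HasFDerivAt (fun x => (f x, x.2)) (T : (ℝ × P) →L[ℝ] (ℝ × P)) x₀ :=
    (hf.differentiableAt (by norm_num)).hasFDerivAt.prodMk hasFDerivAt_snd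
  obtain ⟨i, h1, h2, -, h4⟩ := exists_local_inverse (hf.prodMk contDiffAt_snd) hT (by norm_num)
  refine ⟨fun y => (i y).1, contDiffAt_fst.comp _ h1, by simp only [h2], ?_⟩
  filter_upwards [h4] with y hy
  have h5 := congrArg Prod.snd hy
  dsimp only at h5
  have h6 : ((i y).1, y.2) = i y := Prod.ext rfl h5.symm
  rw [h6]
  exact congrArg Prod.fst hy

end Implicit

/-! ### Smooth families of states and the canonical one-form -/

namespace Spacetime

variable {n : ℕ} {S : Type*} [TopologicalSpace S] [ChartedSpace (EuclideanSpace ℝ (Fin n)) S]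
  [IsManifold (𝓡 n) ∞ S] {g : Spacetime n S}
  {P : Type*} [NormedAddCommGroup P] [NormedSpace ℝ P]

/-- The coordinates of a state in the chart centred at `c`. -/
def stateCoord (c : S) (z : (ℝ × S) × (ℝ × E n)) : (ℝ × E n) × (ℝ × E n) :=
  (coordPt n c z.1, cvec n c z.1 z.2)

/-- The family of states `z` is of class `C¹` at `α₀`, in the chart centred at `c`. -/
structure SmoothFam (c : S) (z : P → (ℝ × S) × (ℝ × E n)) (α₀ : P) : Prop where
  source : (z α₀).1.2 ∈ (chartAt (EuclideanSpace ℝ (Fin n)) c).source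
  cont : ContinuousAt (fun α => (z α).1) α₀
  smooth : ContDiffAt ℝ 1 (fun α => stateCoord c (z α)) α₀

/-- The product of the vectors of the family `z` with the variation of its base points. -/
def pairing (g : Spacetime n S) (c : S) (z : P → (ℝ × S) × (ℝ × E n)) (α₀ a : P) : ℝ :=
  g.chartG c (coordPt n c (z α₀).1) (cvec n c (z α₀).1 (z α₀).2)
    (fderiv ℝ (fun α => coordPt n c (z α).1) α₀ a)

theorem SmoothFam.eventually_source {c : S} {z : P → (ℝ × S) × (ℝ × E n)} {α₀ : P}
    (h : SmoothFam c z α₀) :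
    ∀ᶠ α in 𝓝 α₀, (z α).1.2 ∈ (chartAt (EuclideanSpace ℝ (Fin n)) c).source :=
  (continuousAt_snd.comp h.cont).eventually_mem
    ((chartAt (EuclideanSpace ℝ (Fin n)) c).open_source.mem_nhds h.source)

theorem SmoothFam.smooth_fst {c : S} {z : P → (ℝ × S) × (ℝ × E n)} {α₀ : P}
    (h : SmoothFam c z α₀) : ContDiffAt ℝ 1 (fun α => coordPt n c (z α).1) α₀ :=
  contDiffAt_fst.comp α₀ h.smooth

theorem SmoothFam.smooth_snd {c : S} {z : P → (ℝ × S) × (ℝ × E n)} {α₀ : P}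
    (h : SmoothFam c z α₀) : ContDiffAt ℝ 1 (fun α => cvec n c (z α).1 (z α).2) α₀ :=
  contDiffAt_snd.comp α₀ h.smooth

theorem trans_contDiffAt {c c' : S} {X : ℝ × S}
    (hc : X.2 ∈ (chartAt (EuclideanSpace ℝ (Fin n)) c).source)
    (hc' : X.2 ∈ (chartAt (EuclideanSpace ℝ (Fin n)) c').source) :
    ContDiffAt ℝ ∞ (trans n c c') (coordPt n c X) :=
  contDiffAt_trans (coordPt_mem hc) (by rwa [pt_coordPt hc])

theorem SmoothFam.change {c c' : S} {z : P → (ℝ × S) × (ℝ × E n)} {α₀ : P}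
    (h : SmoothFam c z α₀) (hc' : (z α₀).1.2 ∈ (chartAt (EuclideanSpace ℝ (Fin n)) c').source) :
    SmoothFam c' z α₀ := by
  refine ⟨hc', h.cont, ?_⟩
  have h1 := trans_contDiffAt h.source hc'
  have h2 : ContDiffAt ℝ 1 (fun α => (trans n c c' (coordPt n c (z α).1),
      fderiv ℝ (trans n c c') (coordPt n c (z α).1) (cvec n c (z α).1 (z α).2))) α₀ := by
    refine ContDiffAt.prodMk ?_ (ContDiffAt.clm_apply ?_ h.smooth_snd)
    · exact ContDiffAt.comp α₀ (f := fun α => coordPt n c (z α).1)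
        (h1.of_le (by exact_mod_cast le_top)) h.smooth_fst
    · exact ContDiffAt.comp α₀ (f := fun α => coordPt n c (z α).1)
        (h1.fderiv_right (m := 1) (one_add_one_eq_two.trans_le two_le_infty)) h.smooth_fst
  refine h2.congr_of_eventuallyEq ?_
  have h3 : ∀ᶠ α in 𝓝 α₀, (z α).1.2 ∈ (chartAt (EuclideanSpace ℝ (Fin n)) c').source :=
    (continuousAt_snd.comp h.cont).eventually_mem
      ((chartAt (EuclideanSpace ℝ (Fin n)) c').open_source.mem_nhds hc')
  filter_upwards [h.eventually_source, h3] with α h4 h5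
  rw [trans_coordPt h4, fderiv_trans_cvec h4 h5]
  rfl

/-- The pairing is the metric applied to two vectors that both transform by the Jacobian. Its
invariance allows the conservation law to be carried from chart to chart. -/
theorem SmoothFam.pairing_change {c c' : S} {z : P → (ℝ × S) × (ℝ × E n)} {α₀ : P}
    (h : SmoothFam c z α₀) (hc' : (z α₀).1.2 ∈ (chartAt (EuclideanSpace ℝ (Fin n)) c').source)
    (a : P) : g.pairing c' z α₀ a = g.pairing c z α₀ a := by
  have h1 := trans_contDiffAt h.source hc'
  have h2 : HasFDerivAt (fun α => trans n c c' (coordPt n c (z α).1)) _ α₀ :=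
    HasFDerivAt.comp (f := fun α => coordPt n c (z α).1) α₀
      (h1.differentiableAt (by norm_num)).hasFDerivAt
      (h.smooth_fst.differentiableAt (by norm_num)).hasFDerivAt
  have h3 : (fun α => coordPt n c' (z α).1) =ᶠ[𝓝 α₀]
      fun α => trans n c c' (coordPt n c (z α).1) := by
    filter_upwards [h.eventually_source] with α h4 using (trans_coordPt h4).symm
  have h4 := (h2.congr_of_eventuallyEq h3).fderiv
  have hc := h.source
  rw [pairing, pairing, h4, ← trans_coordPt hc, ← fderiv_trans_cvec hc hc',
    ContinuousLinearMap.comp_apply]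
  exact chartG_trans g (coordPt_mem hc) (by rwa [pt_coordPt hc]) _ _

end Spacetime

namespace Spacetime

variable {n : ℕ} {S : Type*} [TopologicalSpace S] [ChartedSpace (EuclideanSpace ℝ (Fin n)) S]
  [IsManifold (𝓡 n) ∞ S] {g : Spacetime n S}
  {P : Type*} [NormedAddCommGroup P] [NormedSpace ℝ P]

theorem stateCoord_pt {c : S} {q : ℝ × E n} (hq : q ∈ chartDom n c) (p : ℝ × E n) :
    stateCoord c (pt n c q, vec n c q p) = (q, p) := by
  rw [stateCoord, coordPt_pt hq, cvec_vec hq]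

theorem smoothFam_of_coords {c : S} {z : P → (ℝ × S) × (ℝ × E n)} {α₀ : P} {q p : P → ℝ × E n}
    (hz : ∀ᶠ α in 𝓝 α₀, z α = (pt n c (q α), vec n c (q α) (p α)))
    (hq₀ : q α₀ ∈ chartDom n c) (hq : ContDiffAt ℝ 1 q α₀) (hp : ContDiffAt ℝ 1 p α₀) :
    SmoothFam c z α₀ ∧ (fun α => coordPt n c (z α).1) =ᶠ[𝓝 α₀] q ∧
      stateCoord c (z α₀) = (q α₀, p α₀) := by
  have hd : ∀ᶠ α in 𝓝 α₀, q α ∈ chartDom n c :=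
    hq.continuousAt.eventually_mem ((isOpen_chartDom c).mem_nhds hq₀)
  have h0 := hz.self_of_nhds
  refine ⟨⟨?_, ?_, ?_⟩, ?_, ?_⟩
  · rw [h0]
    exact pt_mem hq₀
  · have h1 : ContinuousAt (fun α => pt n c (q α)) α₀ :=
      ContinuousAt.comp (((continuousOn_pt c).continuousAt ((isOpen_chartDom c).mem_nhds hq₀)))
        hq.continuousAt
    refine h1.congr ?_
    filter_upwards [hz] with α hα
    rw [hα]
  · refine (hq.prodMk hp).congr_of_eventuallyEq ?_
    filter_upwards [hz, hd] with α hα hα'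
    rw [hα, stateCoord_pt hα']
  · filter_upwards [hz, hd] with α hα hα'
    rw [hα]
    exact coordPt_pt hα'
  · rw [h0, stateCoord_pt hq₀]

variable [CompleteSpace P] [T2Space S]

/-- Propagation of a smooth family of null states within the domain of a local exponential map. -/
theorem IsLocalExp.propagate {c : S} {q₀ : ℝ × E n}
    {e : (ℝ × E n) × (ℝ × E n) → ℝ × E n} {ρ : ℝ} (h : IsLocalExp g c q₀ e ρ)
    {z : P → (ℝ × S) × (ℝ × E n)} {α₀ : P} (hz : SmoothFam c z α₀)
    (hnull : ∀ᶠ α in 𝓝 α₀, g.IsNullFuture (z α))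
    (hq₀ : ‖coordPt n c (z α₀).1 - q₀‖ < ρ) {r₀ : ℝ}
    (hr₀ : ‖r₀ • cvec n c (z α₀).1 (z α₀).2‖ < ρ) {τ : ℝ}
    (hτ : (e (coordPt n c (z α₀).1, r₀ • cvec n c (z α₀).1 (z α₀).2)).1 = τ) :
    ∃ z' : ℝ × P → (ℝ × S) × (ℝ × E n), SmoothFam c z' (τ, α₀) ∧
      (∀ᶠ β in 𝓝 (τ, α₀), g.Joins (z β.2) (z' β) ∧ (z' β).1.1 = β.1) ∧
      ∀ a, g.pairing c z' (τ, α₀) (0, a) = g.pairing c z α₀ a := by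
  set q : P → ℝ × E n := fun α => coordPt n c (z α).1 with hq
  set p : P → ℝ × E n := fun α => cvec n c (z α).1 (z α).2 with hp
  have hqs : ContDiffAt ℝ 1 q α₀ := hz.smooth_fst
  have hps : ContDiffAt ℝ 1 p α₀ := hz.smooth_snd
  have hsrc := hz.eventually_source
  have hnull' : ∀ᶠ α in 𝓝 α₀, g.chartG c (q α) (p α) (p α) = 0 ∧ 0 < (p α).1 := by
    filter_upwards [hsrc, hnull] with α h1 h2
    exact ⟨(chartG_cvec g h1 _ _).trans h2.1, h2.2⟩
  have hz' : ∀ᶠ α in 𝓝 α₀, z α = (pt n c (q α), vec n c (q α) (p α)) := by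
    filter_upwards [hsrc] with α h1
    exact Prod.ext (pt_coordPt h1).symm (vec_cvec h1 _).symm
  have he := h.smooth _ _ hq₀ hr₀
  have he1 : ContDiffAt ℝ 1 (fderiv ℝ e) (q α₀, r₀ • p α₀) := he.fderiv_right (by norm_num)
  have he1' : ContDiffAt ℝ 1 e (q α₀, r₀ • p α₀) := he.of_le (by norm_num)
  -- the parameter `r` as a function of time
  have hF1 : ContDiffAt ℝ 1 (fun x : ℝ × P => (q x.2, x.1 • p x.2)) (r₀, α₀) :=
    (ContDiffAt.comp (r₀, α₀) (f := fun x : ℝ × P => x.2) hqs contDiffAt_snd).prodMk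
      (contDiffAt_fst.smul (ContDiffAt.comp (r₀, α₀) (f := fun x : ℝ × P => x.2) hps contDiffAt_snd))
  have hF2 : ContDiffAt ℝ 1 (fun x : ℝ × P => (e (q x.2, x.1 • p x.2)).1) (r₀, α₀) :=
    contDiffAt_fst.comp (r₀, α₀) (ContDiffAt.comp (r₀, α₀)
      (f := fun x : ℝ × P => (q x.2, x.1 • p x.2)) he1' hF1)
  have hn0 := hnull'.self_of_nhds
  have hn1 := h.isNullFuture hq₀ hr₀ hn0.1 hn0.2
  -- Null geodesics advance in time, so time can be inverted for the parameter.
  have hF3 : fderiv ℝ (fun x : ℝ × P => (e (q x.2, x.1 • p x.2)).1) (r₀, α₀) (1, 0) ≠ 0 := by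
    have h1 : HasDerivAt (fun r : ℝ => (r, α₀)) ((1, 0) : ℝ × P) r₀ :=
      (hasDerivAt_id r₀).prodMk (hasDerivAt_const r₀ α₀)
    have h2 := (hF2.differentiableAt (by norm_num)).hasFDerivAt.comp_hasDerivAt r₀ h1
    have h3 : HasDerivAt (fun r : ℝ => (e (q α₀, r • p α₀)).1)
        (fderiv ℝ e (q α₀, r₀ • p α₀) (0, p α₀)).1 r₀ :=
      (hasFDerivAt_fst (𝕜 := ℝ) (E := ℝ) (F := E n)).comp_hasDerivAt r₀ (hasDerivAt_line he)
    rw [h2.unique h3]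
    exact hn1.2.ne'
  obtain ⟨R, hR1, hR2, hR3⟩ := exists_implicit hF2 hF3
  have hτ' : ((fun x : ℝ × P => (e (q x.2, x.1 • p x.2)).1) (r₀, α₀), (r₀, α₀).2) = (τ, α₀) :=
    Prod.ext hτ rfl
  rw [hτ'] at hR1 hR2 hR3
  dsimp only at hR2
  -- the propagated family
  have hY : ContDiffAt ℝ 1 (fun β : ℝ × P => (q β.2, R β • p β.2)) (τ, α₀) :=
    (ContDiffAt.comp (τ, α₀) (f := fun x : ℝ × P => x.2) hqs contDiffAt_snd).prodMk
      (hR1.smul (ContDiffAt.comp (τ, α₀) (f := fun x : ℝ × P => x.2) hps contDiffAt_snd))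
  have hY0 : (q α₀, R (τ, α₀) • p α₀) = (q α₀, r₀ • p α₀) := by rw [hR2]
  have hQ : ContDiffAt ℝ 1 (fun β : ℝ × P => e (q β.2, R β • p β.2)) (τ, α₀) :=
    ContDiffAt.comp (τ, α₀) (f := fun β : ℝ × P => (q β.2, R β • p β.2))
      (by dsimp only; rw [hY0]; exact he1') hY
  have hV : ContDiffAt ℝ 1 (fun β : ℝ × P => fderiv ℝ e (q β.2, R β • p β.2) (0, p β.2))
      (τ, α₀) :=
    (ContDiffAt.comp (τ, α₀) (f := fun β : ℝ × P => (q β.2, R β • p β.2))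
      (by dsimp only; rw [hY0]; exact he1) hY).clm_apply (contDiffAt_const.prodMk
        (ContDiffAt.comp (τ, α₀) (f := fun x : ℝ × P => x.2) hps contDiffAt_snd))
  obtain ⟨hs1, hs2, hs3⟩ := smoothFam_of_coords (c := c)
    (z := fun β : ℝ × P => (pt n c (e (q β.2, R β • p β.2)), vec n c (e (q β.2, R β • p β.2))
      (fderiv ℝ e (q β.2, R β • p β.2) (0, p β.2)))) (Filter.Eventually.of_forall fun _ => rfl)
    (by dsimp only; rw [hY0]; exact h.map_mem _ _ hq₀ hr₀) hQ hV
  refine ⟨_, hs1, ?_, fun a => ?_⟩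
  · have hc1 : ∀ᶠ β : ℝ × P in 𝓝 (τ, α₀), ‖q β.2 - q₀‖ < ρ ∧ ‖R β • p β.2‖ < ρ := by
      refine Filter.Eventually.and ?_ ?_
      · have := (contDiffAt_fst.comp (τ, α₀) hY).continuousAt
        exact ((this.sub continuousAt_const).norm).eventually (gt_mem_nhds hq₀)
      · have := (contDiffAt_snd.comp (τ, α₀) hY).continuousAt.norm
        refine this.eventually (gt_mem_nhds ?_)
        change ‖R (τ, α₀) • p α₀‖ < ρ
        rwa [hR2]
    have hsnd : Filter.Tendsto (fun β : ℝ × P => β.2) (𝓝 (τ, α₀)) (𝓝 α₀) :=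
      continuous_snd.tendsto (τ, α₀)
    filter_upwards [hc1, hsnd.eventually hz', hR3] with β h1 h2 h3
    refine ⟨?_, h3⟩
    have h4 := h.joins h1.1 h1.2
    rwa [← h2] at h4
  · have hs4 := Prod.ext_iff.1 hs3
    dsimp only [stateCoord] at hs4
    rw [pairing, hs2.fderiv_eq, hs4.1, hs4.2, pairing]
    have hα : HasDerivAt (fun t : ℝ => α₀ + t • a) a 0 := by
      simpa using ((hasDerivAt_id (0 : ℝ)).smul_const a).const_add α₀
    have hβ : HasDerivAt (fun t : ℝ => (τ, α₀ + t • a)) (0, a) 0 :=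
      (hasDerivAt_const 0 τ).prodMk hα
    have ea : α₀ + (0 : ℝ) • a = α₀ := by simp
    have hqa : HasDerivAt (fun t : ℝ => q (α₀ + t • a)) (fderiv ℝ q α₀ a) 0 :=
      HasFDerivAt.comp_hasDerivAt_of_eq (l := q) (f := fun t : ℝ => α₀ + t • a) 0
        (hqs.differentiableAt (by norm_num)).hasFDerivAt hα ea.symm
    have hpa : HasDerivAt (fun t : ℝ => p (α₀ + t • a)) (fderiv ℝ p α₀ a) 0 :=
      HasFDerivAt.comp_hasDerivAt_of_eq (l := p) (f := fun t : ℝ => α₀ + t • a) 0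
        (hps.differentiableAt (by norm_num)).hasFDerivAt hα ea.symm
    have hRa : HasDerivAt (fun t : ℝ => R (τ, α₀ + t • a)) (fderiv ℝ R (τ, α₀) (0, a)) 0 :=
      HasFDerivAt.comp_hasDerivAt_of_eq (l := R)
        (f := fun t : ℝ => (τ, α₀ + t • a)) 0 (hR1.differentiableAt (by norm_num)).hasFDerivAt hβ
        (by rw [ea])
    have hQa : HasDerivAt (fun t : ℝ => e (q (α₀ + t • a), R (τ, α₀ + t • a) • p (α₀ + t • a)))
        (fderiv ℝ (fun β : ℝ × P => e (q β.2, R β • p β.2)) (τ, α₀) (0, a)) 0 :=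
      HasFDerivAt.comp_hasDerivAt_of_eq (l := fun β : ℝ × P => e (q β.2, R β • p β.2))
        (f := fun t : ℝ => (τ, α₀ + t • a)) 0 (hQ.differentiableAt (by norm_num)).hasFDerivAt hβ
        (by rw [ea])
    have hQa' : HasDerivAt (fun t : ℝ => e (q (α₀ + t • a), R (τ, α₀ + t • a) • p (α₀ + t • a)))
        (fderiv ℝ e (q α₀, r₀ • p α₀) (fderiv ℝ q α₀ a,
          r₀ • fderiv ℝ p α₀ a + fderiv ℝ R (τ, α₀) (0, a) • p α₀)) 0 := by
      have h1 := hqa.prodMk (hRa.smul hpa)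
      have h2 := HasFDerivAt.comp_hasDerivAt_of_eq (l := e)
        (f := fun t : ℝ => (q (α₀ + t • a), R (τ, α₀ + t • a) • p (α₀ + t • a))) 0
        (he.differentiableAt (by norm_num)).hasFDerivAt h1 (by rw [ea, hR2])
      rw [ea, hR2] at h2
      exact h2
    have ht0 : Filter.Tendsto (fun t : ℝ => α₀ + t • a) (𝓝 0) (𝓝 α₀) := by
      have := hα.continuousAt.tendsto
      rwa [ea] at this
    have hfv := h.first_variation hqa hpa (ht0.eventually hnull') (by simpa only [ea] using hq₀)
      (r := r₀) (by simpa only [ea] using hr₀)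
    simp only [ea] at hfv
    -- Stopping at a fixed time instead of a fixed parameter adds a multiple of the velocity to the
    -- variation field. The velocity is null, so the pairing is unaffected and the first variation
    -- formula applies.
    have hsplit : ((fderiv ℝ q α₀ a,
        r₀ • fderiv ℝ p α₀ a + fderiv ℝ R (τ, α₀) (0, a) • p α₀) : (ℝ × E n) × (ℝ × E n)) =
        (fderiv ℝ q α₀ a, r₀ • fderiv ℝ p α₀ a) + fderiv ℝ R (τ, α₀) (0, a) • (0, p α₀) := by
      ext1 <;> simp
    rw [hQa.unique hQa', hR2, hsplit, map_add, map_smul, map_add, map_smul, hn1.1, smul_zero,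
      add_zero, hfv]

end Spacetime

/-! ### Propagation of families of null states to arbitrary times -/

namespace Spacetime

variable {n : ℕ} {S : Type*} [TopologicalSpace S] [ChartedSpace (EuclideanSpace ℝ (Fin n)) S]
  [IsManifold (𝓡 n) ∞ S]
  {P : Type*} [NormedAddCommGroup P] [NormedSpace ℝ P]

/-- The family of states `z'` is the family `z` propagated to times close to `τ`. -/
def IsPropagation (g : Spacetime n S) (c : S) (z : P → (ℝ × S) × (ℝ × E n)) (α₀ : P) (τ : ℝ)
    (c' : S) (z' : ℝ × P → (ℝ × S) × (ℝ × E n)) : Prop :=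
  SmoothFam c' z' (τ, α₀) ∧ (∀ᶠ β in 𝓝 (τ, α₀), g.Joins (z β.2) (z' β) ∧ (z' β).1.1 = β.1) ∧
    ∀ a, g.pairing c' z' (τ, α₀) (0, a) = g.pairing c z α₀ a

variable (P) in
/-- Families of null states at `X` can be propagated through time intervals of length `δ`. -/
def CanPropagate (g : Spacetime n S) (δ : ℝ) (X : ℝ × S) : Prop :=
  ∀ (c : S) (z : P → (ℝ × S) × (ℝ × E n)) (α₀ : P), SmoothFam c z α₀ → (z α₀).1 = X →
    (∀ᶠ α in 𝓝 α₀, g.IsNullFuture (z α)) → ∀ τ, |τ - X.1| < δ → ∃ c' z',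
      g.IsPropagation c z α₀ τ c' z'

variable {g : Spacetime n S} [CompleteSpace P] [T2Space S]

variable (P) in
theorem exists_canPropagate (N : g.NormalNeighbourhoods) (X₀ : ℝ × S) :
    ∃ U ∈ 𝓝 X₀, ∃ δ > 0, ∀ X ∈ U, CanPropagate P g δ X := by
  have hX₀ := mem_chart_source (EuclideanSpace ℝ (Fin n)) X₀.2
  obtain ⟨e, ρ, he⟩ := exists_isLocalExp N (coordPt_mem hX₀)
  obtain ⟨η, hη, hηρ, δ, hδ, h1⟩ := he.exists_time
  have h2 : ∀ᶠ X in 𝓝 X₀, X.2 ∈ (chartAt (EuclideanSpace ℝ (Fin n)) X₀.2).source ∧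
      ‖coordPt n X₀.2 X - coordPt n X₀.2 X₀‖ < η := by
    refine Filter.Eventually.and ?_ ?_
    · exact continuous_snd.continuousAt.eventually_mem
        ((chartAt (EuclideanSpace ℝ (Fin n)) X₀.2).open_source.mem_nhds hX₀)
    · have := ((continuousAt_coordPt hX₀).sub
        (continuousAt_const (y := coordPt n X₀.2 X₀))).norm
      exact this.eventually (gt_mem_nhds (by simpa using hη))
  refine ⟨_, h2, δ, hδ, fun X hX c z α₀ hz hzX hnull τ hτ => ?_⟩
  subst hzX
  have hz' := hz.change hX.1
  have hn := hnull.self_of_nhds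
  obtain ⟨r, hr, ht⟩ := h1 (coordPt n X₀.2 (z α₀).1) (cvec n X₀.2 (z α₀).1 (z α₀).2) hX.2
    ((chartG_cvec g hX.1 _ _).trans hn.1) hn.2 τ hτ
  obtain ⟨z', h3, h4, h5⟩ := he.propagate hz' hnull (hX.2.trans_le hηρ) hr ht
  exact ⟨_, z', h3, h4, fun a => (h5 a).trans (hz.pairing_change hX.1 a)⟩

variable [CompactSpace S]

-- The admissible time step is locally uniform, and `[-R, R] × S` is compact. This bounds the number
-- of steps needed for a given time.
variable (P) in
theorem exists_canPropagate_uniform (N : g.NormalNeighbourhoods) (R : ℝ) :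
    ∃ δ > 0, ∀ X : ℝ × S, |X.1| ≤ R → CanPropagate P g δ X := by
  have hK : IsCompact (Icc (-R) R ×ˢ (univ : Set S)) := isCompact_Icc.prod isCompact_univ
  obtain ⟨δ, hδ, h⟩ : ∃ δ > 0, ∀ X ∈ Icc (-R) R ×ˢ (univ : Set S), CanPropagate P g δ X := by
    refine hK.induction_on (p := fun s => ∃ δ > 0, ∀ X ∈ s, CanPropagate P g δ X)
      ⟨1, one_pos, fun X hX => hX.elim⟩ ?_ ?_ fun X _ => ?_
    · rintro s t hst ⟨δ, hδ, h⟩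
      exact ⟨δ, hδ, fun X hX => h X (hst hX)⟩
    · rintro s t ⟨δ, hδ, h⟩ ⟨δ', hδ', h'⟩
      refine ⟨min δ δ', lt_min hδ hδ', fun X hX c z α₀ hz hzX hn τ hτ => ?_⟩
      rcases hX with hX | hX
      · exact h X hX c z α₀ hz hzX hn τ (hτ.trans_le (min_le_left _ _))
      · exact h' X hX c z α₀ hz hzX hn τ (hτ.trans_le (min_le_right _ _))
    · obtain ⟨U, hU, δ, hδ, h⟩ := exists_canPropagate P N X
      exact ⟨U, mem_nhdsWithin_of_mem_nhds hU, δ, hδ, h⟩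
  exact ⟨δ, hδ, fun X hX => h X ⟨abs_le.1 hX, mem_univ _⟩⟩

/-- A propagated family carries time as an extra parameter; freezing it produces a family over `P`
again, ready for the next step. -/
theorem SmoothFam.comp_prodMk {c : S} {z : ℝ × P → (ℝ × S) × (ℝ × E n)} {τ : ℝ} {α₀ : P}
    (h : SmoothFam c z (τ, α₀)) : SmoothFam c (fun α => z (τ, α)) α₀ ∧
      ∀ a, g.pairing c (fun α => z (τ, α)) α₀ a = g.pairing c z (τ, α₀) (0, a) := by
  have h1 : ContDiffAt ℝ 1 (fun α : P => (τ, α)) α₀ := contDiffAt_const.prodMk contDiffAt_id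
  refine ⟨⟨h.source, ?_, ?_⟩, fun a => ?_⟩
  · exact ContinuousAt.comp (f := fun α : P => (τ, α)) h.cont h1.continuousAt
  · exact ContDiffAt.comp α₀ (f := fun α : P => (τ, α)) h.smooth h1
  · have h2 := HasFDerivAt.comp (f := fun α : P => (τ, α)) α₀
      (h.smooth_fst.differentiableAt (by norm_num)).hasFDerivAt (hasFDerivAt_prodMk_right τ α₀)
    have h3 : fderiv ℝ (fun α => coordPt n c (z (τ, α)).1) α₀ = _ := h2.fderiv
    rw [pairing, h3]
    rfl

/-- Smooth families of null states can be propagated to all times. -/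
theorem exists_isPropagation (N : g.NormalNeighbourhoods) {c : S}
    {z : P → (ℝ × S) × (ℝ × E n)} {α₀ : P} (hz : SmoothFam c z α₀)
    (hn : ∀ᶠ α in 𝓝 α₀, g.IsNullFuture (z α)) (τ : ℝ) :
    ∃ c' z', g.IsPropagation c z α₀ τ c' z' := by
  set s := (z α₀).1.1 with hs
  obtain ⟨δ, hδ, h⟩ := exists_canPropagate_uniform P N (max |s| |τ|)
  -- Induction on the number of steps of length `δ / 2`. All intermediate times lie between `s` and
  -- `τ'`, so the bound `max |s| |τ|` keeps the step size valid.
  have key : ∀ k : ℕ, ∀ τ' : ℝ, |τ'| ≤ max |s| |τ| → |τ' - s| ≤ k * (δ / 2) →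
      ∃ c' z', g.IsPropagation c z α₀ τ' c' z' := by
    intro k
    induction k with
    | zero =>
      intro τ' _ h2
      refine h (z α₀).1 (le_max_left _ _) c z α₀ hz rfl hn τ' (lt_of_le_of_lt ?_ hδ)
      simpa using h2
    | succ k ih =>
      intro τ' h1 h2
      have hk : (0 : ℝ) < k + 1 := by positivity
      -- The intermediate time lies at this fraction of the way: it is within `k` steps of `s` and
      -- leaves at most `δ / 2 < δ` for the last one.
      set a : ℝ := k / (k + 1) with ha
      have ha0 : 0 ≤ a := by positivity
      have ha1 : a ≤ 1 := by
        rw [ha, div_le_one hk]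
        linarith
      have ha2 : 1 - a = 1 / (k + 1) := by
        rw [ha]
        field_simp
        ring
      push_cast at h2
      have h3 : |s + a * (τ' - s)| ≤ max |s| |τ| := by
        have e1 : s + a * (τ' - s) = (1 - a) * s + a * τ' := by ring
        rw [e1]
        refine (abs_add_le _ _).trans ?_
        rw [abs_mul, abs_mul, abs_of_nonneg ha0, abs_of_nonneg (sub_nonneg.2 ha1)]
        have := mul_le_mul_of_nonneg_left h1 ha0
        have := mul_le_mul_of_nonneg_left (le_max_left |s| |τ|) (sub_nonneg.2 ha1)
        linarith
      have h4 : |s + a * (τ' - s) - s| ≤ k * (δ / 2) := by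
        rw [add_sub_cancel_left, abs_mul, abs_of_nonneg ha0]
        calc a * |τ' - s| ≤ a * ((k + 1) * (δ / 2)) := mul_le_mul_of_nonneg_left h2 ha0
          _ = k * (δ / 2) := by rw [ha]; field_simp
      obtain ⟨c₁, z₁, h5, h6, h7⟩ := ih _ h3 h4
      have h8 := h6.self_of_nhds
      have h9 : ContinuousAt (fun α : P => (s + a * (τ' - s), α)) α₀ := by fun_prop
      have h10 := h9.eventually h6
      have h11 : (z₁ (s + a * (τ' - s), α₀)).1.1 = s + a * (τ' - s) := h8.2
      obtain ⟨c₂, z₂, h12, h13, h14⟩ := h _ (by rw [h11]; exact h3) c₁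
        (fun α => z₁ (s + a * (τ' - s), α)) α₀ (h5.comp_prodMk (g := g)).1 rfl
        (by filter_upwards [hn, h10] with α e1 e2 using e2.1.isNullFuture e1) τ' (by
          rw [h11]
          have e2 : τ' - (s + a * (τ' - s)) = (1 - a) * (τ' - s) := by ring
          rw [e2, abs_mul, abs_of_nonneg (sub_nonneg.2 ha1), ha2]
          calc 1 / ((k : ℝ) + 1) * |τ' - s| ≤ 1 / (k + 1) * ((k + 1) * (δ / 2)) :=
                mul_le_mul_of_nonneg_left h2 (by positivity)
            _ = δ / 2 := by field_simp
            _ < δ := by linarith)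
      refine ⟨c₂, z₂, h12, ?_, fun a => ?_⟩
      · have h15 : Filter.Tendsto (fun β : ℝ × P => β.2) (𝓝 (τ', α₀)) (𝓝 α₀) :=
          continuous_snd.tendsto (τ', α₀)
        filter_upwards [h13, h15.eventually h10] with β e1 e2
        exact ⟨e2.1.trans e1.1, e1.2⟩
      · rw [h14, (h5.comp_prodMk (g := g)).2, h7]
  obtain ⟨k, hk⟩ := exists_nat_ge (|τ - s| / (δ / 2))
  refine key k τ (le_max_right _ _) ?_
  rwa [div_le_iff₀ (by positivity)] at hk

end Spacetime

namespace Spacetime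

variable {n : ℕ} {S : Type*} [TopologicalSpace S] [ChartedSpace (EuclideanSpace ℝ (Fin n)) S]
  [IsManifold (𝓡 n) ∞ S] {g : Spacetime n S}

/-! ### Null states parametrised by covectors -/

theorem inverse_chartG {c : S} {q : ℝ × E n} (hq : q ∈ chartDom n c) (v : ℝ × E n) :
    (g.chartG c q).inverse (g.chartG c q v) = v := by
  have h := coe_dualEquiv (g.chartG c q) (fun _ => g.chartG_nondegenerate hq)
  conv_lhs => rw [← h]
  rw [ContinuousLinearMap.inverse_equiv]
  exact ContinuousLinearEquiv.symm_apply_apply _ _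

/-- The squared time component of the null covector which restricts to `ζ`. -/
def nullSq (g : Spacetime n S) (c : S) (q : ℝ × E n) (ζ : E n →L[ℝ] ℝ) : ℝ :=
  -(g.chartG c q (1, 0) (1, 0) * ζ ((g.chartG c q).inverse
    (ζ.comp (ContinuousLinearMap.snd ℝ ℝ (E n)))).2)

/-- The components of the future pointing null vector whose dual covector restricts to `ζ`. -/
def nullCoord (g : Spacetime n S) (c : S) (q : ℝ × E n) (ζ : E n →L[ℝ] ℝ) : ℝ × E n :=
  (g.chartG c q).inverse (Real.sqrt (g.nullSq c q ζ) • ContinuousLinearMap.fst ℝ ℝ (E n) +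
    ζ.comp (ContinuousLinearMap.snd ℝ ℝ (E n)))

/-- The null state with parameters `(t, u, ζ)` in the chart centred at `c`. -/
def parState (g : Spacetime n S) (c : S) (α : ℝ × E n × (E n →L[ℝ] ℝ)) :
    (ℝ × S) × (ℝ × E n) :=
  (pt n c (α.1, α.2.1), vec n c (α.1, α.2.1) (g.nullCoord c (α.1, α.2.1) α.2.2))

/-- The parameters of a state, as a function of its coordinates. -/
def stateParam (g : Spacetime n S) (c : S) (x : (ℝ × E n) × (ℝ × E n)) :
    ℝ × E n × (E n →L[ℝ] ℝ) :=
  (x.1.1, x.1.2, (g.chartG c x.1 x.2).comp (ContinuousLinearMap.inr ℝ ℝ (E n)))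

theorem chartG_time (c : S) (q w : ℝ × E n) :
    g.chartG c q (1, 0) w = g.chartG c q (1, 0) (1, 0) * w.1 := by
  have : w = w.1 • ((1, 0) : ℝ × E n) + (0, w.2) := by ext1 <;> simp
  conv_lhs => rw [this]
  rw [map_add, chartG_zero_one, map_smul, smul_eq_mul, add_zero, mul_comm]

theorem chartG_time_pos (c : S) (q : ℝ × E n) : 0 < g.chartG c q (1, 0) (1, 0) := by
  simpa [chartG_apply, gM_apply, vec] using g.β_pos (pt n c q)

/-- For the covector `θ dt + ζ` nullness reads `θ² / g_tt + g⁻¹(ζ, ζ) = 0`, because the metric has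
no mixed terms; `nullSq` is the resulting value of `θ²`, and `θ = g_tt p.1` for the covector dual to
`p`. -/
theorem nullSq_eq {c : S} {q p : ℝ × E n} (hq : q ∈ chartDom n c) (hp : g.chartG c q p p = 0) :
    g.nullSq c q ((g.chartG c q p).comp (ContinuousLinearMap.inr ℝ ℝ (E n))) =
      (g.chartG c q (1, 0) (1, 0) * p.1) ^ 2 := by
  have h1 : ((g.chartG c q p).comp (ContinuousLinearMap.inr ℝ ℝ (E n))).comp
      (ContinuousLinearMap.snd ℝ ℝ (E n)) = g.chartG c q (0, p.2) := by
    refine ContinuousLinearMap.ext fun w => ?_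
    change g.chartG c q p (0, w.2) = g.chartG c q (0, p.2) w
    have e1 : p = p.1 • ((1, 0) : ℝ × E n) + (0, p.2) := by ext1 <;> simp
    have e2 : w = w.1 • ((1, 0) : ℝ × E n) + (0, w.2) := by ext1 <;> simp
    conv_lhs => rw [e1]
    conv_rhs => rw [e2]
    rw [map_add, map_smul, add_apply, smul_apply, chartG_zero_one, map_add,
      map_smul, g.chartG_symm c q (0, p.2) (1, 0), chartG_zero_one, smul_zero, smul_zero]
  rw [nullSq, h1, inverse_chartG hq]
  change -(g.chartG c q (1, 0) (1, 0) * g.chartG c q p (0, p.2)) = _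
  have e1 : ((0, p.2) : ℝ × E n) = p - p.1 • (1, 0) := by ext1 <;> simp
  rw [e1, map_sub, hp, map_smul, g.chartG_symm c q p (1, 0), chartG_time c q p, smul_eq_mul]
  ring

theorem nullCoord_eq {c : S} {q p : ℝ × E n} (hq : q ∈ chartDom n c) (hp : g.chartG c q p p = 0)
    (hp1 : 0 < p.1) :
    g.nullCoord c q ((g.chartG c q p).comp (ContinuousLinearMap.inr ℝ ℝ (E n))) = p := by
  rw [nullCoord, nullSq_eq hq hp, Real.sqrt_sq (mul_pos (chartG_time_pos c q) hp1).le]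
  have h1 : (g.chartG c q (1, 0) (1, 0) * p.1) • ContinuousLinearMap.fst ℝ ℝ (E n) +
      ((g.chartG c q p).comp (ContinuousLinearMap.inr ℝ ℝ (E n))).comp
        (ContinuousLinearMap.snd ℝ ℝ (E n)) = g.chartG c q p := by
    refine ContinuousLinearMap.ext fun w => ?_
    change g.chartG c q (1, 0) (1, 0) * p.1 * w.1 + g.chartG c q p (0, w.2) = g.chartG c q p w
    have e2 : w = w.1 • ((1, 0) : ℝ × E n) + (0, w.2) := by ext1 <;> simp
    conv_rhs => rw [e2]
    rw [map_add, map_smul, g.chartG_symm c q p (1, 0), chartG_time c q p, smul_eq_mul]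
    ring
  rw [h1, inverse_chartG hq]

/-- A future pointing null covector is recovered from its spatial part, so point and restricted
covector are complete parameters for null states. -/
theorem parState_stateParam {c : S} {z : (ℝ × S) × (ℝ × E n)}
    (hc : z.1.2 ∈ (chartAt (EuclideanSpace ℝ (Fin n)) c).source) (hz : g.IsNullFuture z) :
    g.parState c (g.stateParam c (stateCoord c z)) = z := by
  have h1 : g.chartG c (coordPt n c z.1) (cvec n c z.1 z.2) (cvec n c z.1 z.2) = 0 :=
    (chartG_cvec g hc _ _).trans hz.1
  have h2 : 0 < (cvec n c z.1 z.2).1 := hz.2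
  have h3 := nullCoord_eq (coordPt_mem hc) h1 h2
  refine Prod.ext (pt_coordPt hc) ?_
  change vec n c (coordPt n c z.1) (g.nullCoord c (coordPt n c z.1)
    ((g.chartG c (coordPt n c z.1) (cvec n c z.1 z.2)).comp
      (ContinuousLinearMap.inr ℝ ℝ (E n)))) = z.2
  rw [h3]
  exact vec_cvec hc _

theorem comp_chartD_comp_chartDsymm {c : S} {u : E n} (hu : u ∈ (extChartAt (𝓡 n) c).target)
    (ζ : E n →L[ℝ] ℝ) :
    (ζ.comp (chartD n c ((extChartAt (𝓡 n) c).symm u))).comp (chartDsymm n c u) = ζ := by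
  rw [ContinuousLinearMap.comp_assoc, chartD_comp_chartDsymm hu, ContinuousLinearMap.comp_id]

theorem comp_chartD_ne_zero {c : S} {u : E n} (hu : u ∈ (extChartAt (𝓡 n) c).target)
    {ζ : E n →L[ℝ] ℝ} (hζ : ζ ≠ 0) : ζ.comp (chartD n c ((extChartAt (𝓡 n) c).symm u)) ≠ 0 := by
  intro h
  have := comp_chartD_comp_chartDsymm hu ζ
  rw [h, ContinuousLinearMap.zero_comp] at this
  exact hζ this.symm

variable [T2Space S]

theorem stateParam_nullState {c : S} {s : ℝ} {y : S}
    (hc : y ∈ (chartAt (EuclideanSpace ℝ (Fin n)) c).source) (η : E n →L[ℝ] ℝ) :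
    g.stateParam c (stateCoord c (g.nullState s y η)) =
      (s, extChartAt (𝓡 n) c y, η.comp (chartDsymm n c (extChartAt (𝓡 n) c y))) := by
  have hc' : ((s, y) : ℝ × S).2 ∈ (chartAt (EuclideanSpace ℝ (Fin n)) c).source := hc
  refine Prod.ext rfl (Prod.ext rfl ?_)
  ext1 w
  change g.chartG c (coordPt n c (s, y)) (cvec n c (s, y) (g.shM (s, y) (g.nullL s y η))) (0, w) =
    η (chartDsymm n c (extChartAt (𝓡 n) c y) w)
  have h1 : cvec n c (s, y) (vec n c (coordPt n c (s, y)) (0, w)) = (0, w) := by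
    have := cvec_vec (coordPt_mem hc') (0, w)
    rwa [pt_coordPt hc'] at this
  conv_lhs => rw [← h1]
  rw [chartG_cvec g hc', gM_shM]
  change Real.sqrt (g.β (s, y)) * g.conM s y η * 0 + η _ = _
  rw [mul_zero, zero_add]
  rfl

theorem parState_eq_nullState {c : S} {s : ℝ} {y : S}
    (hc : y ∈ (chartAt (EuclideanSpace ℝ (Fin n)) c).source) {η : E n →L[ℝ] ℝ} (hη : η ≠ 0) :
    g.parState c (s, extChartAt (𝓡 n) c y, η.comp (chartDsymm n c (extChartAt (𝓡 n) c y))) =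
      g.nullState s y η := by
  rw [← stateParam_nullState hc]
  exact parState_stateParam hc (isNullFuture_nullState s y hη)

theorem parState_eq {c : S} {α : ℝ × E n × (E n →L[ℝ] ℝ)}
    (hu : α.2.1 ∈ (extChartAt (𝓡 n) c).target) (hζ : α.2.2 ≠ 0) :
    g.parState c α = g.nullState α.1 ((extChartAt (𝓡 n) c).symm α.2.1)
      (α.2.2.comp (chartD n c ((extChartAt (𝓡 n) c).symm α.2.1))) := by
  have hc : (extChartAt (𝓡 n) c).symm α.2.1 ∈ (chartAt (EuclideanSpace ℝ (Fin n)) c).source := by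
    have := (extChartAt (𝓡 n) c).map_target hu
    rwa [extChartAt_source] at this
  rw [← parState_eq_nullState hc (comp_chartD_ne_zero hu hζ), (extChartAt (𝓡 n) c).right_inv hu,
    comp_chartD_comp_chartDsymm hu]

theorem isNullFuture_parState {c : S} {α : ℝ × E n × (E n →L[ℝ] ℝ)}
    (hu : α.2.1 ∈ (extChartAt (𝓡 n) c).target) (hζ : α.2.2 ≠ 0) :
    g.IsNullFuture (g.parState c α) := by
  rw [parState_eq hu hζ]
  exact isNullFuture_nullState _ _ (comp_chartD_ne_zero hu hζ)

theorem stateParam_parState {c : S} {α : ℝ × E n × (E n →L[ℝ] ℝ)}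
    (hu : α.2.1 ∈ (extChartAt (𝓡 n) c).target) (hζ : α.2.2 ≠ 0) :
    g.stateParam c (stateCoord c (g.parState c α)) = α := by
  have hc : (extChartAt (𝓡 n) c).symm α.2.1 ∈ (chartAt (EuclideanSpace ℝ (Fin n)) c).source := by
    have := (extChartAt (𝓡 n) c).map_target hu
    rwa [extChartAt_source] at this
  rw [parState_eq hu hζ, stateParam_nullState hc, (extChartAt (𝓡 n) c).right_inv hu,
    comp_chartD_comp_chartDsymm hu]

/-- The parametrised state is future pointing and null, so its time component is positive and
`nullSq` is the square of a positive number. This keeps the square root in `nullCoord` smooth. -/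
theorem nullSq_pos {c : S} {q : ℝ × E n} (hq : q ∈ chartDom n c) {ζ : E n →L[ℝ] ℝ}
    (hζ : ζ ≠ 0) : 0 < g.nullSq c q ζ := by
  have h1 := isNullFuture_parState (g := g) (c := c) (α := (q.1, q.2, ζ)) hq hζ
  have h2 := stateParam_parState (g := g) (c := c) (α := (q.1, q.2, ζ)) hq hζ
  set p := g.nullCoord c q ζ
  have h3 : g.parState c (q.1, q.2, ζ) = (pt n c q, vec n c q p) := rfl
  rw [h3] at h1 h2
  rw [stateCoord_pt hq] at h2
  have h4 := nullSq_eq hq (((chartG_apply g c q p p).trans h1.1))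
  have h5 : (g.chartG c q p).comp (ContinuousLinearMap.inr ℝ ℝ (E n)) = ζ :=
    congrArg (fun x => x.2.2) h2
  rw [h5] at h4
  rw [h4]
  have h6 : 0 < p.1 := h1.2
  exact pow_pos (mul_pos (chartG_time_pos c q) h6) 2

theorem contDiffAt_nullCoord {c : S} {α : ℝ × E n × (E n →L[ℝ] ℝ)}
    (hu : α.2.1 ∈ (extChartAt (𝓡 n) c).target) (hζ : α.2.2 ≠ 0) :
    ContDiffAt ℝ ∞ (fun α : ℝ × E n × (E n →L[ℝ] ℝ) =>
      g.nullCoord c (α.1, α.2.1) α.2.2) α := by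
  have hq : (α.1, α.2.1) ∈ chartDom n c := hu
  have hG := g.contDiffAt_chartG hq
  have hI := contDiffAt_inverse (fun _ => g.chartG_nondegenerate hq) hG
  have h1 : ContDiffAt ℝ ∞ (fun α : ℝ × E n × (E n →L[ℝ] ℝ) => (α.1, α.2.1)) α := by fun_prop
  have h2 : ContDiffAt ℝ ∞ (fun α : ℝ × E n × (E n →L[ℝ] ℝ) =>
      (g.chartG c (α.1, α.2.1)).inverse) α :=
    ContDiffAt.comp α (f := fun α : ℝ × E n × (E n →L[ℝ] ℝ) => (α.1, α.2.1)) hI h1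
  have h3 : ContDiffAt ℝ ∞ (fun α : ℝ × E n × (E n →L[ℝ] ℝ) => g.chartG c (α.1, α.2.1)) α :=
    ContDiffAt.comp α (f := fun α : ℝ × E n × (E n →L[ℝ] ℝ) => (α.1, α.2.1)) hG h1
  have h4 : ContDiffAt ℝ ∞ (fun α : ℝ × E n × (E n →L[ℝ] ℝ) => α.2.2) α := by fun_prop
  have h5 : ContDiffAt ℝ ∞ (fun α : ℝ × E n × (E n →L[ℝ] ℝ) =>
      α.2.2.comp (ContinuousLinearMap.snd ℝ ℝ (E n))) α := h4.clm_comp contDiffAt_const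
  have h6 : ContDiffAt ℝ ∞ (fun α : ℝ × E n × (E n →L[ℝ] ℝ) =>
      g.nullSq c (α.1, α.2.1) α.2.2) α :=
    (((h3.clm_apply contDiffAt_const).clm_apply contDiffAt_const).mul
      (h4.clm_apply (contDiffAt_snd.comp α (h2.clm_apply h5)))).neg
  exact h2.clm_apply (((h6.sqrt (nullSq_pos hq hζ).ne').smul contDiffAt_const).add h5)

/-- Varying only the covector does not move the base point, so the pairing vanishes initially;
propagation keeps it zero. -/
theorem smoothFam_parState {c : S} {α : ℝ × E n × (E n →L[ℝ] ℝ)}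
    (hu : α.2.1 ∈ (extChartAt (𝓡 n) c).target) (hζ : α.2.2 ≠ 0) :
    SmoothFam c (g.parState c) α ∧ ∀ ζ, g.pairing c (g.parState c) α (0, 0, ζ) = 0 := by
  have h1 : ContDiffAt ℝ 1 (fun α : ℝ × E n × (E n →L[ℝ] ℝ) => (α.1, α.2.1)) α := by fun_prop
  obtain ⟨h2, h3, -⟩ := smoothFam_of_coords (c := c) (z := g.parState c) (α₀ := α)
    (Filter.Eventually.of_forall fun _ => rfl) hu h1
    ((contDiffAt_nullCoord hu hζ).of_le (by norm_num))
  refine ⟨h2, fun ζ => ?_⟩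
  have h4 : HasFDerivAt (fun α : ℝ × E n × (E n →L[ℝ] ℝ) => (α.1, α.2.1))
      ((ContinuousLinearMap.fst ℝ ℝ (E n × (E n →L[ℝ] ℝ))).prod
        ((ContinuousLinearMap.fst ℝ (E n) (E n →L[ℝ] ℝ)).comp
          (ContinuousLinearMap.snd ℝ ℝ (E n × (E n →L[ℝ] ℝ))))) α :=
    hasFDerivAt_fst.prodMk (hasFDerivAt_fst.comp α hasFDerivAt_snd)
  rw [pairing, h3.fderiv_eq, h4.fderiv]
  exact map_zero _

theorem eventually_parState {c : S} {α₀ : ℝ × E n × (E n →L[ℝ] ℝ)}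
    (hu : α₀.2.1 ∈ (extChartAt (𝓡 n) c).target) (hζ : α₀.2.2 ≠ 0) :
    ∀ᶠ α in 𝓝 α₀, α.2.1 ∈ (extChartAt (𝓡 n) c).target ∧ α.2.2 ≠ 0 := by
  have h1 : ContinuousAt (fun α : ℝ × E n × (E n →L[ℝ] ℝ) => α.2.1) α₀ := by fun_prop
  have h2 : ContinuousAt (fun α : ℝ × E n × (E n →L[ℝ] ℝ) => α.2.2) α₀ := by fun_prop
  exact (h1.eventually_mem ((isOpen_extChartAt_target c).mem_nhds hu)).and (h2.eventually_ne hζ)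

end Spacetime

/-! ### The flow as a `C¹` family of states, and its invertibility -/

namespace Spacetime

variable {n : ℕ} {S : Type*} [TopologicalSpace S] [ChartedSpace (EuclideanSpace ℝ (Fin n)) S]
  [IsManifold (𝓡 n) ∞ S] {g : Spacetime n S}
  {P : Type*} [NormedAddCommGroup P] [NormedSpace ℝ P]

theorem SmoothFam.contDiffAt_stateParam (g : Spacetime n S) {c : S}
    {z : P → (ℝ × S) × (ℝ × E n)} {α₀ : P}
    (h : SmoothFam c z α₀) : ContDiffAt ℝ 1 (fun α => g.stateParam c (stateCoord c (z α))) α₀ := by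
  have hG : ContDiffAt ℝ 1 (fun α => g.chartG c (coordPt n c (z α).1)) α₀ :=
    ContDiffAt.comp α₀ (f := fun α => coordPt n c (z α).1)
      ((g.contDiffAt_chartG (coordPt_mem h.source)).of_le (by norm_num)) h.smooth_fst
  exact (contDiffAt_fst.comp α₀ h.smooth_fst).prodMk ((contDiffAt_snd.comp α₀ h.smooth_fst).prodMk
    ((hG.clm_apply h.smooth_snd).clm_comp contDiffAt_const))

theorem stateParam_target {c : S} {z : (ℝ × S) × (ℝ × E n)}
    (hc : z.1.2 ∈ (chartAt (EuclideanSpace ℝ (Fin n)) c).source) (hz : g.IsNullFuture z) :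
    (g.stateParam c (stateCoord c z)).2.1 ∈ (extChartAt (𝓡 n) c).target ∧
      (g.stateParam c (stateCoord c z)).2.2 ≠ 0 := by
  refine ⟨coordPt_mem hc, fun h => ?_⟩
  have h1 : g.chartG c (coordPt n c z.1) (cvec n c z.1 z.2) (cvec n c z.1 z.2) = 0 :=
    (chartG_cvec g hc _ _).trans hz.1
  have h2 := nullSq_eq (coordPt_mem hc) h1
  have h3 : (g.chartG c (coordPt n c z.1) (cvec n c z.1 z.2)).comp
    (ContinuousLinearMap.inr ℝ ℝ (E n)) = 0 := h
  rw [h3, nullSq, zero_apply, mul_zero, neg_zero] at h2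
  exact (pow_pos (mul_pos (chartG_time_pos c _) hz.2) 2).ne h2

variable [T2Space S] [CompactSpace S]

/-- The state at time `τ` of the null geodesic with parameters `α` depends injectively on the
covector, to first order. -/
theorem fderiv_stateParam_injective (N : g.NormalNeighbourhoods) {c : S}
    {α₀ : ℝ × E n × (E n →L[ℝ] ℝ)} (hu : α₀.2.1 ∈ (extChartAt (𝓡 n) c).target)
    (hζ₀ : α₀.2.2 ≠ 0) {τ : ℝ} {c' : S}
    {z' : ℝ × (ℝ × E n × (E n →L[ℝ] ℝ)) → (ℝ × S) × (ℝ × E n)}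
    (hz' : g.IsPropagation c (g.parState c) α₀ τ c' z') {ζ : E n →L[ℝ] ℝ}
    (hζ : fderiv ℝ (fun α => g.stateParam c' (stateCoord c' (z' (τ, α)))) α₀ (0, 0, ζ) = 0) :
    ζ = 0 := by
  obtain ⟨h1, h2, -⟩ := hz'
  set m := fun α => g.stateParam c' (stateCoord c' (z' (τ, α))) with hm
  have h3 := (h1.comp_prodMk (g := g)).1
  have hm1 : ContDiffAt ℝ 1 m α₀ := h3.contDiffAt_stateParam g
  have hτ : ContinuousAt (fun α : ℝ × E n × (E n →L[ℝ] ℝ) => (τ, α)) α₀ := by fun_prop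
  have h4 : ∀ᶠ α in 𝓝 α₀, g.Joins (g.parState c α) (z' (τ, α)) ∧ (z' (τ, α)).1.1 = τ :=
    hτ.eventually h2
  have h5 : ∀ᶠ α in 𝓝 α₀, g.IsNullFuture (z' (τ, α)) := by
    filter_upwards [h4, eventually_parState hu hζ₀] with α e1 e2
    exact e1.1.isNullFuture (isNullFuture_parState e2.1 e2.2)
  have h6 : ∀ᶠ α in 𝓝 α₀, g.parState c' (m α) = z' (τ, α) := by
    filter_upwards [h3.eventually_source, h5] with α e1 e2 using parState_stateParam e1 e2
  obtain ⟨h7, h8⟩ := stateParam_target h3.source h5.self_of_nhds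
  -- The null states near the state reached at time `τ` are propagated back to the starting time
  -- `α₀.1`.
  obtain ⟨c'', w, hw1, hw2, -⟩ := exists_isPropagation N (smoothFam_parState (g := g) h7 h8).1
    ((eventually_parState h7 h8).mono fun β hβ => isNullFuture_parState hβ.1 hβ.2) α₀.1
  have hs : ContinuousAt (fun β : ℝ × E n × (E n →L[ℝ] ℝ) => (α₀.1, β)) (m α₀) := by fun_prop
  -- Going forward and back returns to the initial state, as a null geodesic has one state per time.
  -- The return time is frozen, so this holds for parameters with the same starting time, which
  -- includes the direction `(0, 0, ζ)`.
  have h9 : ∀ᶠ α in 𝓝 α₀, α.1 = α₀.1 → w (α₀.1, m α) = g.parState c α := by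
    filter_upwards [h4, h6, hm1.continuousAt.eventually (hs.eventually hw2),
      eventually_parState hu hζ₀] with α e1 e2 e3 e4 e5
    rw [e2] at e3
    exact Joins.eq_of_time_eq (isNullFuture_parState e4.1 e4.2) (e1.1.trans e3.1)
      (e1.1.trans e1.1.symm) (e3.2.trans e5.symm)
  have h10 := h9.self_of_nhds rfl
  have h11 := ((hw1.comp_prodMk (g := g)).1).change (c' := c) (by
    change (w (α₀.1, m α₀)).1.2 ∈ _
    rw [h10]
    exact pt_mem (q := (α₀.1, α₀.2.1)) hu)
  have h12 := h11.contDiffAt_stateParam g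
  set k := fun β => g.stateParam c (stateCoord c (w (α₀.1, β))) with hk
  have hα : HasDerivAt (fun t : ℝ => α₀ + t • ((0, 0, ζ) : ℝ × E n × (E n →L[ℝ] ℝ)))
      (0, 0, ζ) 0 := by
    simpa using ((hasDerivAt_id (0 : ℝ)).smul_const
      ((0, 0, ζ) : ℝ × E n × (E n →L[ℝ] ℝ))).const_add α₀
  have ea : α₀ + (0 : ℝ) • ((0, 0, ζ) : ℝ × E n × (E n →L[ℝ] ℝ)) = α₀ := by simp
  have h13 := HasFDerivAt.comp_hasDerivAt_of_eq (l := m) 0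
    (hm1.differentiableAt (by norm_num)).hasFDerivAt hα ea.symm
  rw [hζ] at h13
  have h14 := HasFDerivAt.comp_hasDerivAt_of_eq (l := k) 0
    (h12.differentiableAt (by norm_num)).hasFDerivAt h13 (by rw [Function.comp_apply, ea])
  rw [map_zero] at h14
  have ht0 : Filter.Tendsto (fun t : ℝ => α₀ + t • ((0, 0, ζ) : ℝ × E n × (E n →L[ℝ] ℝ)))
      (𝓝 0) (𝓝 α₀) := by
    have := hα.continuousAt.tendsto
    rwa [ea] at this
  -- On this line `k ∘ m` is the identity, so the chain rule forces `ζ = 0` once the derivative of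
  -- `m` kills `(0, 0, ζ)`.
  have h15 : (fun t : ℝ => α₀ + t • ((0, 0, ζ) : ℝ × E n × (E n →L[ℝ] ℝ))) =ᶠ[𝓝 0]
      (k ∘ m ∘ fun t : ℝ => α₀ + t • ((0, 0, ζ) : ℝ × E n × (E n →L[ℝ] ℝ))) := by
    filter_upwards [ht0.eventually h9, ht0.eventually (eventually_parState hu hζ₀)] with t e1 e2
    simp only [Function.comp_apply, hk]
    rw [e1 (by simp), stateParam_parState e2.1 e2.2]
  have h16 := hα.unique (h14.congr_of_eventuallyEq h15)
  exact congrArg (fun x : ℝ × E n × (E n →L[ℝ] ℝ) => x.2.2) h16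

/-- The flow near the point with parameters `α₀`, as a smooth family of states. -/
theorem exists_flow_family (N : g.NormalNeighbourhoods) {c : S}
    {α₀ : ℝ × E n × (E n →L[ℝ] ℝ)} (hu : α₀.2.1 ∈ (extChartAt (𝓡 n) c).target)
    (hζ₀ : α₀.2.2 ≠ 0) (τ : ℝ) :
    ∃ c' z', g.IsPropagation c (g.parState c) α₀ τ c' z' ∧
      (∀ ζ, g.pairing c' z' (τ, α₀) (0, 0, 0, ζ) = 0) ∧
      ∀ᶠ β in 𝓝 (τ, α₀), g.IsNullFuture (z' β) ∧
        β.2.2.1 ∈ (extChartAt (𝓡 n) c).target ∧ β.2.2.2 ≠ 0 ∧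
        g.flow β.1 β.2.1 ((extChartAt (𝓡 n) c).symm β.2.2.1)
          (β.2.2.2.comp (chartD n c ((extChartAt (𝓡 n) c).symm β.2.2.1))) =
          ⟨(z' β).1, g.gM (z' β).1 (z' β).2⟩ := by
  obtain ⟨h1, h2⟩ := smoothFam_parState (g := g) hu hζ₀
  obtain ⟨c', z', h⟩ := exists_isPropagation N h1
    ((eventually_parState hu hζ₀).mono fun β hβ => isNullFuture_parState hβ.1 hβ.2) τ
  refine ⟨c', z', h, fun ζ => (h.2.2 _).trans (h2 ζ), ?_⟩
  have h3 : Filter.Tendsto (fun β : ℝ × (ℝ × E n × (E n →L[ℝ] ℝ)) => β.2) (𝓝 (τ, α₀)) (𝓝 α₀) :=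
    continuous_snd.tendsto (τ, α₀)
  filter_upwards [h.2.1, h3.eventually (eventually_parState hu hζ₀)] with β e1 e2
  refine ⟨e1.1.isNullFuture (isNullFuture_parState e2.1 e2.2), e2.1, e2.2, ?_⟩
  have e3 := e1.1
  rw [parState_eq e2.1 e2.2] at e3
  exact flow_eq_of_joins (comp_chartD_ne_zero e2.1 e2.2) e3 e1.2

end Spacetime

/-! ### Coordinates on the cotangent bundle -/

section Cot

variable {n : ℕ} {S : Type*} [TopologicalSpace S] [ChartedSpace (EuclideanSpace ℝ (Fin n)) S]
  [IsManifold (𝓡 n) ∞ S]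

theorem trivializationAt_cot {c y : S}
    (hy : y ∈ (chartAt (EuclideanSpace ℝ (Fin n)) c).source) (η : E n →L[ℝ] ℝ) :
    (trivializationAt (E n →L[ℝ] ℝ) (fun x : S => TangentSpace (𝓡 n) x →L[ℝ] ℝ) c
      (⟨y, η⟩ : CotBundle n S)).2 = η.comp (chartDsymm n c (extChartAt (𝓡 n) c y)) := by
  have h3 := TangentBundle.symmL_trivializationAt (𝕜 := ℝ) (I := 𝓡 n) hy
  rw [ModelWithCorners.range_eq_univ, mfderivWithin_univ] at h3
  refine ContinuousLinearMap.ext fun w => ?_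
  have h4 := congrArg (fun L : E n →L[ℝ] E n => η (L w)) h3
  refine Eq.trans ?_ h4
  change (trivializationAt ℝ (Bundle.Trivial S ℝ) c).continuousLinearMapAt ℝ y _ = _
  exact congrArg (fun L : ℝ →L[ℝ] ℝ => L _) (Trivial.continuousLinearMapAt_trivialization ℝ S ℝ y)

/-- The covector with parameters `(t, u, ζ)`, together with its base point and `t`. -/
def cotPar (c : S) (α : ℝ × E n × (E n →L[ℝ] ℝ)) : ℝ × CotBundle n S :=
  (α.1, ⟨(extChartAt (𝓡 n) c).symm α.2.1,
    α.2.2.comp (chartD n c ((extChartAt (𝓡 n) c).symm α.2.1))⟩)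

/-- Smoothness into the bundle is tested in the trivialisation at the image base point. Over the
centre `c` this is the trivialisation at `c`, in which the fibre component is the parameter `ζ`
itself. -/
theorem contMDiffAt_cotPar {c : S} {α₀ : ℝ × E n × (E n →L[ℝ] ℝ)}
    (h : α₀.2.1 = extChartAt (𝓡 n) c c) :
    ContMDiffAt 𝓘(ℝ, ℝ × E n × (E n →L[ℝ] ℝ))
      (𝓘(ℝ, ℝ).prod ((𝓡 n).prod 𝓘(ℝ, E n →L[ℝ] ℝ))) ∞ (cotPar c) α₀ := by
  have hu : α₀.2.1 ∈ (extChartAt (𝓡 n) c).target := h ▸ mem_extChartAt_target c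
  have h1 : ContDiffAt ℝ ∞ (fun α : ℝ × E n × (E n →L[ℝ] ℝ) => α.1) α₀ := by fun_prop
  have h2 : ContDiffAt ℝ ∞ (fun α : ℝ × E n × (E n →L[ℝ] ℝ) => α.2.1) α₀ := by fun_prop
  have h3 : ContDiffAt ℝ ∞ (fun α : ℝ × E n × (E n →L[ℝ] ℝ) => α.2.2) α₀ := by fun_prop
  refine h1.contMDiffAt.prodMk (contMDiffAt_totalSpace.2 ⟨?_, ?_⟩)
  · exact ContMDiffAt.comp α₀ (g := (extChartAt (𝓡 n) c).symm)
      (f := fun α : ℝ × E n × (E n →L[ℝ] ℝ) => α.2.1)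
      ((contMDiffOn_extChartAt_symm c).contMDiffAt
        ((isOpen_extChartAt_target c).mem_nhds hu)) h2.contMDiffAt
  · have e : (cotPar c α₀).2.proj = c := by
      change (extChartAt (𝓡 n) c).symm α₀.2.1 = c
      rw [h]
      exact extChartAt_to_inv c
    change ContMDiffAt 𝓘(ℝ, ℝ × E n × (E n →L[ℝ] ℝ)) 𝓘(ℝ, E n →L[ℝ] ℝ) ∞
      (fun α => (trivializationAt (E n →L[ℝ] ℝ) (fun x : S => TangentSpace (𝓡 n) x →L[ℝ] ℝ)
        (cotPar c α₀).2.proj (cotPar c α).2).2) α₀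
    rw [e]
    refine h3.contMDiffAt.congr_of_eventuallyEq ?_
    have h4 : ContinuousAt (fun α : ℝ × E n × (E n →L[ℝ] ℝ) => α.2.1) α₀ := by fun_prop
    filter_upwards [h4.eventually_mem ((isOpen_extChartAt_target c).mem_nhds hu)] with α hα
    have hα' : (extChartAt (𝓡 n) c).symm α.2.1 ∈
        (chartAt (EuclideanSpace ℝ (Fin n)) c).source := by
      have := (extChartAt (𝓡 n) c).map_target hα
      rwa [extChartAt_source] at this
    refine (trivializationAt_cot hα' _).trans ?_
    rw [(extChartAt (𝓡 n) c).right_inv hα]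
    exact Spacetime.comp_chartD_comp_chartDsymm hα _

/-- The parameters of a covector. -/
def cotCoord (c : S) (z : ℝ × CotBundle n S) : ℝ × E n × (E n →L[ℝ] ℝ) :=
  (z.1, extChartAt (𝓡 n) c z.2.1,
    (show E n →L[ℝ] ℝ from z.2.2).comp (chartDsymm n c (extChartAt (𝓡 n) c z.2.1)))

theorem cotPar_cotCoord {c : S} {z : ℝ × CotBundle n S}
    (h : z.2.1 ∈ (chartAt (EuclideanSpace ℝ (Fin n)) c).source) :
    cotPar c (cotCoord c z) = z := by
  obtain ⟨t, y, η⟩ := z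
  have h' : y ∈ (extChartAt (𝓡 n) c).source := by rwa [extChartAt_source]
  have e : (extChartAt (𝓡 n) c).symm (extChartAt (𝓡 n) c y) = y :=
    (extChartAt (𝓡 n) c).left_inv h'
  refine Prod.ext rfl ?_
  have key : ∀ (y' : S) (η' : E n →L[ℝ] ℝ), y' = y → η' = (show E n →L[ℝ] ℝ from η) →
      (⟨y', η'⟩ : CotBundle n S) = ⟨y, η⟩ := by
    rintro y' η' rfl rfl
    rfl
  refine key _ _ e ?_
  have h1 := chartDsymm_comp_chartD ((extChartAt (𝓡 n) c).map_source h')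
  change (ContinuousLinearMap.comp (show E n →L[ℝ] ℝ from η) (chartDsymm n c
    (extChartAt (𝓡 n) c y))).comp (chartD n c ((extChartAt (𝓡 n) c).symm
      (extChartAt (𝓡 n) c y))) = _
  rw [ContinuousLinearMap.comp_assoc, h1, ContinuousLinearMap.comp_id]

theorem continuousAt_cotCoord {c : S} {z : ℝ × CotBundle n S} (h : z.2.1 = c) :
    ContinuousAt (cotCoord (n := n) c) z := by
  have hs : z.2.1 ∈ (chartAt (EuclideanSpace ℝ (Fin n)) c).source := by
    rw [h]
    exact mem_chart_source _ c
  have h1 : ContinuousAt (fun z : ℝ × CotBundle n S => z.2.1) z :=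
    (FiberBundle.continuous_proj (E n →L[ℝ] ℝ) _).continuousAt.comp continuousAt_snd
  have h2 : ContinuousAt (fun z : ℝ × CotBundle n S => extChartAt (𝓡 n) c z.2.1) z :=
    ContinuousAt.comp (f := fun z : ℝ × CotBundle n S => z.2.1)
      (continuousAt_extChartAt' (by rwa [extChartAt_source])) h1
  set T := trivializationAt (E n →L[ℝ] ℝ) (fun x : S => TangentSpace (𝓡 n) x →L[ℝ] ℝ) c
  have h3 : z.2 ∈ T.source := by
    rw [Trivialization.mem_source, h]
    exact FiberBundle.mem_baseSet_trivializationAt' c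
  have h4 : ContinuousAt (fun z : ℝ × CotBundle n S => (T z.2).2) z :=
    continuousAt_snd.comp (ContinuousAt.comp (f := fun z : ℝ × CotBundle n S => z.2)
      (T.continuousAt h3) continuousAt_snd)
  have h5 : ContinuousAt (fun z : ℝ × CotBundle n S => z.1) z := continuousAt_fst
  refine (h5.prodMk (h2.prodMk h4)).congr ?_
  filter_upwards [h1.eventually_mem
    ((chartAt (EuclideanSpace ℝ (Fin n)) c).open_source.mem_nhds hs)] with z' hz'
  refine Prod.ext rfl (Prod.ext rfl ?_)
  exact trivializationAt_cot hz' _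

end Cot

/-! ### Linear algebra of the phase Hessian -/

section Nondegenerate

variable {F D : Type*} [NormedAddCommGroup F] [NormedSpace ℝ F] [NormedAddCommGroup D]
  [NormedSpace ℝ D]

/-- Non-degeneracy of the mixed part of the Hessian `H` of a phase function, for complex
combinations `a + i b` of fibre directions. -/
theorem hessian_nondegenerate {H : F × D →L[ℝ] F × D →L[ℝ] ℂ} (hsymm : ∀ x y, H x y = H y x)
    {A : D →L[ℝ] F} {Ξ : D →L[ℝ] F →L[ℝ] ℝ}
    (h1 : ∀ ζ v, H (A ζ, ζ) (v, 0) = ((Ξ ζ v : ℝ) : ℂ)) (h2 : ∀ ζ ζ', H (A ζ, ζ) (0, ζ') = 0)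
    (h3 : ∀ w, w ≠ 0 → 0 < (H (w, 0) (w, 0)).im) (hinj : ∀ ζ, A ζ = 0 → Ξ ζ = 0 → ζ = 0)
    {a b : D} (hab : ∀ v, H (v, 0) (0, a) + Complex.I * H (v, 0) (0, b) = 0) :
    a = 0 ∧ b = 0 := by
  have split : ∀ (u : F) (ζ : D) (y : F × D), H (u, ζ) y = H (u, 0) y + H (0, ζ) y := by
    intro u ζ y
    have : ((u, ζ) : F × D) = (u, 0) + (0, ζ) := by simp
    rw [this, map_add, add_apply]
  -- The mixed block differs from a real quantity by the `x`-block applied to `A ζ`.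
  have him : ∀ ζ v, (H (v, 0) (0, ζ)).im = -(H (A ζ, 0) (v, 0)).im := by
    intro ζ v
    have := congrArg Complex.im (h1 ζ v)
    rw [split, Complex.add_im, Complex.ofReal_im] at this
    rw [hsymm (v, 0) (0, ζ)]
    linarith
  -- Symmetry of the fibre block makes `(a, b) ↦ H (A a, 0) (0, b)` symmetric.
  have hB : H (A a, 0) (0, b) = H (A b, 0) (0, a) := by
    have e1 := h2 a b
    have e2 := h2 b a
    rw [split] at e1 e2
    rw [hsymm (0, b) (0, a)] at e2
    linear_combination e1 - e2
  -- The hypothesis tested on `A a`, plus `-i` times the hypothesis tested on `A b`; the cross terms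
  -- cancel by `hB`.
  have hsum : H (A a, 0) (0, a) + H (A b, 0) (0, b) = 0 := by
    have e1 := hab (A a)
    have e2 := hab (A b)
    rw [hB] at e1
    linear_combination e1 - Complex.I * e2 + H (A b, 0) (0, b) * Complex.I_mul_I
  -- The imaginary part of `hsum` is minus the sum of the positive form `Im H_xx` on `A a` and on `A
  -- b`.
  have hA : A a = 0 ∧ A b = 0 := by
    have e1 := congrArg Complex.im hsum
    rw [Complex.add_im, him, him, Complex.zero_im] at e1
    have pos : ∀ w, 0 ≤ (H (w, 0) (w, 0)).im := fun w => by
      rcases eq_or_ne w 0 with rfl | hw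
      · have : ((0, 0) : F × D) = 0 := rfl
        rw [this, map_zero, Complex.zero_im]
      · exact (h3 w hw).le
    constructor
    · by_contra hne
      linarith [h3 _ hne, pos (A b)]
    · by_contra hne
      linarith [h3 _ hne, pos (A a)]
  have hΞ : ∀ ζ, A ζ = 0 → ∀ v, H (v, 0) (0, ζ) = ((Ξ ζ v : ℝ) : ℂ) := by
    intro ζ hζ v
    have := h1 ζ v
    rwa [hζ, hsymm] at this
  have hz : ∀ v, Ξ a v = 0 ∧ Ξ b v = 0 := by
    intro v
    have e1 := hab v
    rw [hΞ a hA.1, hΞ b hA.2] at e1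
    exact ⟨by simpa using congrArg Complex.re e1, by simpa using congrArg Complex.im e1⟩
  exact ⟨hinj a hA.1 (ContinuousLinearMap.ext fun v => (hz v).1),
    hinj b hA.2 (ContinuousLinearMap.ext fun v => (hz v).2)⟩

/-- A complex kernel vector of the matrix splits into real and imaginary coefficients, which define
the two real directions `a` and `b` of the hypothesis. -/
theorem det_ne_zero_of_nondegenerate {m : ℕ} {B : F →L[ℝ] D →L[ℝ] ℂ}
    (hB : ∀ a b : D, (∀ v, B v a + Complex.I * B v b = 0) → a = 0 ∧ b = 0)
    (e : Module.Basis (Fin m) ℝ F) (f : Module.Basis (Fin m) ℝ D) :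
    (Matrix.of fun i j => B (e i) (f j)).det ≠ 0 := by
  intro hdet
  obtain ⟨v, hv, hv0⟩ := Matrix.exists_mulVec_eq_zero_iff.2 hdet
  have h1 : ∀ i, B (e i) (∑ j, (v j).re • f j) + Complex.I * B (e i) (∑ j, (v j).im • f j) = 0 := by
    intro i
    have h2 := congrFun hv0 i
    simp only [Matrix.mulVec, dotProduct, Matrix.of_apply, Pi.zero_apply] at h2
    rw [← h2, map_sum, map_sum, Finset.mul_sum, ← Finset.sum_add_distrib]
    refine Finset.sum_congr rfl fun j _ => ?_
    rw [map_smul, map_smul, Complex.real_smul, Complex.real_smul]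
    conv_rhs => rw [← Complex.re_add_im (v j)]
    ring
  obtain ⟨h3, h4⟩ := hB (∑ j, (v j).re • f j) (∑ j, (v j).im • f j) (by
    intro w
    generalize (∑ j, (v j).re • f j) = a at h1 ⊢
    generalize (∑ j, (v j).im • f j) = b at h1 ⊢
    rw [← e.sum_repr w, map_sum, sum_apply, sum_apply, Finset.mul_sum,
      ← Finset.sum_add_distrib]
    refine Finset.sum_eq_zero fun i _ => ?_
    rw [map_smul, smul_apply, smul_apply, Complex.real_smul,
      Complex.real_smul]
    linear_combination (e.repr w i : ℂ) * h1 i)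
  have h5 := Fintype.linearIndependent_iff.1 f.linearIndependent _ h3
  have h6 := Fintype.linearIndependent_iff.1 f.linearIndependent _ h4
  exact hv (funext fun j => Complex.ext (h5 j) (h6 j))

/-- The determinant passes nondegeneracy from the fibre side to the position side, where it is
needed to isolate the critical set. -/
theorem eq_zero_of_det_ne_zero {m : ℕ} {B : F →L[ℝ] D →L[ℝ] ℂ} {e : Module.Basis (Fin m) ℝ F}
    {f : Module.Basis (Fin m) ℝ D} (h : (Matrix.of fun i j => B (e i) (f j)).det ≠ 0) {v : F}
    (hv : B v = 0) : v = 0 := by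
  have h1 : Matrix.vecMul (fun i => ((e.repr v i : ℝ) : ℂ)) (Matrix.of fun i j => B (e i) (f j)) =
      0 := by
    funext j
    simp only [Matrix.vecMul, dotProduct, Matrix.of_apply, Pi.zero_apply]
    have h2 : B v (f j) = (0 : D →L[ℝ] ℂ) (f j) := by rw [hv]
    rw [← e.sum_repr v, map_sum, sum_apply, zero_apply] at h2
    rw [← h2]
    refine Finset.sum_congr rfl fun i _ => ?_
    rw [map_smul, smul_apply, Complex.real_smul]
  have h2 := Matrix.eq_zero_of_vecMul_eq_zero h h1
  rw [← e.repr.map_eq_zero_iff]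
  ext i
  have := congrFun h2 i
  simpa using this

end Nondegenerate

/-- A map whose strict derivative is injective is locally injective. -/
theorem exists_injOn_of_injective_fderiv {F W : Type*} [NormedAddCommGroup F] [NormedSpace ℝ F]
    [FiniteDimensional ℝ F] [NormedAddCommGroup W] [NormedSpace ℝ W] [FiniteDimensional ℝ W]
    {f : F → W} {f' : F →L[ℝ] W} {x : F} (hf : HasStrictFDerivAt f f' x)
    (hinj : ∀ v, f' v = 0 → v = 0) : ∃ s ∈ 𝓝 x, InjOn f s := by
  -- Composing with a linear left inverse of the derivative reduces to derivative the identity,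
  -- where the inverse function theorem gives a left inverse.
  obtain ⟨l, hl⟩ := (f' : F →ₗ[ℝ] W).exists_leftInverse_of_injective
    (LinearMap.ker_eq_bot'.2 hinj)
  have : CompleteSpace F := FiniteDimensional.complete ℝ F
  have h1 : HasStrictFDerivAt (fun y => LinearMap.toContinuousLinearMap l (f y))
      ((LinearMap.toContinuousLinearMap l).comp f') x :=
    (LinearMap.toContinuousLinearMap l).hasStrictFDerivAt.comp x hf
  have h2 : (LinearMap.toContinuousLinearMap l).comp f' =
      (ContinuousLinearEquiv.refl ℝ F : F →L[ℝ] F) :=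
    ContinuousLinearMap.ext fun v => congrArg (fun L : F →ₗ[ℝ] F => L v) hl
  rw [h2] at h1
  have h3 := h1.eventually_left_inverse
  refine ⟨_, h3, fun y hy z hz hyz => ?_⟩
  have e1 : _ = y := hy
  have e2 : _ = z := hz
  rw [← e1, ← e2, hyz]

namespace Spacetime

variable {n : ℕ} {S : Type*} [TopologicalSpace S] [ChartedSpace (EuclideanSpace ℝ (Fin n)) S]
  [IsManifold (𝓡 n) ∞ S] {g : Spacetime n S}

/-! ### The phase function near the flow -/

theorem conM_smul (s : ℝ) (y : S) {a : ℝ} (ha : 0 < a) (η : E n →L[ℝ] ℝ) :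
    g.conM s y (a • η) = a * g.conM s y η := by
  have h : Real.sqrt (a * (a * (show E n →L[ℝ] ℝ from η)
      ((g.hFlat s y).symm (show CotS n y from η)))) = a * g.conM s y η := by
    rw [← mul_assoc, Real.sqrt_mul (mul_self_nonneg a), Real.sqrt_mul_self ha.le]
    rfl
  rw [← h]
  have h1 : (g.hFlat s y).symm (a • (show CotS n y from η)) =
    a • (g.hFlat s y).symm (show CotS n y from η) := map_smul _ _ _
  refine congrArg Real.sqrt ?_
  refine (congrArg (a • (show CotS n y from η)) h1).trans ?_
  refine congrArg (a * ·) (map_smul (show CotS n y from η) _ _)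

variable [T2Space S] in
theorem nullState_smul (s : ℝ) (y : S) {a : ℝ} (ha : 0 < a) (η : E n →L[ℝ] ℝ) :
    g.nullState s y (a • η) = ((s, y), a • g.shM (s, y) (g.nullL s y η)) := by
  refine Prod.ext rfl ?_
  change g.shM (s, y) (g.nullL s y (a • η)) = _
  rw [← shM_smul]
  refine congrArg (g.shM (s, y)) (ContinuousLinearMap.ext fun w => ?_)
  change Real.sqrt (g.β (s, y)) * g.conM s y (a • η) * w.1 + a * η w.2 =
    a * (Real.sqrt (g.β (s, y)) * g.conM s y η * w.1 + η w.2)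
  rw [conM_smul s y ha]
  ring

theorem dM_eq {f : ℝ × S → ℝ} {F : ℝ × E n → ℝ} {c : S} {X : ℝ × S}
    (hc : X.2 ∈ (chartAt (EuclideanSpace ℝ (Fin n)) c).source)
    (hF : DifferentiableAt ℝ F (coordPt n c X))
    (h : f =ᶠ[𝓝 X] fun Z => F (coordPt n c Z)) (v : ℝ × E n) :
    dM n f X v = fderiv ℝ F (coordPt n c X) (cvec n c X v) := by
  have h1 := HasMFDerivAt.comp X (mdifferentiableAt_extChartAt (I := 𝓡 n) hc).hasMFDerivAt
    (hasMFDerivAt_snd (I := 𝓘(ℝ, ℝ)) (I' := 𝓡 n) X)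
  have h2 : HasMFDerivAt (𝓘(ℝ, ℝ).prod (𝓡 n)) 𝓘(ℝ, ℝ × E n) (coordPt n c) X
      ((ContinuousLinearMap.fst ℝ ℝ (E n)).prod
        ((chartD n c X.2).comp (ContinuousLinearMap.snd ℝ ℝ (E n)))) := by
    rw [modelWithCornersSelf_prod, ← chartedSpaceSelf_prod]
    exact HasMFDerivAt.prodMk (hasMFDerivAt_fst (I := 𝓘(ℝ, ℝ)) (I' := 𝓡 n) X) h1
  have h3 := HasMFDerivAt.comp X (g := F) (f := coordPt n c) hF.hasFDerivAt.hasMFDerivAt h2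
  have h4 := (h3.congr_of_eventuallyEq h).mfderiv
  exact congrArg (fun L : (ℝ × E n) →L[ℝ] ℝ => L v) h4

variable [T2Space S]

/-- The value of the phase function in terms of the state `z` of the flow. -/
theorem IsLeviCivitaPhase.eq_of_flow {N : g.NormalNeighbourhoods} {ε : ℝ}
    {φ : (ℝ × S) × ℝ × CotBundle n S → ℂ} (hφ : IsLeviCivitaPhase N ε φ) {τ s : ℝ} {x y : S}
    {η : E n →L[ℝ] ℝ} (hη : η ≠ 0) {z : (ℝ × S) × (ℝ × E n)}
    (hz : g.flow τ s y η = ⟨z.1, g.gM z.1 z.2⟩) (hx : (τ, x) ∈ N.nhd z.1) :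
    φ ((τ, x), s, ⟨y, η⟩) = -((dM n (fun Z => N.worldFunction (τ, x) Z) z.1 z.2 : ℝ) : ℂ) -
      Complex.I * ((ε * g.conM s y η * N.worldFunction (τ, x) z.1 : ℝ) : ℂ) := by
  -- The covector type depends on the base point; stating the facts for a general pair `p` lets the
  -- equality be substituted at once.
  have key : ∀ p : Σ X : ℝ × S, CotM n X, p = ⟨z.1, g.gM z.1 z.2⟩ →
      (τ, x) ∈ N.nhd p.1 ∧ p.2 (g.grad (fun Z => N.worldFunction (τ, x) Z) p.1) =
        dM n (fun Z => N.worldFunction (τ, x) Z) z.1 z.2 ∧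
      N.worldFunction (τ, x) p.1 = N.worldFunction (τ, x) z.1 := by
    rintro p rfl
    refine ⟨hx, ?_, rfl⟩
    change g.gM z.1 z.2 (g.shM z.1 (dM n (fun Z => N.worldFunction (τ, x) Z) z.1)) = _
    refine (g.gM_symm _ _ _).trans ?_
    exact congrArg (fun L : (ℝ × E n) →L[ℝ] ℝ => L z.2) (gM_shM z.1 _)
  obtain ⟨h1, h2, h3⟩ := key _ hz
  have h4 := hφ.formula τ x s y η hη h1
  rw [h4]
  have h5 : g.flowΞ τ s y η (g.grad (fun Z => N.worldFunction (τ, x) Z) (g.flowX τ s y η)) =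
    dM n (fun Z => N.worldFunction (τ, x) Z) z.1 z.2 := h2
  have h6 : N.worldFunction (τ, x) (g.flowX τ s y η) = N.worldFunction (τ, x) z.1 := h3
  rw [h5, h6]
  rfl

theorem flowX_eq {τ s : ℝ} {y : S} {η : E n →L[ℝ] ℝ} {z : (ℝ × S) × (ℝ × E n)}
    (hz : g.flow τ s y η = ⟨z.1, g.gM z.1 z.2⟩) : g.flowX τ s y η = z.1 :=
  congrArg Sigma.fst hz

variable [CompactSpace S]

theorem exists_flow_state (N : g.NormalNeighbourhoods) (τ s : ℝ) (y : S) {η : E n →L[ℝ] ℝ}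
    (hη : η ≠ 0) : ∃ z : (ℝ × S) × (ℝ × E n), g.Joins (g.nullState s y η) z ∧ z.1.1 = τ ∧
      g.flow τ s y η = ⟨z.1, g.gM z.1 z.2⟩ := by
  have hy : y ∈ (chartAt (EuclideanSpace ℝ (Fin n)) y).source := mem_chart_source _ y
  have hu := mem_extChartAt_target (I := 𝓡 n) y
  have h1 := parState_eq_nullState (g := g) (s := s) hy hη
  have h2 : η.comp (chartDsymm n y (extChartAt (𝓡 n) y y)) ≠ 0 := by
    rw [chartDsymm_self]
    exact hη
  obtain ⟨c', z', h3, -⟩ := exists_flow_family N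
    (α₀ := (s, extChartAt (𝓡 n) y y, η.comp (chartDsymm n y (extChartAt (𝓡 n) y y)))) hu h2 τ
  have h4 := h3.2.1.self_of_nhds
  rw [h1] at h4
  exact ⟨_, h4.1, h4.2, flow_eq_of_joins hη h4.1 h4.2⟩

/-- Scaling `η` by `a > 0` scales the null state and the norm by `a` and leaves the base point `X*`
alone. Hence both covectors fall into the same case of the definition, and the explicit formula is
linear in them. -/
theorem IsLeviCivitaPhase.homogeneous {N : g.NormalNeighbourhoods} {ε : ℝ}
    {φ : (ℝ × S) × ℝ × CotBundle n S → ℂ} (hφ : IsLeviCivitaPhase N ε φ) (τ : ℝ) (x : S) (s : ℝ)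
    (y : S) (η : CotS n y) (hη : η ≠ 0) {a : ℝ} (ha : 0 < a) :
    φ ((τ, x), s, ⟨y, a • η⟩) = (a : ℂ) * φ ((τ, x), s, ⟨y, η⟩) := by
  obtain ⟨z, h1, h2, h3⟩ := exists_flow_state N τ s y (η := η) hη
  by_cases hx : (τ, x) ∈ N.nhd z.1
  · have hη' : (a • (show E n →L[ℝ] ℝ from η)) ≠ 0 := smul_ne_zero ha.ne' hη
    have h4 := h1.smul ha
    have e4 := nullState_smul (g := g) s y ha η
    change g.nullState s y (a • (show E n →L[ℝ] ℝ from η)) = ((g.nullState s y η).1, a • (g.nullState s y η).2) at e4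
    rw [← e4] at h4
    have h5 := hφ.eq_of_flow hη' (z := (z.1, a • z.2)) (flow_eq_of_joins hη' h4 h2) hx
    have h6 := hφ.eq_of_flow hη h3 hx
    refine h5.trans ?_
    rw [h6, conM_smul s y ha]
    have h7 : dM n (fun Z => N.worldFunction (τ, x) Z) z.1 (a • z.2 : ℝ × E n) =
      a * dM n (fun Z => N.worldFunction (τ, x) Z) z.1 z.2 := map_smul _ _ _
    change -((dM n (fun Z => N.worldFunction (τ, x) Z) z.1 (a • z.2 : ℝ × E n) : ℝ) : ℂ) - _ = _
    rw [h7]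
    push_cast
    ring
  · exact hφ.continuation_homogeneous τ x s y η hη (by rwa [flowX_eq h3]) a ha

/-- `X` and `X*` lie on the same time slice, where the world function is nonpositive. -/
theorem IsLeviCivitaPhase.im_nonneg {N : g.NormalNeighbourhoods} {ε : ℝ} (hε : 0 < ε)
    {φ : (ℝ × S) × ℝ × CotBundle n S → ℂ} (hφ : IsLeviCivitaPhase N ε φ) (τ : ℝ) (x : S) (s : ℝ)
    (y : S) (η : CotS n y) (hη : η ≠ 0) : 0 ≤ (φ ((τ, x), s, ⟨y, η⟩)).im := by
  obtain ⟨z, h1, h2, h3⟩ := exists_flow_state N τ s y (η := η) hη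
  by_cases hx : (τ, x) ∈ N.nhd z.1
  · rw [hφ.eq_of_flow hη h3 hx]
    have h4 := N.worldFunction_nonpos hx h2.symm
    have h5 := mul_nonneg (mul_pos hε (conM_pos (g := g) s y hη)).le (neg_nonneg.2 h4)
    simpa using h5
  · exact hφ.continuation_im_nonneg τ x s y η hη (by rwa [flowX_eq h3])

end Spacetime

section QuadraticPhase

/-! ### Phase functions built from a quadratic form of a logarithm -/

section World

variable {V : Type*} [NormedAddCommGroup V] [NormedSpace ℝ V]

/-- Where the vector factor vanishes, the derivative of the operator factor does not contribute. -/
theorem hasFDerivAt_clm_apply_of_eq_zero {X W : Type*} [NormedAddCommGroup X] [NormedSpace ℝ X]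
    [NormedAddCommGroup W] [NormedSpace ℝ W] {B : X → V →L[ℝ] W} {w : X → V} {w' : X →L[ℝ] V}
    {x : X} (hB : DifferentiableAt ℝ B x) (hw : HasFDerivAt w w' x) (h0 : w x = 0) :
    HasFDerivAt (fun x => B x (w x)) ((B x).comp w') x := by
  have h := hB.hasFDerivAt.clm_apply hw
  rw [h0, map_zero, add_zero] at h
  exact h

/-- The quadratic form `½ G(ℓ, ℓ)`. -/
def quadWorld (G : V → V →L[ℝ] V →L[ℝ] ℝ) (ℓ : V × V → V) (y : V × V) : ℝ :=
  1 / 2 * G y.1 (ℓ y) (ℓ y)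

variable {G : V → V →L[ℝ] V →L[ℝ] ℝ} {ℓ : V × V → V}

theorem contDiffAt_quadWorld {y : V × V} (hG : ContDiffAt ℝ ∞ G y.1) (hℓ : ContDiffAt ℝ ∞ ℓ y) :
    ContDiffAt ℝ ∞ (quadWorld G ℓ) y :=
  contDiffAt_const.mul (((ContDiffAt.comp y (f := fun y : V × V => y.1) hG contDiffAt_fst).clm_apply
    hℓ).clm_apply hℓ)

theorem fderiv_quadWorld {y : V × V} (hs : ∀ q v w, G q v w = G q w v)
    (hG : DifferentiableAt ℝ G y.1) (hℓ : DifferentiableAt ℝ ℓ y) (u : V × V) :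
    fderiv ℝ (quadWorld G ℓ) y u =
      (1 / 2 : ℝ) * fderiv ℝ G y.1 u.1 (ℓ y) (ℓ y) + G y.1 (fderiv ℝ ℓ y u) (ℓ y) := by
  have h1 : HasFDerivAt (fun y : V × V => G y.1)
      ((fderiv ℝ G y.1).comp (ContinuousLinearMap.fst ℝ V V)) y :=
    HasFDerivAt.comp y (f := fun y : V × V => y.1) hG.hasFDerivAt hasFDerivAt_fst
  have h2 := ((h1.clm_apply hℓ.hasFDerivAt).clm_apply hℓ.hasFDerivAt).const_mul (1 / 2 : ℝ)
  have h3 := congrArg (fun L : V × V →L[ℝ] ℝ => L u) h2.fderiv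
  refine h3.trans ?_
  simp only [smul_apply, add_apply, ContinuousLinearMap.comp_apply, ContinuousLinearMap.flip_apply,
    smul_eq_mul, ContinuousLinearMap.coe_fst']
  rw [hs _ (ℓ y) (fderiv ℝ ℓ y u)]
  ring

/-- The first derivative is an expression applied to `ℓ`, which vanishes on the diagonal. In the
second derivative only the term differentiating that factor remains, and in the coefficient only the
part not containing `ℓ`. -/
theorem fderiv_fderiv_quadWorld {q : V} (hs : ∀ q v w, G q v w = G q w v)
    (hG : ContDiffAt ℝ ∞ G q) (hℓ : ContDiffAt ℝ ∞ ℓ (q, q)) (h0 : ℓ (q, q) = 0)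
    (h1 : HasFDerivAt ℓ (ContinuousLinearMap.snd ℝ V V - ContinuousLinearMap.fst ℝ V V) (q, q))
    (v u : V × V) :
    fderiv ℝ (fderiv ℝ (quadWorld G ℓ)) (q, q) v u = G q (v.2 - v.1) (u.2 - u.1) := by
  have hW := contDiffAt_quadWorld (y := (q, q)) hG hℓ
  have hW' : DifferentiableAt ℝ (fderiv ℝ (quadWorld G ℓ)) (q, q) :=
    (hW.fderiv_right (m := 1) (one_add_one_eq_two.trans_le two_le_infty)).differentiableAt (by norm_num)
  have hG' : DifferentiableAt ℝ (fderiv ℝ G) q :=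
    (hG.fderiv_right (m := 1) (one_add_one_eq_two.trans_le two_le_infty)).differentiableAt (by norm_num)
  have hℓ' : DifferentiableAt ℝ (fderiv ℝ ℓ) (q, q) :=
    (hℓ.fderiv_right (m := 1) (one_add_one_eq_two.trans_le two_le_infty)).differentiableAt (by norm_num)
  have hfst : DifferentiableAt ℝ (fun y : V × V => y.1) (q, q) := by fun_prop
  have hGf : DifferentiableAt ℝ (fun y : V × V => G y.1) (q, q) :=
    DifferentiableAt.comp (q, q) (f := fun y : V × V => y.1)
      (hG.differentiableAt (by norm_num)) hfst
  have hGf' : DifferentiableAt ℝ (fun y : V × V => fderiv ℝ G y.1) (q, q) :=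
    DifferentiableAt.comp (q, q) (f := fun y : V × V => y.1) hG' hfst
  have e1 : (fun y => fderiv ℝ (quadWorld G ℓ) y u) =ᶠ[𝓝 (q, q)] fun y =>
      ((1 / 2 : ℝ) • fderiv ℝ G y.1 u.1 (ℓ y) + G y.1 (fderiv ℝ ℓ y u)) (ℓ y) := by
    have e2 : ∀ᶠ y in 𝓝 ((q, q) : V × V), ContDiffAt ℝ 1 G y.1 :=
      (continuous_fst.tendsto ((q, q) : V × V)).eventually
        ((hG.of_le (by norm_num : (1 : WithTop ℕ∞) ≤ ∞)).eventually (by norm_num))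
    filter_upwards [e2, (hℓ.of_le (by norm_num : (1 : WithTop ℕ∞) ≤ ∞)).eventually (by norm_num)]
      with y a1 a2
    exact fderiv_quadWorld hs (a1.differentiableAt (by norm_num))
      (a2.differentiableAt (by norm_num)) u
  have hB : DifferentiableAt ℝ (fun y : V × V =>
      (1 / 2 : ℝ) • fderiv ℝ G y.1 u.1 (ℓ y) + G y.1 (fderiv ℝ ℓ y u)) (q, q) :=
    (((hGf'.clm_apply (differentiableAt_const _)).clm_apply
      h1.differentiableAt).fun_const_smul _).fun_add
      (hGf.clm_apply (hℓ'.clm_apply (differentiableAt_const _)))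
  have h2 := (hasFDerivAt_clm_apply_of_eq_zero hB h1 h0).congr_of_eventuallyEq e1
  have h3 := hW'.hasFDerivAt.clm_apply (hasFDerivAt_const u ((q, q) : V × V))
  have h4 := congrArg (fun L : V × V →L[ℝ] ℝ => L v) (h3.unique h2)
  simp only [add_apply, ContinuousLinearMap.comp_apply, ContinuousLinearMap.flip_apply, h0,
    map_zero, smul_zero, zero_add, zero_apply, h1.fderiv, sub_apply, ContinuousLinearMap.coe_fst',
    ContinuousLinearMap.coe_snd'] at h4
  rw [h4, hs]

end World

variable {F D : Type*} [NormedAddCommGroup F] [NormedSpace ℝ F] [NormedAddCommGroup D]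
  [NormedSpace ℝ D]

/-- The data of a smooth bi-scalar `W` which vanishes to second order on the diagonal near `q₀`, with
Hessian given by `G`. -/
def IsWorldLike {V : Type*} [NormedAddCommGroup V] [NormedSpace ℝ V]
    (G : V → V →L[ℝ] V →L[ℝ] ℝ) (W : V × V → ℝ) (q : V) : Prop :=
  ContDiffAt ℝ ∞ W (q, q) ∧ W (q, q) = 0 ∧ fderiv ℝ W (q, q) = 0 ∧
    ∀ v w, fderiv ℝ (fderiv ℝ W) (q, q) v w = G q (v.2 - v.1) (w.2 - w.1)

theorem hasFDerivAt_comp_slice {V W : Type*} [NormedAddCommGroup W] [NormedSpace ℝ W]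
    [NormedAddCommGroup V] [NormedSpace ℝ V] {f : V × (ℝ × F) → W} {q : V} {τ : ℝ} {x : F}
    (hf : DifferentiableAt ℝ f (q, (τ, x))) :
    HasFDerivAt (fun x => f (q, (τ, x))) ((fderiv ℝ f (q, (τ, x))).comp
      ((ContinuousLinearMap.inr ℝ V (ℝ × F)).comp (ContinuousLinearMap.inr ℝ ℝ F))) x :=
  HasFDerivAt.comp x (f := fun x : F => (q, (τ, x))) hf.hasFDerivAt
    ((hasFDerivAt_prodMk_right q (τ, x)).comp x (f := fun x : F => (τ, x))
      (hasFDerivAt_prodMk_right τ x))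

/-- The first term of `φ` is a first derivative of `W`, so on the diagonal its `x`-derivative is a
mixed second derivative, equal to `-G` with a further sign from the formula. The second term is of
second order and enters only the Hessian. -/
theorem phase_derivatives {φ : F × D → ℂ} {G : ℝ × F → (ℝ × F) →L[ℝ] (ℝ × F) →L[ℝ] ℝ}
    {W : (ℝ × F) × (ℝ × F) → ℝ} {τ : ℝ} {u : D → F} {p : D → ℝ × F} {κ : D → ℝ} {η : D}
    (hu : ContinuousAt u η) (hφ : ContDiffAt ℝ ∞ φ (u η, η))
    (hW : ∀ᶠ q in 𝓝 (τ, u η), IsWorldLike G W q)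
    (hform : ∀ᶠ y in 𝓝 (u η, η), φ y = -((fderiv ℝ W ((τ, u y.2), (τ, y.1)) (p y.2, 0) : ℝ) : ℂ) -
      Complex.I * ((κ y.2 * W ((τ, u y.2), (τ, y.1)) : ℝ) : ℂ)) :
    (∀ᶠ ζ in 𝓝 η, φ (u ζ, ζ) = 0 ∧
      ∀ v, fderiv ℝ φ (u ζ, ζ) (v, 0) = ((G (τ, u ζ) (0, v) (p ζ) : ℝ) : ℂ)) ∧
    ∀ w, (fderiv ℝ (fderiv ℝ φ) (u η, η) (w, 0) (w, 0)).im = -(κ η * G (τ, u η) (0, w) (0, w)) := by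
  have hc : ContinuousAt (fun ζ => (u ζ, ζ)) η := hu.prodMk continuousAt_id
  have hc' : ContinuousAt (fun ζ => (τ, u ζ)) η := continuousAt_const.prodMk hu
  have hφ1 : ∀ᶠ y in 𝓝 (u η, η), DifferentiableAt ℝ φ y :=
    ((hφ.of_le (by norm_num : (1 : WithTop ℕ∞) ≤ ∞)).eventually (by norm_num)).mono
      fun y hy => hy.differentiableAt (by norm_num)
  have hx : ∀ x ζ, ContinuousAt (fun x : F => (x, ζ)) x := fun x (ζ : D) => by fun_prop
  refine ⟨?_, fun w => ?_⟩
  · filter_upwards [hc.eventually hφ1, hc'.eventually hW, hc.eventually hform.eventually_nhds]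
      with ζ h1 h2 h3
    obtain ⟨h4, h5, h6, h7⟩ := h2
    refine ⟨?_, fun v => ?_⟩
    · rw [h3.self_of_nhds, h5, h6]
      simp
    · have h8 : HasFDerivAt (fun x => φ (x, ζ)) _ (u ζ) :=
        HasFDerivAt.comp (u ζ) (f := fun x : F => (x, ζ)) h1.hasFDerivAt
          (hasFDerivAt_prodMk_left (u ζ) ζ)
      have h9 := (hasFDerivAt_comp_slice (h4.differentiableAt (by norm_num))).const_mul (κ ζ)
      have h10 := (hasFDerivAt_comp_slice ((h4.fderiv_right (m := 1) (one_add_one_eq_two.trans_le two_le_infty)).differentiableAt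
        (by norm_num))).clm_apply (hasFDerivAt_const ((p ζ, 0) : (ℝ × F) × (ℝ × F)) (u ζ))
      have h11 := ((Complex.ofRealCLM.hasFDerivAt.comp (u ζ) h10).neg.sub
        ((Complex.ofRealCLM.hasFDerivAt.comp (u ζ) h9).const_mul Complex.I))
      have h12 := h8.unique (h11.congr_of_eventuallyEq ((hx (u ζ) ζ).eventually h3))
      have h13 := congrArg (fun L : F →L[ℝ] ℂ => L v) h12
      simp only [ContinuousLinearMap.comp_apply, ContinuousLinearMap.inl_apply] at h13
      rw [h13]
      simp only [sub_apply, neg_apply, smul_apply, ContinuousLinearMap.comp_apply, add_apply,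
        ContinuousLinearMap.flip_apply, ContinuousLinearMap.inr_apply, h6, h7, zero_apply, map_zero,
        smul_zero, sub_zero, zero_add, zero_sub]
      simp
  · have h2 := hW.self_of_nhds
    obtain ⟨h4, h5, h6, h7⟩ := h2
    have h8 : HasFDerivAt (fun x => fderiv ℝ φ (x, η) (w, 0)) _ (u η) :=
      (HasFDerivAt.comp (u η) (f := fun x : F => (x, η))
        ((hφ.fderiv_right (m := 1) (one_add_one_eq_two.trans_le two_le_infty)).differentiableAt (by norm_num)).hasFDerivAt
          (hasFDerivAt_prodMk_left (u η) η)).clm_apply (hasFDerivAt_const ((w, 0) : F × D) (u η))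
    have h9 := Complex.imCLM.hasFDerivAt.comp (u η) h8
    have h10 := ((hasFDerivAt_comp_slice ((h4.fderiv_right (m := 1) (one_add_one_eq_two.trans_le two_le_infty)).differentiableAt
        (by norm_num))).clm_apply
          (hasFDerivAt_const ((0, (0, w)) : (ℝ × F) × (ℝ × F)) (u η))).const_mul (-κ η)
    have e1 : ∀ᶠ x in 𝓝 (u η), DifferentiableAt ℝ W ((τ, u η), (τ, x)) := by
      have hs : ContinuousAt (fun x : F => ((τ, u η), (τ, x))) (u η) := by fun_prop
      exact hs.eventually (((h4.of_le (by norm_num : (1 : WithTop ℕ∞) ≤ ∞)).eventually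
        (by norm_num)).mono fun y hy => hy.differentiableAt (by norm_num))
    -- The first term of the phase is real and drops out, so `Im φ_x` involves only first
    -- derivatives of `W`, and its derivative only the Hessian.
    have e2 : (Complex.imCLM ∘ fun x => fderiv ℝ φ (x, η) (w, 0)) =ᶠ[𝓝 (u η)]
        fun x => -κ η * fderiv ℝ W ((τ, u η), (τ, x)) (0, (0, w)) := by
      filter_upwards [e1, (hx (u η) η).eventually hφ1, (hx (u η) η).eventually hform.eventually_nhds]
        with x a1 a2 a3
      have b1 := Complex.imCLM.hasFDerivAt.comp x (HasFDerivAt.comp x (f := fun x : F => (x, η))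
        a2.hasFDerivAt (hasFDerivAt_prodMk_left x η))
      have b2 := (hasFDerivAt_comp_slice a1).const_mul (-κ η)
      have b3 := b1.unique (b2.congr_of_eventuallyEq (by
        filter_upwards [(hx x η).eventually a3] with x' hx'
        simp only [Function.comp_apply, Complex.imCLM_apply]
        rw [hx']
        simp))
      exact congrArg (fun L : F →L[ℝ] ℝ => L w) b3
    have h11 := congrArg (fun L : F →L[ℝ] ℝ => L w) (h9.unique (h10.congr_of_eventuallyEq e2))
    simp only [ContinuousLinearMap.comp_apply, smul_apply, add_apply, zero_apply, map_zero, zero_add,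
        ContinuousLinearMap.flip_apply, ContinuousLinearMap.inr_apply, ContinuousLinearMap.inl_apply,
        h7, Complex.imCLM_apply, sub_zero] at h11
    rw [h11]
    simp

/-- The derivative of `φ (u ζ, ζ) = 0` is `φ_x u' + φ_η = 0`, and the first summand is `ξ(u')`,
which vanishes by conservation of the canonical one-form. -/
theorem fderiv_eq_zero_of_phase {φ : F × D → ℂ} {u : D → F} {ξ : F →L[ℝ] ℝ} {η : D}
    (hu : DifferentiableAt ℝ u η) (hφ : DifferentiableAt ℝ φ (u η, η))
    (h1 : ∀ᶠ ζ in 𝓝 η, φ (u ζ, ζ) = 0) (h2 : ∀ v, fderiv ℝ φ (u η, η) (v, 0) = ((ξ v : ℝ) : ℂ))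
    (h3 : ∀ ζ, ξ (fderiv ℝ u η ζ) = 0) (ζ : D) : fderiv ℝ φ (u η, η) (0, ζ) = 0 := by
  have h4 : HasFDerivAt (fun ζ => φ (u ζ, ζ)) _ η :=
    HasFDerivAt.comp η (f := fun ζ => (u ζ, ζ)) hφ.hasFDerivAt
      (hu.hasFDerivAt.prodMk (hasFDerivAt_id η))
  have h5 := h4.unique ((hasFDerivAt_const (0 : ℂ) η).congr_of_eventuallyEq h1)
  have h6 := congrArg (fun L : D →L[ℝ] ℂ => L ζ) h5
  have h7 : ((fderiv ℝ u η ζ, ζ) : F × D) = (fderiv ℝ u η ζ, 0) + (0, ζ) := by simp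
  change fderiv ℝ φ (u η, η) (fderiv ℝ u η ζ, ζ) = 0 at h6
  rw [h7, map_add, h2, h3] at h6
  simpa using h6

/-- The relations required by `hessian_nondegenerate` are the derivatives along the flow of `φ_x =
ξ` and `φ_η = 0`. -/
theorem phase_nondegenerate {φ : F × D → ℂ} {u : D → F} {ξ : D → F →L[ℝ] ℝ} {η : D}
    (hu : DifferentiableAt ℝ u η) (hξ : DifferentiableAt ℝ ξ η) (hφ : ContDiffAt ℝ ∞ φ (u η, η))
    (h1 : ∀ᶠ ζ in 𝓝 η, ∀ v, fderiv ℝ φ (u ζ, ζ) (v, 0) = ((ξ ζ v : ℝ) : ℂ))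
    (h2 : ∀ᶠ ζ in 𝓝 η, ∀ ζ', fderiv ℝ φ (u ζ, ζ) (0, ζ') = 0)
    (h3 : ∀ w, w ≠ 0 → 0 < (fderiv ℝ (fderiv ℝ φ) (u η, η) (w, 0) (w, 0)).im)
    (hinj : ∀ ζ, fderiv ℝ u η ζ = 0 → fderiv ℝ ξ η ζ = 0 → ζ = 0) {a b : D}
    (hab : ∀ v, fderiv ℝ (fderiv ℝ φ) (u η, η) (v, 0) (0, a) +
      Complex.I * fderiv ℝ (fderiv ℝ φ) (u η, η) (v, 0) (0, b) = 0) : a = 0 ∧ b = 0 := by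
  have hφ' : DifferentiableAt ℝ (fderiv ℝ φ) (u η, η) :=
    (hφ.fderiv_right (m := 1) (one_add_one_eq_two.trans_le two_le_infty)).differentiableAt (by norm_num)
  have h4 : HasFDerivAt (fun ζ => fderiv ℝ φ (u ζ, ζ)) ((fderiv ℝ (fderiv ℝ φ) (u η, η)).comp
      ((fderiv ℝ u η).prod (ContinuousLinearMap.id ℝ D))) η :=
    HasFDerivAt.comp η (f := fun ζ => (u ζ, ζ)) hφ'.hasFDerivAt
      (hu.hasFDerivAt.prodMk (hasFDerivAt_id η))
  refine hessian_nondegenerate (H := fderiv ℝ (fderiv ℝ φ) (u η, η)) (A := fderiv ℝ u η)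
    (Ξ := fderiv ℝ ξ η) ?_ ?_ ?_ h3 hinj hab
  · exact fun x y => (hφ.isSymmSndFDerivAt (by simpa using two_le_infty)).eq x y
  · intro ζ v
    have h5 := h4.clm_apply (hasFDerivAt_const ((v, 0) : F × D) η)
    have h6 := Complex.ofRealCLM.hasFDerivAt.comp η
      (hξ.hasFDerivAt.clm_apply (hasFDerivAt_const v η))
    have h7 := h5.unique (h6.congr_of_eventuallyEq (h1.mono fun ζ h => h v))
    have h8 := congrArg (fun L : D →L[ℝ] ℂ => L ζ) h7
    simpa using h8
  · intro ζ ζ'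
    have h5 := h4.clm_apply (hasFDerivAt_const ((0, ζ') : F × D) η)
    have h7 := h5.unique ((hasFDerivAt_const (0 : ℂ) η).congr_of_eventuallyEq
      (h2.mono fun ζ h => h ζ'))
    have h8 := congrArg (fun L : D →L[ℝ] ℂ => L ζ) h7
    simpa using h8

end QuadraticPhase

/-! ### The phase function in coordinates -/

section PhaseCoordinates

variable {n : ℕ} {S : Type*} [TopologicalSpace S] [ChartedSpace (EuclideanSpace ℝ (Fin n)) S]
  [IsManifold (𝓡 n) ∞ S]

theorem cotPar_self (s : ℝ) (y : S) (η : E n →L[ℝ] ℝ) :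
    cotPar y (s, extChartAt (𝓡 n) y y, η) = (s, ⟨y, η⟩) := by
  have h1 := cotPar_cotCoord (n := n) (c := y) (z := (s, ⟨y, η⟩)) (mem_chart_source _ y)
  have h2 : cotCoord y ((s, ⟨y, η⟩) : ℝ × CotBundle n S) = (s, extChartAt (𝓡 n) y y, η) := by
    have h3 : η.comp (chartDsymm n y (extChartAt (𝓡 n) y y)) = η := by
      rw [chartDsymm_self]
      exact ContinuousLinearMap.comp_id _
    exact congrArg (fun ζ : E n →L[ℝ] ℝ => (s, extChartAt (𝓡 n) y y, ζ)) h3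
  rwa [h2] at h1

/-- A function of `(X, s, (y, η))` in coordinates. -/
def phaseC (φ : (ℝ × S) × ℝ × CotBundle n S → ℂ) (c c' : S)
    (y : (ℝ × E n) × (ℝ × E n × (E n →L[ℝ] ℝ))) : ℂ := φ (pt n c' y.1, cotPar c y.2)

/-- A function of `(X, s, (y, η))` in coordinates, for fixed times and fixed `y`. -/
def phaseSlice (φ : (ℝ × S) × ℝ × CotBundle n S → ℂ) (τ : ℝ) (c' : S) (s : ℝ) (y : S)
    (x : E n × (E n →L[ℝ] ℝ)) : ℂ := φ ((τ, (extChartAt (𝓡 n) c').symm x.1), s, ⟨y, x.2⟩)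

/-- In the chart centred at `y` the fibre coordinate over `y` is `η` itself. So the slice needs no
chart in the fibre and inherits smoothness from `phaseC`. -/
theorem phaseSlice_eq (φ : (ℝ × S) × ℝ × CotBundle n S → ℂ) (τ : ℝ) (c' : S) (s : ℝ) (y : S)
    (x : E n × (E n →L[ℝ] ℝ)) :
    phaseSlice φ τ c' s y x = phaseC φ y c' ((τ, x.1), (s, extChartAt (𝓡 n) y y, x.2)) := by
  rw [phaseC, cotPar_self]
  rfl

theorem contDiffAt_phaseC {φ : (ℝ × S) × ℝ × CotBundle n S → ℂ}
    (hφ : ContMDiffOn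
      ((𝓘(ℝ, ℝ).prod (𝓡 n)).prod (𝓘(ℝ, ℝ).prod ((𝓡 n).prod 𝓘(ℝ, E n →L[ℝ] ℝ)))) 𝓘(ℝ, ℂ) ∞
      φ {p | p.2.2.2 ≠ 0}) {c c' : S} {y : (ℝ × E n) × (ℝ × E n × (E n →L[ℝ] ℝ))}
    (h1 : y.1 ∈ chartDom n c') (h2 : y.2.2.1 = extChartAt (𝓡 n) c c) (h3 : y.2.2.2 ≠ 0) :
    ContDiffAt ℝ ∞ (phaseC φ c c') y := by
  have e1 : ContMDiffAt 𝓘(ℝ, (ℝ × E n) × (ℝ × E n × (E n →L[ℝ] ℝ))) (𝓘(ℝ, ℝ).prod (𝓡 n)) ∞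
      (fun y : (ℝ × E n) × (ℝ × E n × (E n →L[ℝ] ℝ)) => pt n c' y.1) y :=
    ContMDiffAt.comp y (g := pt n c') (f := fun y : (ℝ × E n) × (ℝ × E n × (E n →L[ℝ] ℝ)) => y.1)
      ((contMDiffOn_pt c').contMDiffAt ((isOpen_chartDom c').mem_nhds h1)) contDiffAt_fst.contMDiffAt
  have e2 : ContMDiffAt 𝓘(ℝ, (ℝ × E n) × (ℝ × E n × (E n →L[ℝ] ℝ)))
      (𝓘(ℝ, ℝ).prod ((𝓡 n).prod 𝓘(ℝ, E n →L[ℝ] ℝ))) ∞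
      (fun y : (ℝ × E n) × (ℝ × E n × (E n →L[ℝ] ℝ)) => cotPar c y.2) y :=
    ContMDiffAt.comp y (g := cotPar c) (f := fun y : (ℝ × E n) × (ℝ × E n × (E n →L[ℝ] ℝ)) => y.2)
      (contMDiffAt_cotPar h2) contDiffAt_snd.contMDiffAt
  have e3 := e1.prodMk e2
  have hu : y.2.2.1 ∈ (extChartAt (𝓡 n) c).target := h2 ▸ mem_extChartAt_target c
  have k1 : ∀ y : (ℝ × E n) × (ℝ × E n × (E n →L[ℝ] ℝ)), y.2.2.1 ∈ (extChartAt (𝓡 n) c).target →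
      y.2.2.2 ≠ 0 → (pt n c' y.1, cotPar c y.2) ∈
        {p : (ℝ × S) × ℝ × CotBundle n S | p.2.2.2 ≠ 0} := fun y a b =>
    Spacetime.comp_chartD_ne_zero a b
  have k2 : ∀ᶠ y' in 𝓝 y, y'.2.2.1 ∈ (extChartAt (𝓡 n) c).target ∧ y'.2.2.2 ≠ 0 := by
    have c1 : ContinuousAt (fun y : (ℝ × E n) × (ℝ × E n × (E n →L[ℝ] ℝ)) => y.2.2.1) y := by
      fun_prop
    have c2 : ContinuousAt (fun y : (ℝ × E n) × (ℝ × E n × (E n →L[ℝ] ℝ)) => y.2.2.2) y := by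
      fun_prop
    exact (c1.eventually ((isOpen_extChartAt_target c).mem_nhds hu)).and (c2.eventually_ne h3)
  have e4 := ContMDiffWithinAt.comp y (g := φ) (hφ _ (k1 y hu h3)) e3.contMDiffWithinAt
    (mapsTo_preimage _ _)
  exact (e4.contMDiffAt (k2.mono fun y' hy' => k1 y' hy'.1 hy'.2)).contDiffAt

theorem contDiffAt_phaseSlice {φ : (ℝ × S) × ℝ × CotBundle n S → ℂ}
    (hφ : ContMDiffOn
      ((𝓘(ℝ, ℝ).prod (𝓡 n)).prod (𝓘(ℝ, ℝ).prod ((𝓡 n).prod 𝓘(ℝ, E n →L[ℝ] ℝ)))) 𝓘(ℝ, ℂ) ∞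
      φ {p | p.2.2.2 ≠ 0}) {τ s : ℝ} {c' y : S} {x : E n × (E n →L[ℝ] ℝ)}
    (h1 : x.1 ∈ (extChartAt (𝓡 n) c').target) (h3 : x.2 ≠ 0) :
    ContDiffAt ℝ ∞ (phaseSlice φ τ c' s y) x := by
  rw [funext (phaseSlice_eq φ τ c' s y)]
  refine ContDiffAt.comp x (g := phaseC φ y c')
    (f := fun x : E n × (E n →L[ℝ] ℝ) => ((τ, x.1), (s, extChartAt (𝓡 n) y y, x.2)))
    (contDiffAt_phaseC hφ h1 rfl h3) ?_
  fun_prop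

theorem dη_eq {φ : (ℝ × S) × ℝ × CotBundle n S → ℂ} {τ s : ℝ} {c' y : S}
    {x : E n × (E n →L[ℝ] ℝ)} (h : DifferentiableAt ℝ (phaseSlice φ τ c' s y) x)
    (ζ : E n →L[ℝ] ℝ) :
    dη φ (τ, (extChartAt (𝓡 n) c').symm x.1) s y x.2 ζ =
      fderiv ℝ (phaseSlice φ τ c' s y) x (0, ζ) := by
  have h1 : HasDerivAt (fun r : ℝ => (x.1, x.2 + r • ζ)) (0, ζ) 0 := by
    have h2 : HasDerivAt (fun r : ℝ => x.2 + r • ζ) ζ 0 := by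
      simpa using ((hasDerivAt_id (0 : ℝ)).smul_const ζ).const_add x.2
    exact (hasDerivAt_const (0 : ℝ) x.1).prodMk h2
  exact (HasFDerivAt.comp_hasDerivAt_of_eq (l := phaseSlice φ τ c' s y) 0 h.hasFDerivAt h1
    (by simp)).deriv

theorem dx_eq {f : S → ℂ} {c : S}
    (h : DifferentiableAt ℝ (fun u => f ((extChartAt (𝓡 n) c).symm u)) (extChartAt (𝓡 n) c c))
    (v : E n) :
    dx f c v = fderiv ℝ (fun u => f ((extChartAt (𝓡 n) c).symm u)) (extChartAt (𝓡 n) c c) v := by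
  have h1 := HasMFDerivAt.comp c (f := extChartAt (𝓡 n) c)
    (g := fun u => f ((extChartAt (𝓡 n) c).symm u)) h.hasFDerivAt.hasMFDerivAt
    (mdifferentiableAt_extChartAt (I := 𝓡 n) (mem_chart_source _ c)).hasMFDerivAt
  have h2 : f =ᶠ[𝓝 c] (fun u => f ((extChartAt (𝓡 n) c).symm u)) ∘ extChartAt (𝓡 n) c := by
    filter_upwards [extChartAt_source_mem_nhds (I := 𝓡 n) c] with x hx
    rw [Function.comp_apply, (extChartAt (𝓡 n) c).left_inv hx]
  have h3 := (h1.congr_of_eventuallyEq h2).mfderiv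
  have h4 := congrArg (fun L : E n →L[ℝ] ℂ => L v) h3
  refine h4.trans ?_
  have h5 := congrArg (fun L : E n →L[ℝ] E n =>
    fderiv ℝ (fun u => f ((extChartAt (𝓡 n) c).symm u)) (extChartAt (𝓡 n) c c) (L v)) (chartD_self c)
  exact h5

end PhaseCoordinates

/-! ### The world function and the phase in coordinates near a flow point -/

namespace Spacetime

variable {n : ℕ} {S : Type*} [TopologicalSpace S] [ChartedSpace (EuclideanSpace ℝ (Fin n)) S]
  [IsManifold (𝓡 n) ∞ S] {g : Spacetime n S} [T2Space S]

/-- The world function in coordinates. -/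
def worldC (N : g.NormalNeighbourhoods) (c : S) (y : (ℝ × E n) × (ℝ × E n)) : ℝ :=
  quadWorld (g.chartG c) (N.logC c) y

theorem isWorldLike_worldC (N : g.NormalNeighbourhoods) {c : S} {q : ℝ × E n}
    (hq : q ∈ chartDom n c) : IsWorldLike (g.chartG c) (worldC N c) q := by
  have h1 := g.contDiffAt_chartG hq
  have h2 := N.contDiffAt_logC (N.diag_mem_logDom hq)
  have h3 := N.logC_diag c q
  refine ⟨contDiffAt_quadWorld h1 h2, ?_, ?_, fderiv_fderiv_quadWorld (g.chartG_symm c) h1 h2 h3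
    (N.hasStrictFDerivAt_logC hq).hasFDerivAt⟩
  · change 1 / 2 * g.chartG c q (N.logC c (q, q)) (N.logC c (q, q)) = 0
    rw [h3, map_zero, mul_zero]
  · refine ContinuousLinearMap.ext fun w => ?_
    refine (fderiv_quadWorld (g.chartG_symm c) (h1.differentiableAt (by norm_num))
      (h2.differentiableAt (by norm_num)) w).trans ?_
    rw [h3]
    simp

/-- The differential here is in the base point `Z` with the endpoint fixed, which corresponds to the
first argument of `worldC`. -/
theorem dM_worldFunction (N : g.NormalNeighbourhoods) {c : S} {Z : ℝ × S} {x : ℝ × E n}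
    (hc : Z.2 ∈ (chartAt (EuclideanSpace ℝ (Fin n)) c).source)
    (hx : (coordPt n c Z, x) ∈ N.logDom c) (v : ℝ × E n) :
    dM n (fun Z => N.worldFunction (pt n c x) Z) Z v =
      fderiv ℝ (worldC N c) (coordPt n c Z, x) (cvec n c Z v, 0) := by
  have h1 : ContDiffAt ℝ ∞ (worldC N c) (coordPt n c Z, x) :=
    contDiffAt_quadWorld (g.contDiffAt_chartG hx.1) (N.contDiffAt_logC hx)
  have h2 : HasFDerivAt (fun q => worldC N c (q, x)) _ (coordPt n c Z) :=
    HasFDerivAt.comp (coordPt n c Z) (f := fun q : ℝ × E n => (q, x))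
      (h1.differentiableAt (by norm_num)).hasFDerivAt (hasFDerivAt_prodMk_left (coordPt n c Z) x)
  have h3 : ∀ᶠ Z' in 𝓝 Z, N.worldFunction (pt n c x) Z' = worldC N c (coordPt n c Z', x) := by
    have h4 : ContinuousAt (fun Z' => (coordPt n c Z', x)) Z :=
      (continuousAt_coordPt hc).prodMk continuousAt_const
    filter_upwards [h4.eventually ((N.isOpen_logDom c).mem_nhds hx),
      (continuousAt_snd (p := Z)).eventually
        ((chartAt (EuclideanSpace ℝ (Fin n)) c).open_source.mem_nhds hc)] with Z' a b
    have := N.worldFunction_pt (y := (coordPt n c Z', x)) a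
    rwa [pt_coordPt b] at this
  refine (dM_eq hc h2.differentiableAt h3 v).trans ?_
  rw [h2.fderiv]
  rfl

end Spacetime

namespace Spacetime

variable {n : ℕ} {S : Type*} [TopologicalSpace S] [ChartedSpace (EuclideanSpace ℝ (Fin n)) S]
  [IsManifold (𝓡 n) ∞ S] {g : Spacetime n S} [T2Space S]

theorem parState_center {s : ℝ} {y : S} {η : E n →L[ℝ] ℝ} (hη : η ≠ 0) :
    g.parState y (s, extChartAt (𝓡 n) y y, η) = g.nullState s y η := by
  have h1 := parState_eq_nullState (g := g) (s := s) (mem_chart_source _ y) hη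
  have h3 : η.comp (chartDsymm n y (extChartAt (𝓡 n) y y)) = η := by
    rw [chartDsymm_self]
    exact ContinuousLinearMap.comp_id _
  rwa [h3] at h1

theorem flowξ_eq {τ s : ℝ} {y : S} {η : E n →L[ℝ] ℝ} {z : (ℝ × S) × (ℝ × E n)}
    (hz : g.flow τ s y η = ⟨z.1, g.gM z.1 z.2⟩) (v : E n) :
    g.flowξ τ s y η v = g.gM z.1 z.2 (0, v) := by
  have key : ∀ p : Σ X : ℝ × S, CotM n X, p = ⟨z.1, g.gM z.1 z.2⟩ →
      p.2 ((0, v) : ℝ × E n) = g.gM z.1 z.2 (0, v) := by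
    rintro p rfl
    rfl
  exact key _ hz

variable [CompactSpace S]

/-- The flow near `(τ, s, y, η)`, in the charts centred at `y` and at the point `x*`. -/
theorem exists_centered_flow_family (N : g.NormalNeighbourhoods) (τ s : ℝ) (y : S)
    {η : E n →L[ℝ] ℝ} (hη : η ≠ 0) :
    ∃ z', g.IsPropagation y (g.parState y) (s, extChartAt (𝓡 n) y y, η) τ (g.flowx τ s y η) z' ∧
      (∀ ζ, g.pairing (g.flowx τ s y η) z' (τ, s, extChartAt (𝓡 n) y y, η) (0, 0, 0, ζ) = 0) ∧
      ∀ᶠ β in 𝓝 (τ, s, extChartAt (𝓡 n) y y, η),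
        β.2.2.1 ∈ (extChartAt (𝓡 n) y).target ∧ β.2.2.2 ≠ 0 ∧
        g.flow β.1 β.2.1 ((extChartAt (𝓡 n) y).symm β.2.2.1)
          (β.2.2.2.comp (chartD n y ((extChartAt (𝓡 n) y).symm β.2.2.1))) =
          ⟨(z' β).1, g.gM (z' β).1 (z' β).2⟩ := by
  obtain ⟨c', z', h1, h2, h3⟩ := exists_flow_family N
    (α₀ := (s, extChartAt (𝓡 n) y y, η)) (mem_extChartAt_target y) hη τ
  have h4 := h1.2.1.self_of_nhds
  have h5 := flow_eq_of_joins hη (parState_center (g := g) hη ▸ h4.1) h4.2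
  have h6 : g.flowx τ s y η = (z' (τ, s, extChartAt (𝓡 n) y y, η)).1.2 :=
    congrArg Prod.snd (flowX_eq h5)
  have hc : (z' (τ, s, extChartAt (𝓡 n) y y, η)).1.2 ∈
      (chartAt (EuclideanSpace ℝ (Fin n)) (g.flowx τ s y η)).source := by
    rw [← h6]
    exact mem_chart_source _ _
  -- The propagated family is expressed in the chart centred at `x*`; the pairings do not depend on
  -- the chart.
  refine ⟨z', ⟨h1.1.change hc, h1.2.1, fun a => ?_⟩, fun ζ => ?_, h3.mono fun β hβ => hβ.2⟩
  · rw [h1.1.pairing_change hc, h1.2.2]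
  · rw [h1.1.pairing_change hc, h2]

/-- The flow and the phase function for fixed `τ`, `s` and `y`, in coordinates near `η`. -/
structure IsLocalPhase (g : Spacetime n S) (φ : (ℝ × S) × ℝ × CotBundle n S → ℂ) (τ s : ℝ) (y : S)
    (η : E n →L[ℝ] ℝ) (u : (E n →L[ℝ] ℝ) → E n) (ξ : (E n →L[ℝ] ℝ) → (E n →L[ℝ] ℝ)) : Prop where
  point : u η = extChartAt (𝓡 n) (g.flowx τ s y η) (g.flowx τ s y η)
  covector : ∀ v : E n, ξ η v = g.flowξ τ s y η v
  diff_point : DifferentiableAt ℝ u η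
  diff_covector : DifferentiableAt ℝ ξ η
  flow : ∀ᶠ ζ in 𝓝 η, ζ ≠ 0 ∧ u ζ ∈ (extChartAt (𝓡 n) (g.flowx τ s y η)).target ∧
    g.flowx τ s y ζ = (extChartAt (𝓡 n) (g.flowx τ s y η)).symm (u ζ)
  orthogonal : ∀ ζ, ξ η (fderiv ℝ u η ζ) = 0
  injective : ∀ ζ, fderiv ℝ u η ζ = 0 → fderiv ℝ ξ η ζ = 0 → ζ = 0
  phase : ∀ᶠ ζ in 𝓝 η, phaseSlice φ τ (g.flowx τ s y η) s y (u ζ, ζ) = 0 ∧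
    ∀ v, fderiv ℝ (phaseSlice φ τ (g.flowx τ s y η) s y) (u ζ, ζ) (v, 0) = ((ξ ζ v : ℝ) : ℂ)
  hessian : ∀ w, w ≠ 0 →
    0 < (fderiv ℝ (fderiv ℝ (phaseSlice φ τ (g.flowx τ s y η) s y)) (u η, η) (w, 0) (w, 0)).im

/-- The position and the restricted covector are the components of `stateParam` along the propagated
family, with `τ`, `s` and `y` frozen. The phase data follow from `phase_derivatives`, the
orthogonality from the conserved pairing, the injectivity from the reversibility of the flow. -/
theorem exists_isLocalPhase {N : g.NormalNeighbourhoods} {ε : ℝ} (hε : 0 < ε)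
    {φ : (ℝ × S) × ℝ × CotBundle n S → ℂ} (hφ : IsLeviCivitaPhase N ε φ) (τ s : ℝ) (y : S)
    {η : E n →L[ℝ] ℝ} (hη : η ≠ 0) : ∃ u ξ, IsLocalPhase g φ τ s y η u ξ := by
  obtain ⟨z', h1, h2, -⟩ := exists_centered_flow_family N τ s y hη
  set c := g.flowx τ s y η with hc
  set α₀ : ℝ × E n × (E n →L[ℝ] ℝ) := (s, extChartAt (𝓡 n) y y, η) with hα₀
  have hu₀ : α₀.2.1 ∈ (extChartAt (𝓡 n) y).target := mem_extChartAt_target y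
  obtain ⟨h3, h4⟩ := h1.1.comp_prodMk (g := g)
  have hι : HasFDerivAt (fun ζ : E n →L[ℝ] ℝ =>
      ((s, extChartAt (𝓡 n) y y, ζ) : ℝ × E n × (E n →L[ℝ] ℝ)))
      ((ContinuousLinearMap.inr ℝ ℝ (E n × (E n →L[ℝ] ℝ))).comp
        (ContinuousLinearMap.inr ℝ (E n) (E n →L[ℝ] ℝ))) η :=
    (hasFDerivAt_prodMk_right s (extChartAt (𝓡 n) y y, η)).comp η
      (hasFDerivAt_prodMk_right (extChartAt (𝓡 n) y y) η)
  have hβ : ContinuousAt (fun ζ : E n →L[ℝ] ℝ =>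
      ((τ, s, extChartAt (𝓡 n) y y, ζ) : ℝ × ℝ × E n × (E n →L[ℝ] ℝ))) η := by fun_prop
  set z : (E n →L[ℝ] ℝ) → (ℝ × S) × (ℝ × E n) := fun ζ => z' (τ, s, extChartAt (𝓡 n) y y, ζ) with hz
  set m := fun α => g.stateParam c (stateCoord c (z' (τ, α))) with hm
  have hmd : HasFDerivAt m (fderiv ℝ m α₀) α₀ :=
    ((h3.contDiffAt_stateParam g).differentiableAt (by norm_num)).hasFDerivAt
  set mι := fun ζ => m (s, extChartAt (𝓡 n) y y, ζ) with hmι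
  have hmι' : HasFDerivAt mι ((fderiv ℝ m α₀).comp
      ((ContinuousLinearMap.inr ℝ ℝ (E n × (E n →L[ℝ] ℝ))).comp
        (ContinuousLinearMap.inr ℝ (E n) (E n →L[ℝ] ℝ)))) η :=
    HasFDerivAt.comp η (g := m) (f := fun ζ => (s, extChartAt (𝓡 n) y y, ζ)) hmd hι
  have hud : HasFDerivAt (fun ζ => (mι ζ).2.1) _ η := hmι'.snd.fst
  have hξd : HasFDerivAt (fun ζ => (mι ζ).2.2) _ η := hmι'.snd.snd
  have htd : HasFDerivAt (fun ζ => (mι ζ).1) _ η := hmι'.fst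
  -- facts near `η`
  have e1 : ∀ᶠ ζ in 𝓝 η, ζ ≠ 0 := continuousAt_id.eventually_ne hη
  have e2 : ∀ᶠ ζ in 𝓝 η, (z ζ).1.2 ∈ (chartAt (EuclideanSpace ℝ (Fin n)) c).source :=
    hβ.eventually h1.1.eventually_source
  have e3 : ∀ᶠ ζ in 𝓝 η, (z ζ).1.1 = τ ∧ g.flow τ s y ζ = ⟨(z ζ).1, g.gM (z ζ).1 (z ζ).2⟩ := by
    filter_upwards [e1, hβ.eventually h1.2.1] with ζ a b
    exact ⟨b.2, flow_eq_of_joins a (parState_center (g := g) a ▸ b.1) b.2⟩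
  have hq : ∀ᶠ ζ in 𝓝 η, coordPt n c (z ζ).1 = (τ, (mι ζ).2.1) :=
    e3.mono fun ζ hζ => Prod.ext hζ.1 rfl
  have hz0 : (z η).1.2 = c := (congrArg Prod.snd (flowX_eq e3.self_of_nhds.2)).symm
  have hpt : (mι η).2.1 = extChartAt (𝓡 n) c c := congrArg (extChartAt (𝓡 n) c) hz0
  have hq0 : (τ, (mι η).2.1) ∈ chartDom n c := by
    change (mι η).2.1 ∈ (extChartAt (𝓡 n) c).target
    rw [hpt]
    exact mem_extChartAt_target c
  have hΦ : ContDiffAt ℝ ∞ (phaseSlice φ τ c s y) ((mι η).2.1, η) :=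
    contDiffAt_phaseSlice hφ.smooth hq0 hη
  have hW : ∀ᶠ q in 𝓝 (τ, (mι η).2.1), IsWorldLike (g.chartG c) (worldC N c) q := by
    filter_upwards [(isOpen_chartDom c).mem_nhds hq0] with q hq using isWorldLike_worldC N hq
  -- Near the flow point all endpoints lie in the normal neighbourhood of `X*`, so the explicit
  -- formula applies and reads as a quadratic-form phase in coordinates.
  have hform : ∀ᶠ x in 𝓝 ((mι η).2.1, η), phaseSlice φ τ c s y x =
      -((fderiv ℝ (worldC N c) ((τ, (mι x.2).2.1), (τ, x.1))
        (cvec n c (z x.2).1 (z x.2).2, 0) : ℝ) : ℂ) -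
      Complex.I * ((ε * g.conM s y x.2 * worldC N c ((τ, (mι x.2).2.1), (τ, x.1)) : ℝ) : ℂ) := by
    have hs : ContinuousAt (fun x : E n × (E n →L[ℝ] ℝ) => x.2) ((mι η).2.1, η) := continuousAt_snd
    have hl : ContinuousAt (fun x : E n × (E n →L[ℝ] ℝ) => ((τ, (mι x.2).2.1), (τ, x.1)))
        ((mι η).2.1, η) :=
      (continuousAt_const.prodMk (ContinuousAt.comp (g := fun ζ => (mι ζ).2.1)
        (f := fun x : E n × (E n →L[ℝ] ℝ) => x.2) (x := ((mι η).2.1, η)) hud.continuousAt hs)).prodMk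
        (continuousAt_const.prodMk continuousAt_fst)
    filter_upwards [hs.eventually e1, hs.eventually e2, hs.eventually e3, hs.eventually hq,
      hl.eventually ((N.isOpen_logDom c).mem_nhds (N.diag_mem_logDom hq0))] with x a1 a2 a3 a4 a5
    have a5' : (coordPt n c (z x.2).1, (τ, x.1)) ∈ N.logDom c := by
      rw [a4]
      exact a5
    have hX : (z x.2).1 = pt n c (τ, (mι x.2).2.1) := by rw [← a4, pt_coordPt a2]
    have b1 := hφ.eq_of_flow (x := (extChartAt (𝓡 n) c).symm x.1) a1 a3.2 (by
      rw [hX]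
      exact a5.2.2)
    have b2 := dM_worldFunction N a2 a5' (z x.2).2
    have b3 : N.worldFunction (pt n c (τ, x.1)) (z x.2).1 =
        worldC N c ((τ, (mι x.2).2.1), (τ, x.1)) := by
      rw [hX]
      exact N.worldFunction_pt (y := ((τ, (mι x.2).2.1), (τ, x.1))) a5
    rw [a4] at b2
    refine b1.trans ?_
    rw [← b2, ← b3]
    rfl
  obtain ⟨p1, p2⟩ := phase_derivatives (p := fun ζ => cvec n c (z ζ).1 (z ζ).2)
    (κ := fun ζ => ε * g.conM s y ζ) hud.continuousAt hΦ hW hform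
  refine ⟨fun ζ => (mι ζ).2.1, fun ζ => (mι ζ).2.2, hpt, ?_, hud.differentiableAt,
    hξd.differentiableAt, ?_, ?_, ?_, ?_, ?_⟩
  · intro v
    have k1 := flowξ_eq e3.self_of_nhds.2 v
    have k2 := chartG_cvec g e2.self_of_nhds (z η).2 (0, v)
    have k3 : cvec n c (z η).1 (0, v) = (0, v) := by
      rw [cvec_def, hz0, chartD_self]
      rfl
    rw [k3] at k2
    exact k2.trans k1.symm
  · filter_upwards [e1, e2, e3] with ζ a1 a2 a3
    refine ⟨a1, coordPt_mem a2, ?_⟩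
    have b1 : g.flowx τ s y ζ = (z ζ).1.2 := congrArg Prod.snd (flowX_eq a3.2)
    rw [b1]
    exact (congrArg Prod.snd (pt_coordPt a2)).symm
  · intro ζ
    have k1 := (h4 (0, 0, ζ)).trans (h2 ζ)
    have k2 : HasFDerivAt (fun α => coordPt n c (z' (τ, α)).1) _ α₀ := hmd.fst.prodMk hmd.snd.fst
    -- All members of the family sit at time `τ`, so the variation is purely spatial and the
    -- conserved pairing reduces to `ξ` applied to the derivative of `u`.
    have k3 : (fderiv ℝ m α₀ (0, 0, ζ)).1 = 0 := by
      have := htd.unique ((hasFDerivAt_const τ η).congr_of_eventuallyEq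
        (e3.mono fun ζ hζ => hζ.1))
      exact congrArg (fun L : (E n →L[ℝ] ℝ) →L[ℝ] ℝ => L ζ) this
    rw [pairing, k2.fderiv] at k1
    rw [hud.fderiv]
    change g.chartG c (coordPt n c (z η).1) (cvec n c (z η).1 (z η).2)
      ((fderiv ℝ m α₀ (0, 0, ζ)).1, (fderiv ℝ m α₀ (0, 0, ζ)).2.1) = 0 at k1
    rw [k3] at k1
    exact k1
  · intro ζ k1 k2
    have k3 : (fderiv ℝ m α₀ (0, 0, ζ)).1 = 0 := by
      have := htd.unique ((hasFDerivAt_const τ η).congr_of_eventuallyEq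
        (e3.mono fun ζ hζ => hζ.1))
      exact congrArg (fun L : (E n →L[ℝ] ℝ) →L[ℝ] ℝ => L ζ) this
    rw [hud.fderiv] at k1
    rw [hξd.fderiv] at k2
    exact fderiv_stateParam_injective N hu₀ hη h1 (Prod.ext k3 (Prod.ext k1 k2))
  · filter_upwards [p1, hq] with ζ a1 a2
    refine ⟨a1.1, fun v => (a1.2 v).trans ?_⟩
    rw [g.chartG_symm, ← a2]
    rfl
  · intro w hw
    have k1 := chartG_neg (g := g) hq0 hw
    have k2 := p2 w
    have k3 : (fderiv ℝ (fderiv ℝ (phaseSlice φ τ c s y)) ((mι η).2.1, η) (w, 0) (w, 0)).im =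
      -(ε * g.conM s y η * g.chartG c (τ, (mι η).2.1) (0, w) (0, w)) := k2
    refine lt_of_lt_of_eq ?_ k3.symm
    have k4 := mul_neg_of_pos_of_neg (mul_pos hε (conM_pos (g := g) s y hη)) k1
    linarith

end Spacetime

namespace Spacetime

variable {n : ℕ} {S : Type*} [TopologicalSpace S] [ChartedSpace (EuclideanSpace ℝ (Fin n)) S]
  [IsManifold (𝓡 n) ∞ S] {g : Spacetime n S} [T2Space S] [CompactSpace S]
  {N : g.NormalNeighbourhoods} {ε : ℝ} {φ : (ℝ × S) × ℝ × CotBundle n S → ℂ}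

/-! ### The phase function on the flow -/

theorem symm_point (c : S) : (extChartAt (𝓡 n) c).symm (extChartAt (𝓡 n) c c) = c :=
  extChartAt_to_inv c

theorem IsLocalPhase.contDiffAt {τ s : ℝ} {y : S} {η : E n →L[ℝ] ℝ}
    {u : (E n →L[ℝ] ℝ) → E n} {ξ : (E n →L[ℝ] ℝ) → (E n →L[ℝ] ℝ)}
    (h : IsLocalPhase g φ τ s y η u ξ) (hφ : IsLeviCivitaPhase N ε φ) (hη : η ≠ 0) :
    ContDiffAt ℝ ∞ (phaseSlice φ τ (g.flowx τ s y η) s y) (u η, η) :=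
  contDiffAt_phaseSlice hφ.smooth h.flow.self_of_nhds.2.1 hη

theorem IsLeviCivitaPhase.eq_zero (hε : 0 < ε) (hφ : IsLeviCivitaPhase N ε φ) (τ s : ℝ) (y : S)
    {η : E n →L[ℝ] ℝ} (hη : η ≠ 0) : φ ((τ, g.flowx τ s y η), s, ⟨y, η⟩) = 0 := by
  obtain ⟨u, ξ, h⟩ := exists_isLocalPhase hε hφ τ s y hη
  have h1 := h.phase.self_of_nhds.1
  rw [h.point, phaseSlice, symm_point] at h1
  exact h1

theorem IsLeviCivitaPhase.dx_eq_flowξ (hε : 0 < ε) (hφ : IsLeviCivitaPhase N ε φ) (τ s : ℝ)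
    (y : S) {η : E n →L[ℝ] ℝ} (hη : η ≠ 0) (v : E n) :
    dx (fun x => φ ((τ, x), s, ⟨y, η⟩)) (g.flowx τ s y η) v = ((g.flowξ τ s y η v : ℝ) : ℂ) := by
  obtain ⟨u, ξ, h⟩ := exists_isLocalPhase hε hφ τ s y hη
  have h1 := (h.contDiffAt hφ hη).differentiableAt (by norm_num)
  have h2 : HasFDerivAt (fun x => phaseSlice φ τ (g.flowx τ s y η) s y (x, η)) _ (u η) :=
    HasFDerivAt.comp (u η) (f := fun x : E n => (x, η)) h1.hasFDerivAt
      (hasFDerivAt_prodMk_left (u η) η)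
  rw [h.point] at h2
  refine (dx_eq h2.differentiableAt v).trans ?_
  refine (congrArg (fun L : E n →L[ℝ] ℂ => L v) h2.fderiv).trans ?_
  have h3 := h.phase.self_of_nhds.2 v
  rw [h.point] at h3
  exact h3.trans (congrArg _ (h.covector v))

theorem IsLeviCivitaPhase.dη_eq_zero (hε : 0 < ε) (hφ : IsLeviCivitaPhase N ε φ) (τ s : ℝ)
    (y : S) {η : E n →L[ℝ] ℝ} (hη : η ≠ 0) (ζ : E n →L[ℝ] ℝ) :
    dη φ (τ, g.flowx τ s y η) s y η ζ = 0 := by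
  obtain ⟨u, ξ, h⟩ := exists_isLocalPhase hε hφ τ s y hη
  have h1 := (h.contDiffAt hφ hη).differentiableAt (by norm_num)
  have h2 := fderiv_eq_zero_of_phase h.diff_point h1 (h.phase.mono fun ζ hζ => hζ.1)
    h.phase.self_of_nhds.2 h.orthogonal ζ
  have h3 := dη_eq h1 ζ
  rw [h2, h.point] at h3
  dsimp only at h3
  rwa [symm_point] at h3

theorem flowSet_subset_criticalSet (hε : 0 < ε) (hφ : IsLeviCivitaPhase N ε φ) :
    g.flowSet ⊆ criticalSet φ := by
  rintro _ ⟨τ, s, y, η, hη, rfl⟩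
  exact ⟨hη, fun ζ => hφ.dη_eq_zero hε τ s y hη ζ⟩

variable (g φ) in
/-- The mixed second derivative of the phase function in `x` and `η` at a point of the flow. -/
def mixedHessian (τ s : ℝ) (y : S) (η : E n →L[ℝ] ℝ) : E n →L[ℝ] (E n →L[ℝ] ℝ) →L[ℝ] ℂ :=
  fderiv ℝ (fun x => (fderiv ℝ (phaseSlice φ τ (g.flowx τ s y η) s y) (x, η)).comp
    (ContinuousLinearMap.inr ℝ (E n) (E n →L[ℝ] ℝ)))
    (extChartAt (𝓡 n) (g.flowx τ s y η) (g.flowx τ s y η))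

theorem hasFDerivAt_mixedHessian (hφ : IsLeviCivitaPhase N ε φ) (τ s : ℝ) (y : S)
    {η : E n →L[ℝ] ℝ} (hη : η ≠ 0) :
    HasFDerivAt (fun x => (fderiv ℝ (phaseSlice φ τ (g.flowx τ s y η) s y) (x, η)).comp
      (ContinuousLinearMap.inr ℝ (E n) (E n →L[ℝ] ℝ))) (g.mixedHessian φ τ s y η)
      (extChartAt (𝓡 n) (g.flowx τ s y η) (g.flowx τ s y η)) ∧
    ∀ v ζ, g.mixedHessian φ τ s y η v ζ =
      fderiv ℝ (fderiv ℝ (phaseSlice φ τ (g.flowx τ s y η) s y))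
        (extChartAt (𝓡 n) (g.flowx τ s y η) (g.flowx τ s y η), η) (v, 0) (0, ζ) := by
  set c := g.flowx τ s y η with hc
  have h1 : ContDiffAt ℝ ∞ (phaseSlice φ τ c s y) (extChartAt (𝓡 n) c c, η) :=
    contDiffAt_phaseSlice hφ.smooth (mem_extChartAt_target c) hη
  have h2 : HasFDerivAt (fun x => fderiv ℝ (phaseSlice φ τ c s y) (x, η)) _ (extChartAt (𝓡 n) c c) :=
    HasFDerivAt.comp (extChartAt (𝓡 n) c c) (f := fun x : E n => (x, η))
      ((h1.fderiv_right (m := 1)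
        (one_add_one_eq_two.trans_le two_le_infty)).differentiableAt (by norm_num)).hasFDerivAt
      (hasFDerivAt_prodMk_left (extChartAt (𝓡 n) c c) η)
  have h3 := h2.clm_comp (hasFDerivAt_const
    (ContinuousLinearMap.inr ℝ (E n) (E n →L[ℝ] ℝ)) (extChartAt (𝓡 n) c c))
  refine ⟨h3.differentiableAt.hasFDerivAt, fun v ζ => ?_⟩
  have h4 := congrArg (fun L : E n →L[ℝ] (E n →L[ℝ] ℝ) →L[ℝ] ℂ => L v ζ) h3.fderiv
  refine h4.trans ?_
  simp

/-- The vanishing of `φ_η` is needed on a neighbourhood of `η`, not only at `η`, because it is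
differentiated along the flow. -/
theorem mixedHessian_nondegenerate (hε : 0 < ε) (hφ : IsLeviCivitaPhase N ε φ) (τ s : ℝ) (y : S)
    {η : E n →L[ℝ] ℝ} (hη : η ≠ 0) (a b : E n →L[ℝ] ℝ)
    (hab : ∀ v, g.mixedHessian φ τ s y η v a + Complex.I * g.mixedHessian φ τ s y η v b = 0) :
    a = 0 ∧ b = 0 := by
  obtain ⟨u, ξ, h⟩ := exists_isLocalPhase hε hφ τ s y hη
  have h1 := h.contDiffAt hφ hη
  have h2 : ContinuousAt (fun ζ => (u ζ, ζ)) η := h.diff_point.continuousAt.prodMk continuousAt_id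
  refine phase_nondegenerate h.diff_point h.diff_covector h1 (h.phase.mono fun ζ hζ => hζ.2) ?_
    h.hessian h.injective fun v => ?_
  · filter_upwards [h.flow, h2.eventually ((h1.of_le (by norm_num : (1 : WithTop ℕ∞) ≤ ∞)).eventually
      (by norm_num))] with ζ a1 a2 ζ'
    rw [← dη_eq (a2.differentiableAt (by norm_num)) ζ']
    dsimp only
    rw [← a1.2.2]
    exact hφ.dη_eq_zero hε τ s y a1.1 ζ'
  · rw [h.point, ← (hasFDerivAt_mixedHessian hφ τ s y hη).2,
      ← (hasFDerivAt_mixedHessian hφ τ s y hη).2]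
    exact hab v

theorem dx_dη_eq (hφ : IsLeviCivitaPhase N ε φ) (τ s : ℝ) (y : S) {η : E n →L[ℝ] ℝ} (hη : η ≠ 0)
    (v : E n) (ζ : E n →L[ℝ] ℝ) :
    dx (fun x => dη φ (τ, x) s y η ζ) (g.flowx τ s y η) v = g.mixedHessian φ τ s y η v ζ := by
  set c := g.flowx τ s y η with hc
  have h1 : ContDiffAt ℝ ∞ (phaseSlice φ τ c s y) (extChartAt (𝓡 n) c c, η) :=
    contDiffAt_phaseSlice hφ.smooth (mem_extChartAt_target c) hη
  have h2 : ContinuousAt (fun x : E n => (x, η)) (extChartAt (𝓡 n) c c) := by fun_prop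
  have h3 := (hasFDerivAt_mixedHessian hφ τ s y hη).1.clm_apply
    (hasFDerivAt_const ζ (extChartAt (𝓡 n) c c))
  have h4 : (fun x => dη φ (τ, (extChartAt (𝓡 n) c).symm x) s y η ζ)
      =ᶠ[𝓝 (extChartAt (𝓡 n) c c)] fun x => (fderiv ℝ (phaseSlice φ τ c s y) (x, η)).comp
      (ContinuousLinearMap.inr ℝ (E n) (E n →L[ℝ] ℝ)) ζ := by
    filter_upwards [h2.eventually ((h1.of_le (by norm_num : (1 : WithTop ℕ∞) ≤ ∞)).eventually
      (by norm_num))] with x hx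
    exact dη_eq (hx.differentiableAt (by norm_num)) ζ
  have h5 := h3.congr_of_eventuallyEq h4
  refine (dx_eq (f := fun x => dη φ (τ, x) s y η ζ) h5.differentiableAt v).trans ?_
  rw [h5.fderiv]
  simp

theorem det_dx_dη_ne_zero (hε : 0 < ε) (hφ : IsLeviCivitaPhase N ε φ) (τ s : ℝ) (y : S)
    {η : E n →L[ℝ] ℝ} (hη : η ≠ 0) (b : Module.Basis (Fin n) ℝ (E n))
    (e : Module.Basis (Fin n) ℝ (E n →L[ℝ] ℝ)) :
    (Matrix.of fun i j : Fin n =>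
      dx (fun x => dη φ (τ, x) s y η (e j)) (g.flowx τ s y η) (b i)).det ≠ 0 := by
  have h1 := det_ne_zero_of_nondegenerate (mixedHessian_nondegenerate hε hφ τ s y hη) b e
  have h2 : (fun i j : Fin n => dx (fun x => dη φ (τ, x) s y η (e j)) (g.flowx τ s y η) (b i)) =
      fun i j => g.mixedHessian φ τ s y η (b i) (e j) :=
    funext fun i => funext fun j => dx_dη_eq hφ τ s y hη (b i) (e j)
  rwa [h2]

theorem eq_zero_of_mixedHessian (hε : 0 < ε) (hφ : IsLeviCivitaPhase N ε φ) (τ s : ℝ) (y : S)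
    {η : E n →L[ℝ] ℝ} (hη : η ≠ 0) {v : E n} (hv : g.mixedHessian φ τ s y η v = 0) : v = 0 := by
  have hdim : Module.finrank ℝ (E n →L[ℝ] ℝ) = n := by
    rw [← (LinearMap.toContinuousLinearMap (𝕜 := ℝ) (E := E n) (F' := ℝ)).finrank_eq]
    exact (Subspace.dual_finrank_eq (K := ℝ) (V := E n)).trans finrank_euclideanSpace_fin
  exact eq_zero_of_det_ne_zero (det_ne_zero_of_nondegenerate
    (mixedHessian_nondegenerate hε hφ τ s y hη)
    (Module.finBasisOfFinrankEq ℝ (E n) finrank_euclideanSpace_fin)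
    (Module.finBasisOfFinrankEq ℝ (E n →L[ℝ] ℝ) hdim)) hv

/-! ### Isolation of the flow in the critical set -/

theorem fderiv_phaseC_eq_dη {c c' : S} {x : (ℝ × E n) × (ℝ × E n × (E n →L[ℝ] ℝ))}
    (h : DifferentiableAt ℝ (phaseC φ c c') x) (ζ : E n →L[ℝ] ℝ) :
    fderiv ℝ (phaseC φ c c') x (0, 0, 0, ζ) =
      dη φ (pt n c' x.1) x.2.1 ((extChartAt (𝓡 n) c).symm x.2.2.1)
        (x.2.2.2.comp (chartD n c ((extChartAt (𝓡 n) c).symm x.2.2.1)))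
        (ζ.comp (chartD n c ((extChartAt (𝓡 n) c).symm x.2.2.1))) := by
  have h1 : HasDerivAt (fun r : ℝ => (x.1, x.2.1, x.2.2.1, x.2.2.2 + r • ζ)) (0, 0, 0, ζ) 0 := by
    have h2 : HasDerivAt (fun r : ℝ => x.2.2.2 + r • ζ) ζ 0 := by
      simpa using ((hasDerivAt_id (0 : ℝ)).smul_const ζ).const_add x.2.2.2
    exact (hasDerivAt_const (0 : ℝ) x.1).prodMk ((hasDerivAt_const (0 : ℝ) x.2.1).prodMk
      ((hasDerivAt_const (0 : ℝ) x.2.2.1).prodMk h2))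
  exact (HasFDerivAt.comp_hasDerivAt_of_eq (l := phaseC φ c c') 0 h.hasFDerivAt h1
    (by simp)).deriv.symm

theorem fderiv_phaseC_eq_zero {c c' : S} {x : (ℝ × E n) × (ℝ × E n × (E n →L[ℝ] ℝ))}
    (h : DifferentiableAt ℝ (phaseC φ c c') x) (hx : (pt n c' x.1, cotPar c x.2) ∈ criticalSet φ)
    (ζ : E n →L[ℝ] ℝ) : fderiv ℝ (phaseC φ c c') x (0, 0, 0, ζ) = 0 := by
  rw [fderiv_phaseC_eq_dη h]
  exact hx.2 _

/-- The inclusion of the fibre variable. -/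
def fibreIncl (n : ℕ) : (E n →L[ℝ] ℝ) →L[ℝ] (ℝ × E n) × (ℝ × E n × (E n →L[ℝ] ℝ)) :=
  (ContinuousLinearMap.inr ℝ (ℝ × E n) (ℝ × E n × (E n →L[ℝ] ℝ))).comp
    ((ContinuousLinearMap.inr ℝ ℝ (E n × (E n →L[ℝ] ℝ))).comp
      (ContinuousLinearMap.inr ℝ (E n) (E n →L[ℝ] ℝ)))

/-- Near the flow, a point is determined by `t`, `s`, `(y, η)` and the derivative `φ_η`. -/
theorem exists_injOn_phaseC (hε : 0 < ε) (hφ : IsLeviCivitaPhase N ε φ) (τ s : ℝ) (y : S)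
    {η : E n →L[ℝ] ℝ} (hη : η ≠ 0) :
    ∃ U ∈ 𝓝 ((coordPt n (g.flowx τ s y η) (τ, g.flowx τ s y η), (s, extChartAt (𝓡 n) y y, η)) :
      (ℝ × E n) × (ℝ × E n × (E n →L[ℝ] ℝ))),
      InjOn (fun x => (x.1.1, x.2, (fderiv ℝ (phaseC φ y (g.flowx τ s y η)) x).comp (fibreIncl n)))
        U := by
  set c := g.flowx τ s y η with hc
  set x₀ : (ℝ × E n) × (ℝ × E n × (E n →L[ℝ] ℝ)) :=
    (coordPt n c (τ, c), (s, extChartAt (𝓡 n) y y, η)) with hx₀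
  have h1 : ContDiffAt ℝ ∞ (phaseC φ y c) x₀ :=
    contDiffAt_phaseC hφ.smooth (mem_extChartAt_target c) rfl hη
  have h2 : ContDiffAt ℝ 1 (fderiv ℝ (phaseC φ y c)) x₀ :=
    h1.fderiv_right (one_add_one_eq_two.trans_le two_le_infty)
  have h3 : ContDiffAt ℝ 1 (fun x => (fderiv ℝ (phaseC φ y c) x).comp (fibreIncl n)) x₀ :=
    h2.clm_comp contDiffAt_const
  have h4 : ContDiffAt ℝ 1 (fun x : (ℝ × E n) × (ℝ × E n × (E n →L[ℝ] ℝ)) =>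
      (x.1.1, x.2, (fderiv ℝ (phaseC φ y c) x).comp (fibreIncl n))) x₀ :=
    contDiffAt_fst.fst.prodMk (contDiffAt_snd.prodMk h3)
  -- A kernel vector has no component in `t` or in the parameters, so only a spatial displacement
  -- `w` remains; the last component is then the mixed Hessian applied to `w`, which is
  -- nondegenerate.
  refine exists_injOn_of_injective_fderiv (h4.hasStrictFDerivAt (by norm_num)) fun v hv => ?_
  have h5 : HasFDerivAt (fun x : (ℝ × E n) × (ℝ × E n × (E n →L[ℝ] ℝ)) =>
      (x.1.1, x.2, (fderiv ℝ (phaseC φ y c) x).comp (fibreIncl n))) _ x₀ :=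
    hasFDerivAt_fst.fst.prodMk
      (hasFDerivAt_snd.prodMk (h3.differentiableAt (by norm_num)).hasFDerivAt)
  rw [h5.fderiv] at hv
  obtain ⟨⟨a, w⟩, b⟩ := v
  have e1 : a = 0 := congrArg (fun x : ℝ × _ × _ => x.1) hv
  have e2 : b = 0 := congrArg (fun x : ℝ × _ × _ => x.2.1) hv
  have e3 := congrArg (fun x : ℝ × _ × _ => x.2.2) hv
  subst e1 e2
  suffices hw : w = 0 by rw [hw]; rfl
  refine eq_zero_of_mixedHessian hε hφ τ s y hη ?_
  have j1 : ∀ x ζ, HasFDerivAt (fun y' : E n × (E n →L[ℝ] ℝ) =>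
      (((τ, y'.1), (s, extChartAt (𝓡 n) y y, y'.2)) : (ℝ × E n) × (ℝ × E n × (E n →L[ℝ] ℝ))))
      (((0 : E n × (E n →L[ℝ] ℝ) →L[ℝ] ℝ).prod (ContinuousLinearMap.fst ℝ _ _)).prod
        ((0 : E n × (E n →L[ℝ] ℝ) →L[ℝ] ℝ).prod ((0 : E n × (E n →L[ℝ] ℝ) →L[ℝ] E n).prod
          (ContinuousLinearMap.snd ℝ _ _)))) (x, ζ) := fun x ζ =>
    ((hasFDerivAt_const τ _).prodMk hasFDerivAt_fst).prodMk ((hasFDerivAt_const s _).prodMk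
      ((hasFDerivAt_const (extChartAt (𝓡 n) y y) _).prodMk hasFDerivAt_snd))
  have h6 : (fun x => (fderiv ℝ (phaseSlice φ τ c s y) (x, η)).comp
      (ContinuousLinearMap.inr ℝ (E n) (E n →L[ℝ] ℝ))) =ᶠ[𝓝 (extChartAt (𝓡 n) c c)]
      fun x => (fderiv ℝ (phaseC φ y c) ((τ, x), (s, extChartAt (𝓡 n) y y, η))).comp
        (fibreIncl n) := by
    have k1 : ContinuousAt (fun x : E n => (((τ, x), (s, extChartAt (𝓡 n) y y, η)) :
      (ℝ × E n) × (ℝ × E n × (E n →L[ℝ] ℝ)))) (extChartAt (𝓡 n) c c) := by fun_prop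
    filter_upwards [k1.eventually ((h1.of_le (by norm_num : (1 : WithTop ℕ∞) ≤ ∞)).eventually
      (by norm_num))] with x hx
    have k2 : HasFDerivAt (fun y' : E n × (E n →L[ℝ] ℝ) =>
        phaseC φ y c ((τ, y'.1), (s, extChartAt (𝓡 n) y y, y'.2))) _ (x, η) :=
      HasFDerivAt.comp (x, η) (f := fun y' : E n × (E n →L[ℝ] ℝ) =>
        (((τ, y'.1), (s, extChartAt (𝓡 n) y y, y'.2)) : (ℝ × E n) × (ℝ × E n × (E n →L[ℝ] ℝ))))
        (hx.differentiableAt (by norm_num)).hasFDerivAt (j1 x η)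
    rw [← funext (phaseSlice_eq φ τ c s y)] at k2
    rw [k2.fderiv]
    rfl
  have h7 : HasFDerivAt (fun x => (fderiv ℝ (phaseC φ y c)
      ((τ, x), (s, extChartAt (𝓡 n) y y, η))).comp (fibreIncl n)) _ (extChartAt (𝓡 n) c c) :=
    HasFDerivAt.comp (extChartAt (𝓡 n) c c)
      (f := fun x : E n => (((τ, x), (s, extChartAt (𝓡 n) y y, η)) :
        (ℝ × E n) × (ℝ × E n × (E n →L[ℝ] ℝ))))
      (h3.differentiableAt (by norm_num)).hasFDerivAt
      (HasFDerivAt.comp (extChartAt (𝓡 n) c c) (g := fun q : ℝ × E n =>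
        ((q, (s, extChartAt (𝓡 n) y y, η)) : (ℝ × E n) × (ℝ × E n × (E n →L[ℝ] ℝ))))
        (f := fun x : E n => (τ, x))
        (hasFDerivAt_prodMk_left (τ, extChartAt (𝓡 n) c c) (s, extChartAt (𝓡 n) y y, η)) (hasFDerivAt_prodMk_right τ (extChartAt (𝓡 n) c c)))
  have h8 := (hasFDerivAt_mixedHessian hφ τ s y hη).1.unique (h7.congr_of_eventuallyEq h6)
  rw [h8]
  exact e3

/-- A critical point near the flow is compared with the flow point having the same `τ`, `s`, `y` and
`η`, which is critical too and is close by continuity of the flow. -/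
theorem eventually_mem_flowSet (hε : 0 < ε) (hφ : IsLeviCivitaPhase N ε φ) (τ s : ℝ) (y : S)
    {η : E n →L[ℝ] ℝ} (hη : η ≠ 0) :
    ∀ᶠ p in 𝓝 ((τ, g.flowx τ s y η), s, (⟨y, η⟩ : CotBundle n S)),
      p ∈ criticalSet φ → p ∈ g.flowSet := by
  obtain ⟨z', h1, -, h2⟩ := exists_centered_flow_family N τ s y hη
  obtain ⟨U, hU, h3⟩ := exists_injOn_phaseC hε hφ τ s y hη
  set c := g.flowx τ s y η with hc
  set α₀ : ℝ × E n × (E n →L[ℝ] ℝ) := (s, extChartAt (𝓡 n) y y, η) with hα₀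
  have hs : c ∈ (chartAt (EuclideanSpace ℝ (Fin n)) c).source := mem_chart_source _ c
  have hz0 : (z' (τ, α₀)).1 = (τ, c) := by
    have e1 := h1.2.1.self_of_nhds
    have e2 := flow_eq_of_joins hη (parState_center (g := g) hη ▸ e1.1) e1.2
    exact Prod.ext e1.2 (congrArg Prod.snd (flowX_eq e2)).symm
  have hd : ∀ᶠ x in 𝓝 ((coordPt n c (τ, c), α₀) : (ℝ × E n) × (ℝ × E n × (E n →L[ℝ] ℝ))),
      x ∈ U ∧ DifferentiableAt ℝ (phaseC φ y c) x := by
    have k1 : ContDiffAt ℝ ∞ (phaseC φ y c) (coordPt n c (τ, c), α₀) :=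
      contDiffAt_phaseC hφ.smooth (mem_extChartAt_target c) rfl hη
    exact (Filter.eventually_mem_set.2 hU).and
      (((k1.of_le (by norm_num : (1 : WithTop ℕ∞) ≤ ∞)).eventually (by norm_num)).mono
        fun x hx => hx.differentiableAt (by norm_num))
  have k2 : ContinuousAt (fun β => (coordPt n c (z' β).1, β.2)) (τ, α₀) :=
    h1.1.smooth_fst.continuousAt.prodMk continuousAt_snd
  have hd' : ∀ᶠ β in 𝓝 (τ, α₀), (coordPt n c (z' β).1, β.2) ∈ U ∧
      DifferentiableAt ℝ (phaseC φ y c) (coordPt n c (z' β).1, β.2) := by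
    refine k2.eventually (p := fun x => x ∈ U ∧ DifferentiableAt ℝ (phaseC φ y c) x) ?_
    dsimp only
    rw [hz0]
    exact hd
  have hcot : cotCoord y ((s, ⟨y, η⟩) : ℝ × CotBundle n S) = α₀ := by
    have h3 : η.comp (chartDsymm n y (extChartAt (𝓡 n) y y)) = η := by
      rw [chartDsymm_self]
      exact ContinuousLinearMap.comp_id _
    exact congrArg (fun ζ : E n →L[ℝ] ℝ => (s, extChartAt (𝓡 n) y y, ζ)) h3
  have c1 : ContinuousAt (fun p : (ℝ × S) × ℝ × CotBundle n S => coordPt n c p.1)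
      ((τ, c), s, ⟨y, η⟩) :=
    ContinuousAt.comp (g := coordPt n c) (f := fun p : (ℝ × S) × ℝ × CotBundle n S => p.1)
      (continuousAt_coordPt hs) continuousAt_fst
  have c2 : ContinuousAt (fun p : (ℝ × S) × ℝ × CotBundle n S => cotCoord y p.2)
      ((τ, c), s, ⟨y, η⟩) :=
    ContinuousAt.comp (g := cotCoord (n := n) y)
      (f := fun p : (ℝ × S) × ℝ × CotBundle n S => p.2)
      (x := ((τ, c), s, (⟨y, η⟩ : CotBundle n S))) (continuousAt_cotCoord rfl) continuousAt_snd
  have c3 : ContinuousAt (fun p : (ℝ × S) × ℝ × CotBundle n S => (p.1.1, cotCoord y p.2))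
      ((τ, c), s, ⟨y, η⟩) := (continuousAt_fst.fst).prodMk c2
  have c4 : ContinuousAt (fun p : (ℝ × S) × ℝ × CotBundle n S => p.1.2) ((τ, c), s, ⟨y, η⟩) :=
    continuousAt_fst.snd
  have c5 : ContinuousAt (fun p : (ℝ × S) × ℝ × CotBundle n S => p.2.2.1) ((τ, c), s, ⟨y, η⟩) :=
    ContinuousAt.comp (g := fun q : CotBundle n S => q.1)
      (f := fun p : (ℝ × S) × ℝ × CotBundle n S => p.2.2)
      (FiberBundle.continuous_proj (E n →L[ℝ] ℝ) _).continuousAt continuousAt_snd.snd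
  have t1 := (c1.prodMk c2).tendsto
  have t3 := c3.tendsto
  rw [hcot] at t1 t3
  filter_upwards [t1.eventually hd, t3.eventually hd', t3.eventually h2, t3.eventually h1.2.1,
    t3.eventually h1.1.eventually_source,
    c4.eventually ((chartAt (EuclideanSpace ℝ (Fin n)) c).open_source.mem_nhds hs),
    c5.eventually ((chartAt (EuclideanSpace ℝ (Fin n)) y).open_source.mem_nhds
      (mem_chart_source _ y))] with p a1 a2 a3 a4 a5 a6 a7 hp
  set β := (p.1.1, cotCoord y p.2) with hβ
  have b1 : (pt n c (coordPt n c p.1), cotPar y (cotCoord y p.2)) = p := by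
    rw [pt_coordPt a6, cotPar_cotCoord a7]
  have b2 : pt n c (coordPt n c (z' β).1) = (z' β).1 := pt_coordPt a5
  have b3 : (pt n c (coordPt n c (z' β).1), cotPar y (cotCoord y p.2)) ∈ g.flowSet := by
    refine ⟨p.1.1, (cotCoord y p.2).1, (extChartAt (𝓡 n) y).symm (cotCoord y p.2).2.1,
      (cotCoord y p.2).2.2.comp (chartD n y ((extChartAt (𝓡 n) y).symm (cotCoord y p.2).2.1)),
      comp_chartD_ne_zero a3.1 a3.2.1, ?_⟩
    refine Prod.ext ?_ rfl
    rw [b2]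
    exact Prod.ext a4.2 (congrArg Prod.snd (flowX_eq a3.2.2)).symm
  -- Both points have the same time and parameters and `φ_η = 0`, so local injectivity identifies
  -- them.
  have b4 : (coordPt n c p.1, cotCoord y p.2) = (coordPt n c (z' β).1, cotCoord y p.2) := by
    refine h3 a1.1 a2.1 (Prod.ext a4.2.symm (Prod.ext rfl ?_))
    refine ContinuousLinearMap.ext fun ζ => ?_
    refine (fderiv_phaseC_eq_zero a1.2 (by rw [b1]; exact hp) ζ).trans ?_
    exact (fderiv_phaseC_eq_zero a2.2 (flowSet_subset_criticalSet hε hφ b3) ζ).symm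
  rw [← b1, (Prod.mk.inj b4).1]
  exact b3

theorem exists_isolating_neighbourhood (hε : 0 < ε) (hφ : IsLeviCivitaPhase N ε φ) :
    ∃ W : Set ((ℝ × S) × ℝ × CotBundle n S),
      IsOpen W ∧ g.flowSet ⊆ W ∧ criticalSet φ ∩ (W \ g.flowSet) = ∅ := by
  refine ⟨interior {p | p ∈ criticalSet φ → p ∈ g.flowSet}, isOpen_interior, ?_, ?_⟩
  · rintro _ ⟨τ, s, y, η, hη, rfl⟩
    exact mem_interior_iff_mem_nhds.2 (eventually_mem_flowSet hε hφ τ s y hη)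
  · refine eq_empty_of_forall_notMem fun p hp => hp.2.2 (interior_subset hp.2.1 hp.1)

end Spacetime

end LorentzianPhase

end

end

theorem mainTheorem3 {n : ℕ} (hn : 2 ≤ n) {S : Type*} [TopologicalSpace S] [T2Space S]
    [CompactSpace S] [ChartedSpace (EuclideanSpace ℝ (Fin n)) S] [IsManifold (𝓡 n) ∞ S]
    (g : LorentzianPhase.Spacetime n S) (N : g.NormalNeighbourhoods) (ε : ℝ) (hε : 0 < ε)
    (φ : (ℝ × S) × ℝ × LorentzianPhase.CotBundle n S → ℂ)
    (hφ : LorentzianPhase.Spacetime.IsLeviCivitaPhase N ε φ) :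
    -- homogeneity
    (∀ (τ : ℝ) (x : S) (s : ℝ) (y : S) (η : LorentzianPhase.CotS n y), η ≠ 0 →
      ∀ c : ℝ, 0 < c → φ ((τ, x), s, ⟨y, c • η⟩) = (c : ℂ) * φ ((τ, x), s, ⟨y, η⟩)) ∧
    -- sign of the imaginary part
    (∀ (τ : ℝ) (x : S) (s : ℝ) (y : S) (η : LorentzianPhase.CotS n y), η ≠ 0 →
      0 ≤ (φ ((τ, x), s, ⟨y, η⟩)).im) ∧
    -- behaviour on the flow
    (∀ (τ s : ℝ) (y : S) (η : LorentzianPhase.CotS n y), η ≠ 0 →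
      φ ((τ, g.flowx τ s y η), s, ⟨y, η⟩) = 0 ∧
      (∀ v : LorentzianPhase.TanS n (g.flowx τ s y η),
        LorentzianPhase.dx (fun x => φ ((τ, x), s, ⟨y, η⟩)) (g.flowx τ s y η) v =
          ((g.flowξ τ s y η v : ℝ) : ℂ)) ∧
      (∀ (b : Module.Basis (Fin n) ℝ (LorentzianPhase.TanS n (g.flowx τ s y η)))
        (e : Module.Basis (Fin n) ℝ (LorentzianPhase.CotS n y)),
        (Matrix.of fun i j : Fin n =>
          LorentzianPhase.dx (fun x => LorentzianPhase.dη φ (τ, x) s y η (e j))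
            (g.flowx τ s y η) (b i)).det ≠ 0)) ∧
    -- the flow set is contained in the critical set and isolated in it
    g.flowSet ⊆ LorentzianPhase.criticalSet φ ∧
    ∃ W : Set ((ℝ × S) × ℝ × LorentzianPhase.CotBundle n S),
      IsOpen W ∧ g.flowSet ⊆ W ∧ LorentzianPhase.criticalSet φ ∩ (W \ g.flowSet) = ∅ := by
  refine ⟨fun τ x s y η hη c hc => hφ.homogeneous τ x s y η hη hc,
    fun τ x s y η hη => hφ.im_nonneg hε τ x s y η hη, fun τ s y η hη => ⟨hφ.eq_zero hε τ s y hη,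
      fun v => hφ.dx_eq_flowξ hε τ s y hη v,
      fun b e => LorentzianPhase.Spacetime.det_dx_dη_ne_zero hε hφ τ s y hη b e⟩,
    LorentzianPhase.Spacetime.flowSet_subset_criticalSet hε hφ,
    LorentzianPhase.Spacetime.exists_isolating_neighbourhood hε hφ⟩
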